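/- Theorem 5.1. Let $G=\mathrm{SL}(3,\mathbb{R})$ and let $P\le G$ be the minimal parabolic subgroup of upper triangular matrices, so that $G/P$ (with the quotient topology) is the variety of complete flags in $\mathbb{R}^3$. Let $\Gamma$ be a subgroup of $\mathrm{SL}(3,\mathbb{Z})$ which is Zariski-dense in $G$, i.e. every real polynomial in the matrix entries that vanishes on $\Gamma$ vanishes on $G$. Suppose that $\Gamma$ satisfies at least one of the following conditions: 1. $\Gamma$ contains a subgroup isomorphic to $\mathbb{Z}^2$; 2. $\Gamma$ contains a standard copy of $\mathrm{SL}(2,\mathbb{Z})$, i.e. for some $h\in \mathrm{SL}(3,\mathbb{R})$ it contains the subgroup $h\left\{\begin{pmatrix}A&0\\0&1\end{pmatrix} : A\in \mathrm{SL}(2,\mathbb{Z})\right\}h^{-1}$; 3. $\Gamma$ contains an element of infinite order which has at least one non-real complex eigenvalue. Then $\Gamma$ acts minimally on $G/P$, i.e. every $\Gamma$-orbit in $G/P$ is dense; and, equivalently, $P$ acts minimally (by right multiplication) on $\Gamma\backslash G$, i.e. every $P$-orbit in $\Gamma\backslash G$, with the quotient topology, is dense. -/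

import Mathlib

open scoped MatrixGroups

namespace SLThree

/-- A subset `S` of `SL(n, ℝ)` is Zariski-dense if every real polynomial in the `n²` matrix entries
which vanishes on `S` vanishes on all of `SL(n, ℝ)`. -/
def IsZariskiDense {n : ℕ} (S : Set SL(n, ℝ)) : Prop :=
  ∀ p : MvPolynomial (Fin n × Fin n) ℝ,
    (∀ g ∈ S, MvPolynomial.eval (fun ij => (g : Matrix (Fin n) (Fin n) ℝ) ij.1 ij.2) p = 0) →
      ∀ g : SL(n, ℝ), MvPolynomial.eval (fun ij => (g : Matrix (Fin n) (Fin n) ℝ) ij.1 ij.2) p = 0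

/-- The subgroup `SL(3, ℤ)` of `SL(3, ℝ)`. -/
def integerSL3 : Subgroup SL(3, ℝ) :=
  (Matrix.SpecialLinearGroup.map (n := Fin 3) (Int.castRingHom ℝ)).range

/-- The standard minimal parabolic subgroup `P` of `SL(n, ℝ)`: the upper triangular matrices. -/
def minimalParabolic (n : ℕ) : Subgroup SL(n, ℝ) where
  carrier := {g | (g : Matrix (Fin n) (Fin n) ℝ).BlockTriangular id}
  one_mem' := Matrix.blockTriangular_one
  mul_mem' ha hb := ha.mul hb
  inv_mem' := by
    intro g hg
    have h1 : ((g⁻¹ : SL(n, ℝ)) : Matrix (Fin n) (Fin n) ℝ) * (g : Matrix (Fin n) (Fin n) ℝ) = 1 := by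
      rw [← Matrix.SpecialLinearGroup.coe_mul, inv_mul_cancel, Matrix.SpecialLinearGroup.coe_one]
    have : Invertible (g : Matrix (Fin n) (Fin n) ℝ) :=
      ⟨_, h1, mul_eq_one_comm.1 h1⟩
    have h := Matrix.blockTriangular_inv_of_blockTriangular
      (M := (g : Matrix (Fin n) (Fin n) ℝ)) (b := id) hg
    rw [Matrix.inv_eq_left_inv h1] at h
    exact h

/-- The real `3 × 3` block-diagonal matrix `diag(A, 1)` of an integral `2 × 2` matrix `A`. -/
def blockMatrix (A : Matrix (Fin 2) (Fin 2) ℤ) : Matrix (Fin 3) (Fin 3) ℝ :=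
  !![(A 0 0 : ℝ), (A 0 1 : ℝ), 0;
     (A 1 0 : ℝ), (A 1 1 : ℝ), 0;
     0, 0, 1]

theorem blockMatrix_one : blockMatrix 1 = 1 := by
  ext i j
  fin_cases i <;> fin_cases j <;> simp [blockMatrix]

theorem blockMatrix_mul (A B : Matrix (Fin 2) (Fin 2) ℤ) :
    blockMatrix (A * B) = blockMatrix A * blockMatrix B := by
  ext i j
  fin_cases i <;> fin_cases j <;>
    simp [blockMatrix, Matrix.mul_apply, Fin.sum_univ_two, Fin.sum_univ_three]

theorem det_blockMatrix (A : Matrix (Fin 2) (Fin 2) ℤ) : (blockMatrix A).det = (A.det : ℝ) := by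
  simp [blockMatrix, Matrix.det_fin_three, Matrix.det_fin_two]

/-- The block-diagonal inclusion `SL(2, ℤ) → SL(3, ℝ)`, `A ↦ diag(A, 1)`. -/
def blockSL2 : SL(2, ℤ) →* SL(3, ℝ) where
  toFun A := ⟨blockMatrix A, by
    rw [det_blockMatrix, Matrix.SpecialLinearGroup.det_coe, Int.cast_one]⟩
  map_one' := Subtype.ext blockMatrix_one
  map_mul' A B := Subtype.ext (blockMatrix_mul A B)

/-- A subgroup of `SL(3, ℝ)` is a standard copy of `SL(2, ℤ)` if, in some basis of `ℝ³`, it is the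
group of all matrices `diag(A, 1)` with `A ∈ SL(2, ℤ)`. (A change of basis can be rescaled to have
determinant one without changing the conjugated group.) -/
def IsStandardSL2Z (H : Subgroup SL(3, ℝ)) : Prop :=
  ∃ h : SL(3, ℝ), H = ((MulAut.conj h).toMonoidHom.comp blockSL2).range

/-- `μ` is a complex eigenvalue of the real matrix `g`. -/
def HasComplexEigenvalue (g : SL(3, ℝ)) (μ : ℂ) : Prop :=
  Module.End.HasEigenvalue (Matrix.toLin' ((g : Matrix (Fin 3) (Fin 3) ℝ).map (fun x : ℝ => (x : ℂ)))) μ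

/-- The space `Γ \ G` of cosets `Γ g`, with the quotient topology. -/
abbrev RightCosets {G : Type*} [Group G] (Γ : Subgroup G) : Type _ :=
  Quotient (QuotientGroup.rightRel Γ)

/-- The action of a subgroup `P` of `G` on `Γ \ G` by right multiplication, written as a left
action: `p • Γ g = Γ g p⁻¹`. -/
instance rightCosetsAction {G : Type*} [Group G] (Γ P : Subgroup G) :
    MulAction P (RightCosets Γ) where
  smul p := Quotient.map' (fun g => g * (p : G)⁻¹) (by
    intro a b hab
    rw [QuotientGroup.rightRel_apply] at hab ⊢
    simpa [mul_assoc] using hab)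
  one_smul x := by
    induction x using Quotient.inductionOn' with
    | h g => exact congrArg Quotient.mk'' (by simp)
  mul_smul p q x := by
    induction x using Quotient.inductionOn' with
    | h g => exact congrArg Quotient.mk'' (by simp [mul_assoc])

end SLThree

namespace SLThree

open Matrix Filter Topology

/-- Column vectors and linear forms on `ℝ³`. -/
abbrev Vec : Type := Fin 3 → ℝ

/-- Pairs `(x, φ)` of a nonzero vector and a nonzero linear form vanishing on it. Up to scaling
these are the complete flags of `ℝ³`. -/
def flags : Set (Vec × Vec) := {q | q.1 ≠ 0 ∧ q.2 ≠ 0 ∧ q.1 ⬝ᵥ q.2 = 0}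

/-- The matrix of an element of `SL(3, ℝ)`. -/
def mat (g : SL(3, ℝ)) : Matrix (Fin 3) (Fin 3) ℝ := g

theorem mat_mul (g k : SL(3, ℝ)) : mat (g * k) = mat g * mat k := rfl

theorem mat_one : mat 1 = 1 := rfl

/-- The element of `SL(3, ℝ)` given by a matrix of determinant one. -/
def mkSL (A : Matrix (Fin 3) (Fin 3) ℝ) (h : A.det = 1) : SL(3, ℝ) := ⟨A, h⟩

theorem mat_mkSL (A : Matrix (Fin 3) (Fin 3) ℝ) (h : A.det = 1) : mat (mkSL A h) = A := rfl

theorem mat_injective : Function.Injective mat := Subtype.val_injective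

theorem det_mat (g : SL(3, ℝ)) : (mat g).det = 1 := g.2

theorem mat_inv (g : SL(3, ℝ)) : mat g⁻¹ = (mat g).adjugate := rfl

theorem inv_mul_coe (g : SL(3, ℝ)) : mat g⁻¹ * mat g = 1 := by
  rw [← mat_mul, inv_mul_cancel, mat_one]

theorem mul_inv_coe (g : SL(3, ℝ)) : mat g * mat g⁻¹ = 1 := by
  rw [← mat_mul, mul_inv_cancel, mat_one]

theorem dotProduct_act (g : SL(3, ℝ)) (x φ : Vec) :
    (mat g *ᵥ x) ⬝ᵥ (φ ᵥ* mat (g⁻¹)) = x ⬝ᵥ φ := by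
  rw [dotProduct_comm, ← dotProduct_mulVec, mulVec_mulVec, inv_mul_coe, one_mulVec,
    dotProduct_comm]

theorem mulVec_ne_zero (g : SL(3, ℝ)) {x : Vec} (hx : x ≠ 0) : mat g *ᵥ x ≠ 0 := by
  intro h
  apply hx
  rw [← one_mulVec x, ← inv_mul_coe g, ← mulVec_mulVec, h, mulVec_zero]

theorem vecMul_ne_zero (g : SL(3, ℝ)) {x : Vec} (hx : x ≠ 0) : x ᵥ* mat g ≠ 0 := by
  intro h
  apply hx
  rw [← vecMul_one x, ← mul_inv_coe g, ← vecMul_vecMul, h, zero_vecMul]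

theorem act_mem_flags (g : SL(3, ℝ)) {x φ : Vec} (h : (x, φ) ∈ flags) :
    (mat g *ᵥ x, φ ᵥ* mat (g⁻¹)) ∈ flags :=
  ⟨mulVec_ne_zero g h.1, vecMul_ne_zero g⁻¹ h.2.1, by
    simpa only [dotProduct_act] using h.2.2⟩

theorem smul_mem_flags {x φ : Vec} {s t : ℝ} (hs : s ≠ 0) (ht : t ≠ 0) (h : (x, φ) ∈ flags) :
    (s • x, t • φ) ∈ flags :=
  ⟨smul_ne_zero hs h.1, smul_ne_zero ht h.2.1, by
    have := h.2.2
    simp only [] at this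
    simp [this]⟩

/-- A nonempty set of flags which is stable under scaling and under `Γ`, and closed in the space of
flags. -/
structure InvClosed (Γ : Subgroup SL(3, ℝ)) (M : Set (Vec × Vec)) : Prop where
  subset : M ⊆ flags
  nonempty : M.Nonempty
  smul_mem : ∀ {x φ : Vec} {s t : ℝ}, s ≠ 0 → t ≠ 0 → (x, φ) ∈ M → (s • x, t • φ) ∈ M
  act_mem : ∀ {g : SL(3, ℝ)} {x φ : Vec}, g ∈ Γ → (x, φ) ∈ M → (mat g *ᵥ x, φ ᵥ* mat (g⁻¹)) ∈ M
  mem_of_mem_closure : ∀ {q : Vec × Vec}, q ∈ flags → q ∈ closure M → q ∈ M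

/-- `Γ` acts minimally on flags. -/
def FlagMinimal (Γ : Subgroup SL(3, ℝ)) : Prop :=
  ∀ M : Set (Vec × Vec), InvClosed Γ M → flags ⊆ M

theorem dotProduct_self_pos {x : Vec} (hx : x ≠ 0) : 0 < x ⬝ᵥ x := by
  have h : 0 ≤ x ⬝ᵥ x := Finset.sum_nonneg fun i _ => mul_self_nonneg (x i)
  exact h.lt_of_ne' fun h0 => hx (dotProduct_self_eq_zero.1 h0)

/-- The matrix with columns `c • x`, `φ × x` and `φ`. -/
def frameMatrix (c : ℝ) (x φ : Vec) : Matrix (Fin 3) (Fin 3) ℝ :=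
  !![c * x 0, φ 1 * x 2 - φ 2 * x 1, φ 0;
     c * x 1, φ 2 * x 0 - φ 0 * x 2, φ 1;
     c * x 2, φ 0 * x 1 - φ 1 * x 0, φ 2]

theorem det_frameMatrix (c : ℝ) (x φ : Vec) :
    (frameMatrix c x φ).det = c * ((x ⬝ᵥ x) * (φ ⬝ᵥ φ) - (x ⬝ᵥ φ) ^ 2) := by
  simp [frameMatrix, det_fin_three, dotProduct, Fin.sum_univ_three]
  ring

/-- A matrix of determinant one whose first column is proportional to `x` and whose first two
columns span the kernel of `φ`. -/
noncomputable def flagFrame (q : flags) : SL(3, ℝ) :=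
  ⟨frameMatrix ((q.1.1 ⬝ᵥ q.1.1) * (q.1.2 ⬝ᵥ q.1.2))⁻¹ q.1.1 q.1.2, by
    obtain ⟨⟨x, φ⟩, hx, hφ, h⟩ := q
    have h1 := (dotProduct_self_pos hx).ne'
    have h2 := (dotProduct_self_pos hφ).ne'
    simp only at h1 h2 h ⊢
    rw [det_frameMatrix, h, zero_pow two_ne_zero, sub_zero, inv_mul_cancel₀ (mul_ne_zero h1 h2)]⟩

theorem mat_flagFrame (q : flags) : mat (flagFrame q) =
    frameMatrix ((q.1.1 ⬝ᵥ q.1.1) * (q.1.2 ⬝ᵥ q.1.2))⁻¹ q.1.1 q.1.2 := rfl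

theorem flagFrame_mulVec (q : flags) : ∃ c : ℝ, c ≠ 0 ∧
    mat (flagFrame q) *ᵥ Pi.single 0 1 = c • q.1.1 := by
  obtain ⟨⟨x, φ⟩, hx, hφ, h⟩ := q
  refine ⟨((x ⬝ᵥ x) * (φ ⬝ᵥ φ))⁻¹, inv_ne_zero (mul_ne_zero (dotProduct_self_pos hx).ne'
    (dotProduct_self_pos hφ).ne'), ?_⟩
  rw [mulVec_single_one, mat_flagFrame]
  ext i
  fin_cases i <;> rfl

theorem flagFrame_vecMul (q : flags) : ∃ c : ℝ, c ≠ 0 ∧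
    Pi.single 2 1 ᵥ* mat (flagFrame q)⁻¹ = c • q.1.2 := by
  have h2 := (dotProduct_self_pos q.2.2.1).ne'
  have key : q.1.2 ᵥ* mat (flagFrame q) = (q.1.2 ⬝ᵥ q.1.2) • Pi.single 2 1 := by
    have h := q.2.2.2
    rw [mat_flagFrame]
    generalize ((q.1.1 ⬝ᵥ q.1.1) * (q.1.2 ⬝ᵥ q.1.2))⁻¹ = c
    generalize q.1.1 = x at *
    generalize q.1.2 = φ at *
    simp only [dotProduct, Fin.sum_univ_three] at h
    ext i
    fin_cases i
    · simp [frameMatrix, vecMul, dotProduct, Fin.sum_univ_three]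
      linear_combination c * h
    · simp [frameMatrix, vecMul, dotProduct, Fin.sum_univ_three]
      ring
    · simp [frameMatrix, vecMul, dotProduct, Fin.sum_univ_three]
  refine ⟨(q.1.2 ⬝ᵥ q.1.2)⁻¹, inv_ne_zero h2, ?_⟩
  rw [eq_inv_smul_iff₀ h2, ← smul_vecMul, ← key, vecMul_vecMul, mul_inv_coe, vecMul_one]

theorem continuous_flagFrame : Continuous flagFrame := by
  have h1 : Continuous fun q : flags => q.1.1 := continuous_fst.comp continuous_subtype_val
  have h2 : Continuous fun q : flags => q.1.2 := continuous_snd.comp continuous_subtype_val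
  have h3 : Continuous fun q : flags => ((q.1.1 ⬝ᵥ q.1.1) * (q.1.2 ⬝ᵥ q.1.2))⁻¹ :=
    Continuous.inv₀ ((h1.dotProduct h1).mul (h2.dotProduct h2)) fun q =>
      mul_ne_zero (dotProduct_self_pos q.2.1).ne' (dotProduct_self_pos q.2.2.1).ne'
  have e1 := fun i => (continuous_apply i).comp h1
  have e2 := fun i => (continuous_apply i).comp h2
  refine Continuous.subtype_mk (continuous_matrix fun i j => ?_) _
  fin_cases i <;> fin_cases j
  · exact h3.mul (e1 0)
  · exact ((e2 1).mul (e1 2)).sub ((e2 2).mul (e1 1))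
  · exact e2 0
  · exact h3.mul (e1 1)
  · exact ((e2 2).mul (e1 0)).sub ((e2 0).mul (e1 2))
  · exact e2 1
  · exact h3.mul (e1 2)
  · exact ((e2 0).mul (e1 1)).sub ((e2 1).mul (e1 0))
  · exact e2 2

theorem mk_eq_mk_of_proportional {g k : SL(3, ℝ)} {s t : ℝ}
    (hs : mat g *ᵥ Pi.single 0 1 = s • mat k *ᵥ Pi.single 0 1)
    (ht : Pi.single 2 1 ᵥ* mat (g⁻¹) = t • Pi.single 2 1 ᵥ* mat (k⁻¹)) :
    (k : SL(3, ℝ) ⧸ minimalParabolic 3) = g := by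
  rw [QuotientGroup.eq]
  have h1 : mat (k⁻¹ * g) *ᵥ Pi.single 0 1 = s • Pi.single 0 1 := by
    rw [mat_mul, ← mulVec_mulVec, hs, mulVec_smul, mulVec_mulVec, inv_mul_coe,
      one_mulVec]
  have h2 : Pi.single 2 1 = t • Pi.single 2 1 ᵥ* mat (k⁻¹ * g) := by
    rw [mat_mul, ← vecMul_vecMul, ← smul_vecMul, ← ht, vecMul_vecMul,
      inv_mul_coe, vecMul_one]
  have ht0 : t ≠ 0 := by
    rintro rfl
    have := congrFun h2 2
    simp at this
  rw [mulVec_single_one] at h1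
  rw [single_one_vecMul] at h2
  have a1 := congrFun h1 1
  have a2 := congrFun h1 2
  have b1 := congrFun h2 1
  simp [ht0] at a1 a2 b1
  intro i j hij
  fin_cases i <;> fin_cases j <;> simp at hij ⊢ <;> assumption

theorem mk_flagFrame_eq {q : flags} {g : SL(3, ℝ)} {c d : ℝ}
    (hc : mat g *ᵥ Pi.single 0 1 = c • q.1.1) (hd : Pi.single 2 1 ᵥ* mat (g⁻¹) = d • q.1.2) :
    (flagFrame q : SL(3, ℝ) ⧸ minimalParabolic 3) = g := by
  obtain ⟨c', hc', h1⟩ := flagFrame_mulVec q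
  obtain ⟨d', hd', h2⟩ := flagFrame_vecMul q
  refine mk_eq_mk_of_proportional (s := c * c'⁻¹) (t := d * d'⁻¹) ?_ ?_
  · rw [h1, hc, smul_smul, mul_assoc, inv_mul_cancel₀ hc', mul_one]
  · rw [h2, hd, smul_smul, mul_assoc, inv_mul_cancel₀ hd', mul_one]

theorem base_mem_flags : ((Pi.single 0 1, Pi.single 2 1) : Vec × Vec) ∈ flags := by
  refine ⟨?_, ?_, ?_⟩ <;> simp

theorem invClosed_preimage (Γ : Subgroup SL(3, ℝ)) {Z : Set (SL(3, ℝ) ⧸ minimalParabolic 3)}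
    (hZ : IsClosed Z) (hne : Z.Nonempty) (hΓ : ∀ g ∈ Γ, ∀ z ∈ Z, g • z ∈ Z) :
    InvClosed Γ (Subtype.val ''
      {q : flags | (flagFrame q : SL(3, ℝ) ⧸ minimalParabolic 3) ∈ Z}) where
  subset := by rintro _ ⟨q, -, rfl⟩; exact q.2
  nonempty := by
    obtain ⟨z, hz⟩ := hne
    induction z using QuotientGroup.induction_on with
    | H g =>
      have h0 := base_mem_flags
      refine ⟨_, ⟨_, act_mem_flags g h0⟩, ?_, rfl⟩
      rw [Set.mem_ofPred_eq, mk_flagFrame_eq (g := g) (c := 1) (d := 1)]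
      · exact hz
      · simp
      · simp
  smul_mem := by
    rintro x φ s t hs ht ⟨q, hq, h⟩
    obtain ⟨c', hc', h1⟩ := flagFrame_mulVec q
    obtain ⟨d', hd', h2⟩ := flagFrame_vecMul q
    rw [h] at h1 h2
    refine ⟨⟨_, smul_mem_flags hs ht (h ▸ q.2)⟩, ?_, rfl⟩
    rw [Set.mem_ofPred_eq, mk_flagFrame_eq (g := flagFrame q) (c := c' * s⁻¹) (d := d' * t⁻¹)]
    · exact hq
    · rw [h1, smul_smul, mul_assoc, inv_mul_cancel₀ hs, mul_one]
    · rw [h2, smul_smul, mul_assoc, inv_mul_cancel₀ ht, mul_one]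
  act_mem := by
    rintro g x φ hg ⟨q, hq, h⟩
    obtain ⟨c', hc', h1⟩ := flagFrame_mulVec q
    obtain ⟨d', hd', h2⟩ := flagFrame_vecMul q
    rw [h] at h1 h2
    refine ⟨⟨_, act_mem_flags g (h ▸ q.2)⟩, ?_, rfl⟩
    rw [Set.mem_ofPred_eq, mk_flagFrame_eq (g := g * flagFrame q) (c := c') (d := d')]
    · exact hΓ g hg _ hq
    · rw [mat_mul, ← mulVec_mulVec, h1, mulVec_smul]
    · rw [_root_.mul_inv_rev, mat_mul, ← vecMul_vecMul, h2, smul_vecMul]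
  mem_of_mem_closure := by
    intro q hq hcl
    have hc : IsClosed {q : flags | (flagFrame q : SL(3, ℝ) ⧸ minimalParabolic 3) ∈ Z} :=
      hZ.preimage (QuotientGroup.continuous_mk.comp continuous_flagFrame)
    have := (closure_subtype (x := ⟨q, hq⟩)).2 hcl
    rw [hc.closure_eq] at this
    exact ⟨⟨q, hq⟩, this, rfl⟩

theorem FlagMinimal.isMinimal {Γ : Subgroup SL(3, ℝ)} (h : FlagMinimal Γ) :
    MulAction.IsMinimal Γ (SL(3, ℝ) ⧸ minimalParabolic 3) := by
  refine ⟨fun z => ?_⟩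
  have hZ : ∀ g ∈ Γ, ∀ w ∈ closure (MulAction.orbit Γ z),
      g • w ∈ closure (MulAction.orbit Γ z) := by
    intro g hg w hw
    have hc : Continuous fun y : SL(3, ℝ) ⧸ minimalParabolic 3 => g • y := continuous_const_smul g
    refine map_mem_closure hc hw ?_
    rintro _ ⟨k, rfl⟩
    exact ⟨(⟨g, hg⟩ : Γ) * k, mul_smul (⟨g, hg⟩ : Γ) k z⟩
  have hne : (closure (MulAction.orbit Γ z)).Nonempty :=
    ⟨z, subset_closure (MulAction.mem_orbit_self z)⟩
  have key := h _ (invClosed_preimage Γ isClosed_closure hne hZ)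
  intro w
  induction w using QuotientGroup.induction_on with
  | H g =>
    have h0 := base_mem_flags
    obtain ⟨q, hq, he⟩ := key (act_mem_flags g h0)
    rw [Set.mem_ofPred_eq, mk_flagFrame_eq (g := g) (c := 1) (d := 1)] at hq
    · exact hq
    · rw [he]; simp
    · rw [he]; simp

theorem isMinimal_rightCosets {G : Type*} [Group G] [TopologicalSpace G] [IsTopologicalGroup G]
    (Γ P : Subgroup G) (h : MulAction.IsMinimal Γ (G ⧸ P)) :
    MulAction.IsMinimal P (RightCosets Γ) := by
  refine ⟨fun z => ?_⟩
  induction z using Quotient.inductionOn' with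
  | h g =>
    have h1 := (h.dense_orbit (g : G ⧸ P)).preimage QuotientGroup.isOpenMap_coe
    have h2 : Dense ((Quotient.mk (QuotientGroup.rightRel Γ)) ''
        ((QuotientGroup.mk : G → G ⧸ P) ⁻¹' MulAction.orbit Γ (g : G ⧸ P))) :=
      (Quotient.mk_surjective.denseRange).dense_image continuous_quotient_mk' h1
    refine h2.mono ?_
    rintro _ ⟨k, ⟨γ, hk⟩, rfl⟩
    have hk' : ((γ.1 * g : G) : G ⧸ P) = k := hk
    rw [QuotientGroup.eq] at hk'
    refine ⟨⟨_, inv_mem hk'⟩, ?_⟩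
    refine Quotient.sound' ?_
    rw [QuotientGroup.rightRel_apply]
    simp [mul_assoc]

theorem inv_mulVec_mulVec (g : SL(3, ℝ)) (x : Vec) : mat g⁻¹ *ᵥ (mat g *ᵥ x) = x := by
  rw [mulVec_mulVec, inv_mul_coe, one_mulVec]

theorem mulVec_inv_mulVec (g : SL(3, ℝ)) (x : Vec) : mat g *ᵥ (mat g⁻¹ *ᵥ x) = x := by
  rw [mulVec_mulVec, mul_inv_coe, one_mulVec]

theorem vecMul_vecMul_inv (g : SL(3, ℝ)) (x : Vec) : (x ᵥ* mat g) ᵥ* mat g⁻¹ = x := by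
  rw [vecMul_vecMul, mul_inv_coe, vecMul_one]

theorem vecMul_inv_vecMul (g : SL(3, ℝ)) (x : Vec) : (x ᵥ* mat g⁻¹) ᵥ* mat g = x := by
  rw [vecMul_vecMul, inv_mul_coe, vecMul_one]

/-! ### Duality and conjugation -/

/-- The group of transposes of the elements of `Γ`. -/
def dual (Γ : Subgroup SL(3, ℝ)) : Subgroup SL(3, ℝ) where
  carrier := {g | g.transpose ∈ Γ}
  one_mem' := by
    have : (1 : SL(3, ℝ)).transpose = 1 := Subtype.ext transpose_one
    rw [Set.mem_ofPred_eq, this]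
    exact one_mem Γ
  mul_mem' {a b} ha hb := by
    have : (a * b).transpose = b.transpose * a.transpose := Subtype.ext (transpose_mul a.1 b.1)
    rw [Set.mem_ofPred_eq, this]
    exact mul_mem hb ha
  inv_mem' {a} ha := by
    have : a⁻¹.transpose = a.transpose⁻¹ := Subtype.ext (adjugate_transpose a.1)
    rw [Set.mem_ofPred_eq, this]
    exact inv_mem ha

theorem mem_dual {Γ : Subgroup SL(3, ℝ)} {g : SL(3, ℝ)} : g ∈ dual Γ ↔ g.transpose ∈ Γ := Iff.rfl

theorem mat_transpose (g : SL(3, ℝ)) : mat g.transpose = (mat g)ᵀ := rfl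

theorem transpose_mem_dual {Γ : Subgroup SL(3, ℝ)} {g : SL(3, ℝ)} (hg : g ∈ Γ) :
    g.transpose ∈ dual Γ := hg

/-- The conjugate `h⁻¹ Γ h`. -/
def conj (h : SL(3, ℝ)) (Γ : Subgroup SL(3, ℝ)) : Subgroup SL(3, ℝ) :=
  Γ.comap (MulAut.conj h).toMonoidHom

theorem mem_conj {h g : SL(3, ℝ)} {Γ : Subgroup SL(3, ℝ)} : g ∈ conj h Γ ↔ h * g * h⁻¹ ∈ Γ :=
  Iff.rfl

theorem InvClosed.swap {Γ : Subgroup SL(3, ℝ)} {M : Set (Vec × Vec)} (hM : InvClosed Γ M) :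
    InvClosed (dual Γ) (Prod.swap ⁻¹' M) where
  subset := by
    rintro ⟨φ, x⟩ h
    have := hM.subset h
    exact ⟨this.2.1, this.1, (dotProduct_comm _ _).trans this.2.2⟩
  nonempty := by
    obtain ⟨⟨x, φ⟩, h⟩ := hM.nonempty
    exact ⟨(φ, x), h⟩
  smul_mem hs ht h := hM.smul_mem ht hs h
  act_mem {g φ x} hg h := by
    have h1 : g.transpose⁻¹ ∈ Γ := inv_mem hg
    have := hM.act_mem h1 h
    rw [inv_inv] at this
    have e1 : mat g.transpose⁻¹ = (mat g⁻¹)ᵀ := by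
      rw [mat_inv, mat_inv, mat_transpose, adjugate_transpose]
    rw [e1, mat_transpose, mulVec_transpose, vecMul_transpose] at this
    exact this
  mem_of_mem_closure {q} hq hcl := by
    refine hM.mem_of_mem_closure ⟨hq.2.1, hq.1, (dotProduct_comm _ _).trans hq.2.2⟩ ?_
    exact map_mem_closure continuous_swap hcl fun _ h => h

theorem InvClosed.conj {Γ : Subgroup SL(3, ℝ)} {M : Set (Vec × Vec)} (hM : InvClosed Γ M)
    (h : SL(3, ℝ)) :
    InvClosed (conj h Γ) ((fun q : Vec × Vec => (mat h *ᵥ q.1, q.2 ᵥ* mat h⁻¹)) ⁻¹' M) where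
  subset := by
    rintro ⟨x, φ⟩ hx
    have := act_mem_flags h⁻¹ (hM.subset hx)
    rwa [inv_inv, inv_mulVec_mulVec, vecMul_inv_vecMul] at this
  nonempty := by
    obtain ⟨⟨x, φ⟩, hx⟩ := hM.nonempty
    refine ⟨(mat h⁻¹ *ᵥ x, φ ᵥ* mat h), ?_⟩
    rwa [Set.mem_preimage, mulVec_inv_mulVec, vecMul_vecMul_inv]
  smul_mem hs ht hx := by
    rw [Set.mem_preimage, mulVec_smul, smul_vecMul]
    exact hM.smul_mem hs ht hx
  act_mem {g x φ} hg hx := by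
    have := hM.act_mem hg hx
    have e : (MulAut.conj h).toMonoidHom g = h * g * h⁻¹ := rfl
    rw [e, mulVec_mulVec, vecMul_vecMul, ← mat_mul, ← mat_mul, inv_mul_cancel_right,
      _root_.mul_inv_rev, _root_.mul_inv_rev, inv_inv, inv_mul_cancel_left, mat_mul, mat_mul,
      ← mulVec_mulVec, ← vecMul_vecMul] at this
    exact this
  mem_of_mem_closure {q} hq hcl := by
    refine hM.mem_of_mem_closure (act_mem_flags h hq) ?_
    refine map_mem_closure (f := fun q : Vec × Vec => (mat h *ᵥ q.1, q.2 ᵥ* mat h⁻¹)) ?_ hcl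
      fun _ h => h
    exact (continuous_const.matrix_mulVec continuous_fst).prodMk
      (continuous_snd.matrix_vecMul continuous_const)

theorem FlagMinimal.of_dual {Γ : Subgroup SL(3, ℝ)} (h : FlagMinimal (dual Γ)) : FlagMinimal Γ :=
  fun _ hM q hq => h _ hM.swap
    (show q.swap ∈ flags from ⟨hq.2.1, hq.1, (dotProduct_comm _ _).trans hq.2.2⟩)

theorem FlagMinimal.of_conj {Γ : Subgroup SL(3, ℝ)} {h : SL(3, ℝ)} (H : FlagMinimal (conj h Γ)) :
    FlagMinimal Γ := by
  intro M hM q hq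
  have hq' := act_mem_flags h⁻¹ hq
  have := H _ (hM.conj h) hq'
  rwa [Set.mem_preimage, inv_inv, mulVec_inv_mulVec, vecMul_vecMul_inv] at this

/-! ### Polynomial functions on `SL(3, ℝ)` -/

/-- The algebra of polynomial functions on `SL(3, ℝ)`. -/
noncomputable def polyFun : Subalgebra ℝ (SL(3, ℝ) → ℝ) :=
  (MvPolynomial.aeval (R := ℝ) fun (ij : Fin 3 × Fin 3) (g : SL(3, ℝ)) => mat g ij.1 ij.2).range

theorem aeval_fun_apply {σ α : Type*} (F : σ → α → ℝ) (p : MvPolynomial σ ℝ) (a : α) :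
    MvPolynomial.aeval F p a = MvPolynomial.eval (fun i => F i a) p := by
  induction p using MvPolynomial.induction_on with
  | C r => simp
  | add p q hp hq => simp [hp, hq]
  | mul_X p i hp => simp [hp]

theorem entry_mem_polyFun (i j : Fin 3) : (fun g => mat g i j) ∈ polyFun :=
  ⟨MvPolynomial.X (i, j), by
    ext g
    simp⟩

theorem const_mem_polyFun (c : ℝ) : (fun _ => c) ∈ polyFun := polyFun.algebraMap_mem c

theorem comp_mem_polyFun {f : SL(3, ℝ) → SL(3, ℝ)} (hf : ∀ i j, (fun g => mat (f g) i j) ∈ polyFun)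
    {F : SL(3, ℝ) → ℝ} (hF : F ∈ polyFun) : F ∘ f ∈ polyFun := by
  obtain ⟨p, rfl⟩ := hF
  have h : ∀ p : MvPolynomial (Fin 3 × Fin 3) ℝ,
      (fun g => MvPolynomial.eval (fun ij => mat (f g) ij.1 ij.2) p) ∈ polyFun := by
    intro p
    induction p using MvPolynomial.induction_on with
    | C r => simpa using const_mem_polyFun r
    | add p q hp hq => simpa only [map_add] using! polyFun.add_mem hp hq
    | mul_X p i hp => simpa only [map_mul, MvPolynomial.eval_X] using! polyFun.mul_mem hp (hf i.1 i.2)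
  have e : ((MvPolynomial.aeval (R := ℝ) fun (ij : Fin 3 × Fin 3) (g : SL(3, ℝ)) =>
      mat g ij.1 ij.2) p) ∘ f = fun g => MvPolynomial.eval (fun ij => mat (f g) ij.1 ij.2) p :=
    funext fun g => aeval_fun_apply _ p (f g)
  exact e ▸ h p

theorem inv_entry_mem_polyFun (i j : Fin 3) : (fun g => mat g⁻¹ i j) ∈ polyFun := by
  have h : ∀ a b c d a' b' c' d', (fun g => mat g a b * mat g c d - mat g a' b' * mat g c' d') ∈
      polyFun := fun a b c d a' b' c' d' =>
    polyFun.sub_mem (polyFun.mul_mem (entry_mem_polyFun _ _) (entry_mem_polyFun _ _))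
      (polyFun.mul_mem (entry_mem_polyFun _ _) (entry_mem_polyFun _ _))
  simp only [mat_inv, adjugate_fin_three]
  fin_cases i <;> fin_cases j <;>
    simp only [Fin.zero_eta, Fin.mk_one, Fin.reduceFinMk, of_apply, cons_val, neg_add_eq_sub] <;>
    apply h

theorem sum_mem_polyFun {f : Fin 3 → SL(3, ℝ) → ℝ} (hf : ∀ i, f i ∈ polyFun) :
    (fun g => ∑ i, f i g) ∈ polyFun := by
  have := polyFun.sum_mem (t := Finset.univ) fun i _ => hf i
  convert this using 1
  ext g
  simp

theorem prod_mem_polyFun {ι : Type*} (S : Finset ι) {f : ι → SL(3, ℝ) → ℝ}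
    (hf : ∀ i, f i ∈ polyFun) : (fun g => ∏ i ∈ S, f i g) ∈ polyFun := by
  have := polyFun.prod_mem (t := S) fun i _ => hf i
  convert this using 1
  ext g
  simp

theorem dot_mulVec_mem_polyFun (α x : Vec) : (fun g => α ⬝ᵥ mat g *ᵥ x) ∈ polyFun :=
  sum_mem_polyFun fun i => polyFun.mul_mem (const_mem_polyFun (α i))
    (sum_mem_polyFun fun j => polyFun.mul_mem (entry_mem_polyFun i j) (const_mem_polyFun (x j)))

theorem dot_vecMul_inv_mem_polyFun (β φ : Vec) : (fun g => β ⬝ᵥ φ ᵥ* mat g⁻¹) ∈ polyFun :=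
  sum_mem_polyFun fun i => polyFun.mul_mem (const_mem_polyFun (β i))
    (sum_mem_polyFun fun j => polyFun.mul_mem (const_mem_polyFun (φ j)) (inv_entry_mem_polyFun j i))

theorem mul_mul_entry_mem_polyFun (h k : SL(3, ℝ)) (i j : Fin 3) :
    (fun g => mat (h * g * k) i j) ∈ polyFun := by
  simp only [mat_mul, Matrix.mul_apply]
  exact sum_mem_polyFun fun i => polyFun.mul_mem (sum_mem_polyFun fun j =>
    polyFun.mul_mem (const_mem_polyFun _) (entry_mem_polyFun _ _)) (const_mem_polyFun _)

theorem IsZariskiDense.exists_ne_zero {S : Set SL(3, ℝ)} (hS : IsZariskiDense S)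
    {f : SL(3, ℝ) → ℝ} (hf : f ∈ polyFun) {g : SL(3, ℝ)} (hg : f g ≠ 0) : ∃ s ∈ S, f s ≠ 0 := by
  obtain ⟨p, rfl⟩ := hf
  by_contra! h
  refine hg ?_
  have := hS p fun s hs => (aeval_fun_apply _ p s).symm.trans (h s hs)
  exact (aeval_fun_apply _ p g).trans (this g)

theorem IsZariskiDense.of_map {S T : Set SL(3, ℝ)} (hS : IsZariskiDense S)
    {f : SL(3, ℝ) → SL(3, ℝ)} (hf : ∀ i j, (fun g => mat (f g) i j) ∈ polyFun)
    (hsurj : Function.Surjective f) (hST : ∀ g ∈ S, f g ∈ T) : IsZariskiDense T := by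
  intro p hp g
  by_contra hg
  obtain ⟨k, rfl⟩ := hsurj g
  have hp' : (MvPolynomial.aeval (R := ℝ) fun (ij : Fin 3 × Fin 3) (g : SL(3, ℝ)) =>
      mat g ij.1 ij.2) p ∈ polyFun := ⟨p, rfl⟩
  obtain ⟨s, hs, h⟩ := hS.exists_ne_zero (comp_mem_polyFun hf hp') (g := k)
    (by rw [Function.comp_apply, aeval_fun_apply]; exact hg)
  rw [Function.comp_apply, aeval_fun_apply] at h
  exact h (hp _ (hST s hs))

theorem IsZariskiDense.dual {Γ : Subgroup SL(3, ℝ)} (h : IsZariskiDense (Γ : Set SL(3, ℝ))) :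
    IsZariskiDense (SLThree.dual Γ : Set SL(3, ℝ)) :=
  h.of_map (f := SpecialLinearGroup.transpose) (fun i j => entry_mem_polyFun j i)
    (fun g => ⟨g.transpose, rfl⟩) fun _ hg => hg

theorem IsZariskiDense.conj {Γ : Subgroup SL(3, ℝ)} (h : IsZariskiDense (Γ : Set SL(3, ℝ)))
    (k : SL(3, ℝ)) : IsZariskiDense (SLThree.conj k Γ : Set SL(3, ℝ)) := by
  refine h.of_map (f := fun g => k⁻¹ * g * k) (mul_mul_entry_mem_polyFun _ _)
    (fun g => ⟨k * g * k⁻¹, by group⟩) fun g hg => ?_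
  have : k * (k⁻¹ * g * k) * k⁻¹ = g := by group
  exact mem_conj.2 (this.symm ▸ hg)

/-! ### Flags in general position -/

theorem exists_forall_dotProduct_ne_zero (S : Finset Vec) (hS : 0 ∉ S) :
    ∃ y : Vec, ∀ α ∈ S, α ⬝ᵥ y ≠ 0 := by
  obtain ⟨y, hy⟩ := Module.Dual.exists_forall_ne_zero_of_forall_exists (K := ℝ) (M := Vec)
    (fun α : S => dotProductBilin ℝ ℝ α.1) fun α => ⟨α.1, (dotProduct_self_pos
      (x := α.1) fun h => hS (h ▸ α.2)).ne'⟩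
  exact ⟨y, fun α hα => hy ⟨α, hα⟩⟩

theorem exists_dotProduct_eq_zero (β : Vec) : ∃ γ : Vec, γ ≠ 0 ∧ γ ⬝ᵥ β = 0 := by
  by_cases h : β 0 = 0
  · refine ⟨Pi.single 0 1, by simp, by simp [h]⟩
  · refine ⟨![-β 1, β 0, 0], fun h0 => h (congrFun h0 1), ?_⟩
    simp [dotProduct, Fin.sum_univ_three]
    ring

theorem cross_ne_zero_of_dotProduct {β x γ : Vec} (hβ : β ≠ 0) (h : γ ⬝ᵥ β = 0)
    (hx : γ ⬝ᵥ x ≠ 0) : crossProduct β x ≠ 0 := by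
  intro h0
  have := cross_cross_eq_smul_sub_smul' γ β x
  rw [h0, map_zero, dotProduct_comm β, h, zero_smul, sub_zero] at this
  exact (smul_ne_zero hx hβ) this.symm

theorem exists_flag_generic (S T : Finset Vec) (hS : 0 ∉ S) (hT : 0 ∉ T) :
    ∃ q ∈ flags, (∀ α ∈ S, α ⬝ᵥ q.1 ≠ 0) ∧ ∀ β ∈ T, β ⬝ᵥ q.2 ≠ 0 := by
  classical
  choose γ hγ0 hγ using exists_dotProduct_eq_zero
  let e : Vec := Pi.single 0 1
  have he : e ≠ 0 := by simp [e]
  obtain ⟨x, hx⟩ := exists_forall_dotProduct_ne_zero (insert (γ e) (S ∪ T.image γ)) (by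
    simp only [Finset.mem_insert, Finset.mem_union, Finset.mem_image, not_or, not_exists, not_and]
    exact ⟨(hγ0 e).symm, hS, fun β _ => hγ0 β⟩)
  have hcross : ∀ β ∈ insert e T, crossProduct β x ≠ 0 := by
    intro β hβ
    rcases Finset.mem_insert.1 hβ with rfl | hβ
    · exact cross_ne_zero_of_dotProduct he (hγ e) (hx _ (by simp))
    · exact cross_ne_zero_of_dotProduct (fun h => hT (h ▸ hβ)) (hγ β)
        (hx _ (Finset.mem_insert_of_mem (Finset.mem_union_right _ (Finset.mem_image_of_mem _ hβ))))
  obtain ⟨y, hy⟩ := exists_forall_dotProduct_ne_zero ((insert e T).image fun β => crossProduct β x)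
    (by
      simp only [Finset.mem_image, not_exists, not_and]
      exact hcross)
  have hy' : ∀ β ∈ insert e T, β ⬝ᵥ crossProduct x y ≠ 0 := by
    intro β hβ
    have := hy _ (Finset.mem_image_of_mem _ hβ)
    rwa [triple_product_permutation, triple_product_permutation, dotProduct_comm]
  refine ⟨(x, crossProduct x y), ⟨?_, ?_, dot_self_cross x y⟩, ?_, ?_⟩
  · rintro rfl
    exact hx (γ e) (by simp) (by simp)
  · intro h
    have := hy' e (by simp)
    simp only at h
    rw [h] at this
    simp at this
  · exact fun α hα => hx _ (Finset.mem_insert_of_mem (Finset.mem_union_left _ hα))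
  · exact fun β hβ => hy' _ (Finset.mem_insert_of_mem hβ)

theorem exists_map_flag {q r : Vec × Vec} (hq : q ∈ flags) (hr : r ∈ flags) :
    ∃ (g : SL(3, ℝ)) (c d : ℝ), c ≠ 0 ∧ d ≠ 0 ∧ mat g *ᵥ q.1 = c • r.1 ∧
      q.2 ᵥ* mat g⁻¹ = d • r.2 := by
  obtain ⟨a, ha, h1⟩ := flagFrame_mulVec ⟨q, hq⟩
  obtain ⟨b, hb, h2⟩ := flagFrame_vecMul ⟨q, hq⟩
  obtain ⟨c, hc, h3⟩ := flagFrame_mulVec ⟨r, hr⟩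
  obtain ⟨d, hd, h4⟩ := flagFrame_vecMul ⟨r, hr⟩
  refine ⟨flagFrame ⟨r, hr⟩ * (flagFrame ⟨q, hq⟩)⁻¹, a⁻¹ * c, b⁻¹ * d,
    mul_ne_zero (inv_ne_zero ha) hc, mul_ne_zero (inv_ne_zero hb) hd, ?_, ?_⟩
  · rw [mul_smul, ← h3, eq_inv_smul_iff₀ ha, ← mulVec_smul, ← h1, mat_mul, ← mulVec_mulVec,
      inv_mulVec_mulVec]
  · rw [mul_smul, ← h4, eq_inv_smul_iff₀ hb, ← smul_vecMul, ← h2, _root_.mul_inv_rev, inv_inv,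
      mat_mul, ← vecMul_vecMul, vecMul_inv_vecMul]

theorem IsZariskiDense.exists_generic {Γ : Set SL(3, ℝ)} (hΓ : IsZariskiDense Γ)
    {x φ : Vec} (h : (x, φ) ∈ flags) (S T : Finset Vec) (hS : 0 ∉ S) (hT : 0 ∉ T) :
    ∃ g ∈ Γ, (∀ α ∈ S, α ⬝ᵥ mat g *ᵥ x ≠ 0) ∧ ∀ β ∈ T, β ⬝ᵥ φ ᵥ* mat g⁻¹ ≠ 0 := by
  obtain ⟨r, hr, hr1, hr2⟩ := exists_flag_generic S T hS hT
  obtain ⟨g, c, d, hc, hd, h1, h2⟩ := exists_map_flag h hr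
  obtain ⟨k, hk, hk'⟩ := hΓ.exists_ne_zero (f := fun g => (∏ α ∈ S, α ⬝ᵥ mat g *ᵥ x) *
    ∏ β ∈ T, β ⬝ᵥ φ ᵥ* mat g⁻¹) (g := g)
    (polyFun.mul_mem (prod_mem_polyFun S fun α => dot_mulVec_mem_polyFun α x)
      (prod_mem_polyFun T fun β => dot_vecMul_inv_mem_polyFun β φ)) (by
      simp only at h1 h2
      refine mul_ne_zero (Finset.prod_ne_zero_iff.2 fun α hα => ?_)
        (Finset.prod_ne_zero_iff.2 fun β hβ => ?_)
      · rw [h1, dotProduct_smul]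
        exact mul_ne_zero hc (hr1 α hα)
      · rw [h2, dotProduct_smul]
        exact mul_ne_zero hd (hr2 β hβ))
  rw [mul_ne_zero_iff, Finset.prod_ne_zero_iff, Finset.prod_ne_zero_iff] at hk'
  exact ⟨k, hk, hk'.1, hk'.2⟩

theorem exists_flag_of_ne_zero {x : Vec} (hx : x ≠ 0) : ∃ φ, (x, φ) ∈ flags := by
  obtain ⟨γ, hγ0, hγ⟩ := exists_dotProduct_eq_zero x
  exact ⟨γ, hx, hγ0, (dotProduct_comm _ _).trans hγ⟩

theorem IsZariskiDense.exists_dotProduct_mulVec_ne_zero {Γ : Set SL(3, ℝ)} (hΓ : IsZariskiDense Γ)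
    {x α : Vec} (hx : x ≠ 0) (hα : α ≠ 0) : ∃ g ∈ Γ, α ⬝ᵥ mat g *ᵥ x ≠ 0 := by
  obtain ⟨φ, h⟩ := exists_flag_of_ne_zero hx
  obtain ⟨g, hg, h1, -⟩ := hΓ.exists_generic h {α} ∅ (by simpa using hα.symm) (by simp)
  exact ⟨g, hg, h1 α (by simp)⟩

theorem InvClosed.exists_generic {Γ : Subgroup SL(3, ℝ)} {M : Set (Vec × Vec)}
    (hM : InvClosed Γ M) (hΓ : IsZariskiDense (Γ : Set SL(3, ℝ))) (S T : Finset Vec)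
    (hS : 0 ∉ S) (hT : 0 ∉ T) :
    ∃ x φ, (x, φ) ∈ M ∧ (∀ α ∈ S, α ⬝ᵥ x ≠ 0) ∧ ∀ β ∈ T, β ⬝ᵥ φ ≠ 0 := by
  obtain ⟨⟨x, φ⟩, h⟩ := hM.nonempty
  obtain ⟨g, hg, h1, h2⟩ := hΓ.exists_generic (hM.subset h) S T hS hT
  exact ⟨_, _, hM.act_mem hg h, h1, h2⟩

theorem IsZariskiDense.exists_entries_ne_zero {Γ : Set SL(3, ℝ)} (hΓ : IsZariskiDense Γ) :
    ∃ g ∈ Γ, ∀ i j, mat g i j ≠ 0 ∧ mat g⁻¹ i j ≠ 0 := by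
  obtain ⟨g, hg, h⟩ := hΓ.exists_ne_zero (f := fun g => (∏ i, ∏ j, mat g i j) *
    ∏ i, ∏ j, mat g⁻¹ i j) (g := mkSL !![1, 1, 1; 1, 2, 3; 1, 3, 6] (by
      simp [det_fin_three]; norm_num))
    (polyFun.mul_mem (prod_mem_polyFun _ fun i => prod_mem_polyFun _ fun j => entry_mem_polyFun i j)
      (prod_mem_polyFun _ fun i => prod_mem_polyFun _ fun j => inv_entry_mem_polyFun i j)) (by
      rw [mat_inv, mat_mkSL, adjugate_fin_three_of]
      simp [Fin.prod_univ_three]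
      norm_num)
  simp only [mul_ne_zero_iff, Finset.prod_ne_zero_iff, Finset.mem_univ, true_imp_iff] at h
  exact ⟨g, hg, fun i j => ⟨h.1 i j, h.2 i j⟩⟩

/-! ### Limits of flags -/

theorem InvClosed.mem_of_tendsto {Γ : Subgroup SL(3, ℝ)} {M : Set (Vec × Vec)}
    (hM : InvClosed Γ M) {ι : Type*} {l : Filter ι} [l.NeBot] {x φ : ι → Vec} {x₀ φ₀ : Vec}
    (hx : Tendsto x l (𝓝 x₀)) (hφ : Tendsto φ l (𝓝 φ₀)) (hx₀ : x₀ ≠ 0) (hφ₀ : φ₀ ≠ 0)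
    (h : ∀ᶠ i in l, (x i, φ i) ∈ M) : (x₀, φ₀) ∈ M := by
  refine hM.mem_of_mem_closure ⟨hx₀, hφ₀, ?_⟩ (mem_closure_of_tendsto (hx.prodMk_nhds hφ) h)
  have h1 : Tendsto (fun i => x i ⬝ᵥ φ i) l (𝓝 (x₀ ⬝ᵥ φ₀)) :=
    ((continuous_fst.dotProduct continuous_snd).tendsto (x₀, φ₀)).comp (hx.prodMk_nhds hφ)
  refine tendsto_nhds_unique (h1.congr' ?_) tendsto_const_nhds
  filter_upwards [h] with i hi
  exact (hM.subset hi).2.2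

/-- The orthogonal projection of `x` onto the orthogonal complement of `q`. -/
noncomputable def orthoPart (x q : Vec) : Vec := x - (x ⬝ᵥ q / q ⬝ᵥ q) • q

theorem orthoPart_dotProduct (x : Vec) {q : Vec} (hq : q ≠ 0) : orthoPart x q ⬝ᵥ q = 0 := by
  rw [orthoPart, sub_dotProduct, smul_dotProduct, smul_eq_mul,
    div_mul_cancel₀ _ (dotProduct_self_pos hq).ne', sub_self]

theorem tendsto_orthoPart {ι : Type*} {l : Filter ι} {q : ι → Vec} {x q₀ : Vec}
    (hq : Tendsto q l (𝓝 q₀)) (hq₀ : q₀ ≠ 0) (h : x ⬝ᵥ q₀ = 0) :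
    Tendsto (fun i => orthoPart x (q i)) l (𝓝 x) := by
  have hc : ContinuousAt (fun q => orthoPart x q) q₀ := by
    have h1 : ContinuousAt (fun q => x ⬝ᵥ q) q₀ :=
      (continuous_const.dotProduct continuous_id).continuousAt
    have h2 : ContinuousAt (fun q : Vec => q ⬝ᵥ q) q₀ :=
      (continuous_id.dotProduct continuous_id).continuousAt
    exact continuousAt_const.sub ((h1.div h2 (dotProduct_self_pos hq₀).ne').smul continuousAt_id)
  have := hc.tendsto.comp hq
  rwa [orthoPart, h, zero_div, zero_smul, sub_zero] at this

/-- The cone over the `Γ`-orbit of `p` in the projective plane. -/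
def coneOrbit (Γ : Subgroup SL(3, ℝ)) (p : Vec) : Set Vec :=
  {y | ∃ c : ℝ, c ≠ 0 ∧ ∃ g ∈ Γ, y = c • mat g *ᵥ p}

/-- The cone over the `Γ`-orbit of the form `ℓ` in the dual projective plane. -/
def dualConeOrbit (Γ : Subgroup SL(3, ℝ)) (p : Vec) : Set Vec :=
  {y | ∃ c : ℝ, c ≠ 0 ∧ ∃ g ∈ Γ, y = c • p ᵥ* mat g⁻¹}

theorem ne_zero_of_mem_coneOrbit {Γ : Subgroup SL(3, ℝ)} {p y : Vec} (hp : p ≠ 0)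
    (hy : y ∈ coneOrbit Γ p) : y ≠ 0 := by
  obtain ⟨c, hc, g, hg, rfl⟩ := hy
  exact smul_ne_zero hc (mulVec_ne_zero g hp)

theorem ne_zero_of_mem_dualConeOrbit {Γ : Subgroup SL(3, ℝ)} {p y : Vec} (hp : p ≠ 0)
    (hy : y ∈ dualConeOrbit Γ p) : y ≠ 0 := by
  obtain ⟨c, hc, g, hg, rfl⟩ := hy
  exact smul_ne_zero hc (vecMul_ne_zero g⁻¹ hp)

theorem invClosed_closure_coneOrbit (Γ : Subgroup SL(3, ℝ)) {p : Vec} (hp : p ≠ 0) :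
    InvClosed Γ {q | q ∈ flags ∧ q.1 ∈ closure (coneOrbit Γ p)} where
  subset _ h := h.1
  nonempty := by
    obtain ⟨φ, h⟩ := exists_flag_of_ne_zero hp
    refine ⟨(p, φ), h, subset_closure ⟨1, one_ne_zero, 1, one_mem Γ, ?_⟩⟩
    rw [mat_one, one_mulVec, one_smul]
  smul_mem {x φ s t} hs ht h := by
    refine ⟨smul_mem_flags hs ht h.1, map_mem_closure (f := fun y : Vec => s • y)
      (continuous_const_smul s) h.2 ?_⟩
    rintro _ ⟨c, hc, g, hg, rfl⟩
    exact ⟨s * c, mul_ne_zero hs hc, g, hg, (mul_smul _ _ _).symm⟩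
  act_mem {g x φ} hg h := by
    refine ⟨act_mem_flags g h.1, map_mem_closure (f := fun x => mat g *ᵥ x)
      (continuous_const.matrix_mulVec continuous_id) h.2 ?_⟩
    rintro _ ⟨c, hc, k, hk, rfl⟩
    exact ⟨c, hc, g * k, mul_mem hg hk, by
      simp only [mulVec_smul, mat_mul, mulVec_mulVec]⟩
  mem_of_mem_closure {q} hq hcl := by
    refine ⟨hq, ?_⟩
    have := map_mem_closure (t := closure (coneOrbit Γ p)) continuous_fst hcl fun _ h => h.2
    rwa [closure_closure] at this

theorem invClosed_closure_dualConeOrbit (Γ : Subgroup SL(3, ℝ)) {p : Vec} (hp : p ≠ 0) :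
    InvClosed Γ {q | q ∈ flags ∧ q.2 ∈ closure (dualConeOrbit Γ p)} where
  subset _ h := h.1
  nonempty := by
    obtain ⟨φ, h⟩ := exists_flag_of_ne_zero hp
    refine ⟨(φ, p), ⟨h.2.1, h.1, (dotProduct_comm _ _).trans h.2.2⟩,
      subset_closure ⟨1, one_ne_zero, 1, one_mem Γ, ?_⟩⟩
    rw [inv_one, mat_one, vecMul_one, one_smul]
  smul_mem {x φ s t} hs ht h := by
    refine ⟨smul_mem_flags hs ht h.1, map_mem_closure (f := fun y : Vec => t • y)
      (continuous_const_smul t) h.2 ?_⟩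
    rintro _ ⟨c, hc, g, hg, rfl⟩
    exact ⟨t * c, mul_ne_zero ht hc, g, hg, (mul_smul _ _ _).symm⟩
  act_mem {g x φ} hg h := by
    refine ⟨act_mem_flags g h.1, map_mem_closure (f := fun x => x ᵥ* mat g⁻¹)
      (continuous_id.matrix_vecMul continuous_const) h.2 ?_⟩
    rintro _ ⟨c, hc, k, hk, rfl⟩
    exact ⟨c, hc, g * k, mul_mem hg hk, by
      simp only [smul_vecMul, _root_.mul_inv_rev, mat_mul, vecMul_vecMul]⟩
  mem_of_mem_closure {q} hq hcl := by
    refine ⟨hq, ?_⟩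
    have := map_mem_closure (t := closure (dualConeOrbit Γ p)) continuous_snd hcl fun _ h => h.2
    rwa [closure_closure] at this

theorem InvClosed.mem_of_act {Γ : Subgroup SL(3, ℝ)} {M : Set (Vec × Vec)}
    (hM : InvClosed Γ M) {g : SL(3, ℝ)} {x φ : Vec} (hg : g ∈ Γ)
    (h : (mat g⁻¹ *ᵥ x, φ ᵥ* mat g) ∈ M) : (x, φ) ∈ M := by
  have := hM.act_mem hg h
  rwa [mulVec_inv_mulVec, vecMul_vecMul_inv] at this

/-- If `M` contains all flags at the point `p`, it contains all flags at points of the closure of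
the orbit of `p`. -/
theorem InvClosed.mem_of_mem_closure_coneOrbit {Γ : Subgroup SL(3, ℝ)} {M : Set (Vec × Vec)}
    (hM : InvClosed Γ M) {p : Vec} (hp : p ≠ 0) (h : ∀ φ, φ ≠ 0 → p ⬝ᵥ φ = 0 → (p, φ) ∈ M)
    {q : Vec × Vec} (hq : q ∈ flags) (hcl : q.1 ∈ closure (coneOrbit Γ p)) : q ∈ M := by
  obtain ⟨x, φ⟩ := q
  obtain ⟨y, hy, hyx⟩ := mem_closure_iff_seq_limit.1 hcl
  have hφ : Tendsto (fun n => orthoPart φ (y n)) atTop (𝓝 φ) :=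
    tendsto_orthoPart hyx hq.1 ((dotProduct_comm _ _).trans hq.2.2)
  refine hM.mem_of_tendsto hyx hφ hq.1 hq.2.1 ?_
  filter_upwards [hφ.eventually_ne hq.2.1] with n hn
  have hn' := orthoPart_dotProduct φ (ne_zero_of_mem_coneOrbit hp (hy n))
  obtain ⟨c, hc, g, hg, hyn⟩ := hy n
  refine hM.mem_of_act hg ?_
  rw [hyn] at hn' ⊢
  rw [mulVec_smul, inv_mulVec_mulVec]
  have := hM.smul_mem hc (one_ne_zero (α := ℝ)) (h (orthoPart φ (c • mat g *ᵥ p) ᵥ* mat g) ?_ ?_)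
  · rwa [one_smul] at this
  · rw [hyn] at hn
    exact vecMul_ne_zero g hn
  · rw [dotProduct_smul, dotProduct_mulVec, smul_eq_mul, mul_eq_zero] at hn'
    rw [dotProduct_comm]
    exact hn'.resolve_left hc

/-- If `M` contains all flags on the line `ℓ`, it contains all flags on lines of the closure of
the orbit of `ℓ`. -/
theorem InvClosed.mem_of_mem_closure_dualConeOrbit {Γ : Subgroup SL(3, ℝ)} {M : Set (Vec × Vec)}
    (hM : InvClosed Γ M) {p : Vec} (hp : p ≠ 0) (h : ∀ x, x ≠ 0 → x ⬝ᵥ p = 0 → (x, p) ∈ M)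
    {q : Vec × Vec} (hq : q ∈ flags) (hcl : q.2 ∈ closure (dualConeOrbit Γ p)) : q ∈ M := by
  obtain ⟨x, φ⟩ := q
  obtain ⟨y, hy, hyφ⟩ := mem_closure_iff_seq_limit.1 hcl
  have hx : Tendsto (fun n => orthoPart x (y n)) atTop (𝓝 x) :=
    tendsto_orthoPart hyφ hq.2.1 hq.2.2
  refine hM.mem_of_tendsto hx hyφ hq.1 hq.2.1 ?_
  filter_upwards [hx.eventually_ne hq.1] with n hn
  have hn' := orthoPart_dotProduct x (ne_zero_of_mem_dualConeOrbit hp (hy n))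
  obtain ⟨c, hc, g, hg, hyn⟩ := hy n
  refine hM.mem_of_act hg ?_
  rw [hyn] at hn' ⊢
  rw [smul_vecMul, vecMul_inv_vecMul]
  have := hM.smul_mem (one_ne_zero (α := ℝ)) hc (h (mat g⁻¹ *ᵥ orthoPart x (c • p ᵥ* mat g⁻¹)) ?_ ?_)
  · rwa [one_smul] at this
  · rw [hyn] at hn
    exact mulVec_ne_zero g⁻¹ hn
  · rw [dotProduct_smul, dotProduct_comm, ← dotProduct_mulVec, smul_eq_mul, mul_eq_zero] at hn'
    rw [dotProduct_comm]
    exact hn'.resolve_left hc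

/-- If `M` contains all flags whose line passes through `p`, and every line meets the closure of
the orbit of `p`, then `M` contains all flags. -/
theorem InvClosed.flags_subset_of_lines_through {Γ : Subgroup SL(3, ℝ)} {M : Set (Vec × Vec)}
    (hM : InvClosed Γ M) {p : Vec} (hp : p ≠ 0)
    (h : ∀ x φ, (x, φ) ∈ flags → φ ⬝ᵥ p = 0 → (x, φ) ∈ M)
    (hcl : ∀ φ : Vec, φ ≠ 0 → ∃ y, y ≠ 0 ∧ φ ⬝ᵥ y = 0 ∧ y ∈ closure (coneOrbit Γ p)) :
    flags ⊆ M := by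
  rintro ⟨x, φ⟩ hq
  obtain ⟨q₀, hq₀, hφq, hcl⟩ := hcl φ hq.2.1
  obtain ⟨y, hy, hyq⟩ := mem_closure_iff_seq_limit.1 hcl
  have hφ : Tendsto (fun n => orthoPart φ (y n)) atTop (𝓝 φ) := tendsto_orthoPart hyq hq₀ hφq
  have hx : Tendsto (fun n => orthoPart x (orthoPart φ (y n))) atTop (𝓝 x) :=
    tendsto_orthoPart hφ hq.2.1 hq.2.2
  refine hM.mem_of_tendsto hx hφ hq.1 hq.2.1 ?_
  filter_upwards [hx.eventually_ne hq.1, hφ.eventually_ne hq.2.1] with n hxn hφn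
  have h1 := orthoPart_dotProduct φ (ne_zero_of_mem_coneOrbit hp (hy n))
  have h2 := orthoPart_dotProduct x hφn
  obtain ⟨c, hc, g, hg, hyn⟩ := hy n
  refine hM.mem_of_act hg (h _ _ ?_ ?_)
  · have := act_mem_flags g⁻¹ (show (_, _) ∈ flags from ⟨hxn, hφn, h2⟩)
    rwa [inv_inv] at this
  · rw [hyn, dotProduct_smul, dotProduct_mulVec, smul_eq_mul, mul_eq_zero] at h1
    rw [hyn]
    exact h1.resolve_left hc

/-- If every nonempty closed invariant set of flags contains all flags on the line `ℓ` and all flags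
at the point `p`, the action is minimal. -/
theorem flagMinimal_of_line_of_point {Γ : Subgroup SL(3, ℝ)} {ℓ p : Vec} (hℓ : ℓ ≠ 0) (hp : p ≠ 0)
    (h1 : ∀ M, InvClosed Γ M → ∀ x, x ≠ 0 → x ⬝ᵥ ℓ = 0 → (x, ℓ) ∈ M)
    (h2 : ∀ M, InvClosed Γ M → ∀ φ, φ ≠ 0 → p ⬝ᵥ φ = 0 → (p, φ) ∈ M) : FlagMinimal Γ := by
  intro M hM
  refine hM.flags_subset_of_lines_through hp (fun x φ hq hφ => ?_) fun φ hφ => ?_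
  · refine hM.mem_of_mem_closure_dualConeOrbit hℓ (h1 M hM) hq ?_
    exact (h2 _ (invClosed_closure_dualConeOrbit Γ hℓ) φ hq.2.1 ((dotProduct_comm _ _).trans hφ)).2
  · have : ∃ y : Vec, y ≠ 0 ∧ y ⬝ᵥ ℓ = 0 ∧ φ ⬝ᵥ y = 0 := by
      by_cases hc : crossProduct φ ℓ = 0
      · obtain ⟨γ, hγ0, hγ⟩ := exists_dotProduct_eq_zero ℓ
        refine ⟨γ, hγ0, hγ, by_contra fun h => ?_⟩
        have := cross_cross_eq_smul_sub_smul' γ φ ℓ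
        rw [hc, map_zero, hγ, zero_smul, zero_sub, eq_comm, neg_eq_zero] at this
        exact smul_ne_zero h hℓ this
      · exact ⟨_, hc, (dotProduct_comm _ _).trans (dot_cross_self _ _), dot_self_cross _ _⟩
    obtain ⟨y, hy0, hyℓ, hyφ⟩ := this
    exact ⟨y, hy0, hyφ, (h1 _ (invClosed_closure_coneOrbit Γ hp) y hy0 hyℓ).2⟩

/-- If, for `Γ` and its dual, all flags on the line `ℓ` lie in every nonempty closed invariant set,
then the action of `Γ` is minimal. -/
theorem flagMinimal_of_line_of_dual_line {Γ : Subgroup SL(3, ℝ)} {ℓ p : Vec} (hℓ : ℓ ≠ 0)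
    (hp : p ≠ 0) (h1 : ∀ M, InvClosed Γ M → ∀ x, x ≠ 0 → x ⬝ᵥ ℓ = 0 → (x, ℓ) ∈ M)
    (h2 : ∀ M, InvClosed (dual Γ) M → ∀ x, x ≠ 0 → x ⬝ᵥ p = 0 → (x, p) ∈ M) : FlagMinimal Γ :=
  flagMinimal_of_line_of_point hℓ hp h1 fun _ hM φ hφ h =>
    h2 _ hM.swap φ hφ ((dotProduct_comm _ _).trans h)

theorem vecMul_fin_three (x : Vec) (A : Matrix (Fin 3) (Fin 3) ℝ) :
    x ᵥ* A = ![x 0 * A 0 0 + x 1 * A 1 0 + x 2 * A 2 0, x 0 * A 0 1 + x 1 * A 1 1 + x 2 * A 2 1,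
      x 0 * A 0 2 + x 1 * A 1 2 + x 2 * A 2 2] := by
  ext i
  fin_cases i <;> simp [vecMul, dotProduct, Fin.sum_univ_three]

theorem mulVec_fin_three (x : Vec) (A : Matrix (Fin 3) (Fin 3) ℝ) :
    A *ᵥ x = ![A 0 0 * x 0 + A 0 1 * x 1 + A 0 2 * x 2, A 1 0 * x 0 + A 1 1 * x 1 + A 1 2 * x 2,
      A 2 0 * x 0 + A 2 1 * x 1 + A 2 2 * x 2] := by
  ext i
  fin_cases i <;> simp [mulVec, dotProduct, Fin.sum_univ_three]

theorem mat_inv_eq {g : SL(3, ℝ)} {B : Matrix (Fin 3) (Fin 3) ℝ} (h : mat g * B = 1) :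
    mat g⁻¹ = B := by
  rw [← mul_one (mat g⁻¹), ← h, ← mul_assoc, inv_mul_coe, one_mul]

theorem tendsto_vec3 {ι : Type*} {l : Filter ι} {a b c : ι → ℝ} {x : Vec}
    (ha : Tendsto a l (𝓝 (x 0))) (hb : Tendsto b l (𝓝 (x 1))) (hc : Tendsto c l (𝓝 (x 2))) :
    Tendsto (fun i => (![a i, b i, c i] : Vec)) l (𝓝 x) := by
  refine tendsto_pi_nhds.2 fun i => ?_
  fin_cases i
  exacts [ha, hb, hc]

theorem zero_notMem_singleton_single (i : Fin 3) :
    (0 : Vec) ∉ ({Pi.single i 1} : Finset Vec) := by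
  rw [Finset.mem_singleton, eq_comm, Pi.single_eq_zero_iff]
  exact one_ne_zero

/-! ### Rotations composed with a homothety -/

/-- The real matrix of determinant one acting on `ℂ ⊕ ℝ` by multiplication by `μ` on `ℂ`. -/
noncomputable def rotMat (μ : ℂ) : Matrix (Fin 3) (Fin 3) ℝ :=
  !![μ.re, -μ.im, 0; μ.im, μ.re, 0; 0, 0, (Complex.normSq μ)⁻¹]

theorem rotMat_mul (μ ν : ℂ) : rotMat (μ * ν) = rotMat μ * rotMat ν := by
  ext i j
  fin_cases i <;> fin_cases j <;> simp [rotMat, Matrix.mul_apply, Fin.sum_univ_three] <;> ring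

theorem rotMat_one : rotMat 1 = 1 := by
  ext i j
  fin_cases i <;> fin_cases j <;> simp [rotMat]

theorem rotMat_pow (μ : ℂ) (n : ℕ) : rotMat (μ ^ n) = rotMat μ ^ n := by
  induction n with
  | zero => simp [rotMat_one]
  | succ n ih => rw [pow_succ, rotMat_mul, ih, pow_succ]

theorem rotMat_transpose (μ : ℂ) : (rotMat μ)ᵀ = rotMat (starRingEnd ℂ μ) := by
  ext i j
  fin_cases i <;> fin_cases j <;> simp [rotMat]

theorem exists_filter_tendsto_pow {z : Circle} (hz : ∀ n : ℕ, 0 < n → z ^ n ≠ 1) (w : Circle) :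
    ∃ l : Filter ℕ, l.NeBot ∧ l ≤ atTop ∧ Tendsto (fun n => z ^ n) l (𝓝 w) := by
  have : Fact (0 < 2 * Real.pi) := ⟨Real.two_pi_pos⟩
  obtain ⟨a, ha⟩ := (AddCircle.homeomorphCircle (T := 2 * Real.pi) Real.two_pi_pos.ne').surjective z
  have ha' : AddCircle.toCircle a = z := by
    rw [← ha, AddCircle.homeomorphCircle_apply]
  have hord : addOrderOf a = 0 := by
    rw [addOrderOf_eq_zero_iff']
    intro n hn h0
    refine hz n hn ?_
    rw [← ha', ← AddCircle.toCircle_nsmul, h0, AddCircle.toCircle_zero]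
  have hd := AddCircle.denseRange_zsmul_iff.2 hord
  have hd2 : DenseRange fun n : ℤ => z ^ n := by
    have := (AddCircle.homeomorphCircle (T := 2 * Real.pi)
      Real.two_pi_pos.ne').surjective.denseRange.comp hd
      (AddCircle.homeomorphCircle (T := 2 * Real.pi) Real.two_pi_pos.ne').continuous
    convert this using 1
    ext1 n
    rw [Function.comp_apply, AddCircle.homeomorphCircle_apply, AddCircle.toCircle_zsmul, ha']
  have hcl : MapClusterPt w atTop (fun n : ℕ => z ^ n) :=
    ((mapClusterPt_atTop_pow_tfae w z).out 0 3).2 (hd2 w)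
  refine ⟨atTop ⊓ comap (fun n => z ^ n) (𝓝 w), ?_, inf_le_left, ?_⟩
  · rw [MapClusterPt, ClusterPt, inf_comm] at hcl
    exact Filter.map_neBot_iff _ |>.1 ((Filter.push_pull _ _ _).symm ▸ hcl)
  · exact tendsto_comap.mono_left inf_le_right

theorem InvClosed.mem_line_of_rotMat {Γ : Subgroup SL(3, ℝ)} {M : Set (Vec × Vec)}
    (hΓ : IsZariskiDense (Γ : Set SL(3, ℝ))) {g : SL(3, ℝ)} (hg : g ∈ Γ) {μ : ℂ}
    (hgμ : mat g = rotMat μ) (hμ : 1 < ‖μ‖) (him : ∀ n : ℕ, 0 < n → (μ ^ n).im ≠ 0)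
    (hM : InvClosed Γ M) (x : Vec) (hx : x ≠ 0) (hx2 : x ⬝ᵥ Pi.single 2 1 = 0) :
    (x, Pi.single 2 1) ∈ M := by
  obtain ⟨y, ψ, hyψ, hy, hψ⟩ := hM.exists_generic hΓ {Pi.single 0 1} {Pi.single 2 1}
    (zero_notMem_singleton_single 0) (zero_notMem_singleton_single 2)
  have hy0 : y 0 ≠ 0 := by simpa using hy
  have hψ2 : ψ 2 ≠ 0 := by simpa using hψ
  have hx2 : x 2 = 0 := by simpa using hx2
  have hμ0 : μ ≠ 0 := norm_pos_iff.1 (zero_lt_one.trans hμ)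
  set ξ : ℂ := ⟨y 0, y 1⟩ with hξ
  set η : ℂ := ⟨x 0, x 1⟩ with hη
  have hξ0 : ξ ≠ 0 := fun h => hy0 (congrArg Complex.re h)
  have hη0 : η ≠ 0 := fun h => hx (by
    ext i
    fin_cases i
    exacts [congrArg Complex.re h, congrArg Complex.im h, hx2])
  have hnμ : (‖μ‖ : ℂ) ≠ 0 := by simpa using hμ0
  have hnξ : (‖ξ‖ : ℂ) ≠ 0 := by simpa using hξ0
  have hnη : (‖η‖ : ℂ) ≠ 0 := by simpa using hη0
  let z : Circle := ⟨μ / ‖μ‖, by simp [Submonoid.unitSphere, hμ0]⟩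
  let w : Circle := ⟨η / ‖η‖ / (ξ / ‖ξ‖), by simp [Submonoid.unitSphere, hξ0, hη0]⟩
  have hz : ∀ n : ℕ, 0 < n → z ^ n ≠ 1 := by
    intro n hn h
    have h1 : (μ / ‖μ‖) ^ n = 1 := by
      have := congrArg (fun u : Circle => (u : ℂ)) h
      simp only [Circle.coe_pow, Circle.coe_one] at this
      exact this
    rw [div_pow, div_eq_one_iff_eq (pow_ne_zero n hnμ)] at h1
    refine him n hn ?_
    rw [h1, ← Complex.ofReal_pow, Complex.ofReal_im]
  obtain ⟨l, hl, hle, hzw⟩ := exists_filter_tendsto_pow hz w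
  have hzw' : Tendsto (fun n : ℕ => (μ / ‖μ‖) ^ n) l (𝓝 (η / ‖η‖ / (ξ / ‖ξ‖))) := by
    have := (continuous_subtype_val.tendsto w).comp hzw
    exact this
  let s : ℕ → ℝ := fun n => ‖η‖ / ‖ξ‖ / ‖μ‖ ^ n
  let t : ℕ → ℝ := fun n => (ψ 2)⁻¹ * (‖μ‖ ^ n)⁻¹ ^ 2
  have hinv : Tendsto (fun n : ℕ => (‖μ‖ ^ n)⁻¹) l (𝓝 0) :=
    (tendsto_inv_atTop_zero.comp (tendsto_pow_atTop_atTop_of_one_lt hμ)).mono_left hle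
  have hs0 : ∀ n, s n ≠ 0 := fun n => by simp [s, hξ0, hη0, hμ0]
  have ht0 : ∀ n, t n ≠ 0 := fun n => by simp [t, hψ2, hμ0]
  have hmem : ∀ n, (s n • rotMat (μ ^ n) *ᵥ y, t n • ψ ᵥ* rotMat (μ ^ n)⁻¹) ∈ M := by
    intro n
    have h1 : mat (g ^ n) = rotMat (μ ^ n) := by
      rw [rotMat_pow, ← hgμ]; rfl
    have h2 : mat (g ^ n)⁻¹ = rotMat (μ ^ n)⁻¹ := by
      refine mat_inv_eq ?_
      rw [h1, ← rotMat_mul, mul_inv_cancel₀ (pow_ne_zero n hμ0), rotMat_one]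
    have := hM.smul_mem (hs0 n) (ht0 n) (hM.act_mem (pow_mem hg n) hyψ)
    rwa [h1, h2] at this
  have hlim : Tendsto (fun n => (s n : ℂ) * (μ ^ n * ξ)) l (𝓝 η) := by
    have h1 : Tendsto (fun n : ℕ => (‖η‖ / ‖ξ‖ * ξ : ℂ) * (μ / ‖μ‖) ^ n) l
        (𝓝 ((‖η‖ / ‖ξ‖ * ξ : ℂ) * (η / ‖η‖ / (ξ / ‖ξ‖)))) := tendsto_const_nhds.mul hzw'
    have h2 : (‖η‖ / ‖ξ‖ * ξ : ℂ) * (η / ‖η‖ / (ξ / ‖ξ‖)) = η := by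
      field_simp
    rw [h2] at h1
    refine h1.congr fun n => ?_
    simp only [s]
    push_cast
    rw [div_pow]
    ring
  refine hM.mem_of_tendsto (l := l) (x := fun n => s n • rotMat (μ ^ n) *ᵥ y)
    (φ := fun n => t n • ψ ᵥ* rotMat (μ ^ n)⁻¹) ?_ ?_ hx (by simp) (Eventually.of_forall hmem)
  · have hre : Tendsto (fun n => s n * (μ ^ n * ξ).re) l (𝓝 (x 0)) :=
      ((Complex.continuous_re.tendsto η).comp hlim).congr fun n => Complex.re_ofReal_mul _ _
    have him : Tendsto (fun n => s n * (μ ^ n * ξ).im) l (𝓝 (x 1)) :=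
      ((Complex.continuous_im.tendsto η).comp hlim).congr fun n => Complex.im_ofReal_mul _ _
    have h3 : Tendsto (fun n => s n * ((‖μ‖ ^ n)⁻¹ ^ 2 * y 2)) l (𝓝 (x 2)) := by
      have := (hinv.const_mul (‖η‖ / ‖ξ‖)).mul ((hinv.pow 2).mul_const (y 2))
      rw [mul_zero, zero_mul] at this
      rw [hx2]
      exact this
    refine (tendsto_vec3 hre him h3).congr fun n => ?_
    rw [mulVec_fin_three]
    ext i
    fin_cases i
    · simp [rotMat, hξ, sub_eq_add_neg]
    · simp [rotMat, hξ, add_comm]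
    · simp [rotMat, Complex.normSq_eq_norm_sq]
  · have hbd : Tendsto (fun n : ℕ => (μ ^ n)⁻¹) l (𝓝 0) := by
      refine tendsto_zero_iff_norm_tendsto_zero.2 (hinv.congr fun n => ?_)
      simp
    have hre := (Complex.continuous_re.tendsto 0).comp hbd
    have him := (Complex.continuous_im.tendsto 0).comp hbd
    have ht : Tendsto t l (𝓝 0) := by
      have := (hinv.pow 2).const_mul (ψ 2)⁻¹
      rwa [zero_pow two_ne_zero, mul_zero] at this
    have h1 : Tendsto (fun n => t n * (ψ 0 * ((μ ^ n)⁻¹).re + ψ 1 * ((μ ^ n)⁻¹).im)) l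
        (𝓝 ((Pi.single 2 1 : Vec) 0)) := by
      simpa using ht.mul ((hre.const_mul (ψ 0)).add (him.const_mul (ψ 1)))
    have h2 : Tendsto (fun n => t n * (-ψ 0 * ((μ ^ n)⁻¹).im + ψ 1 * ((μ ^ n)⁻¹).re)) l
        (𝓝 ((Pi.single 2 1 : Vec) 1)) := by
      simpa using ht.mul ((him.const_mul (-ψ 0)).add (hre.const_mul (ψ 1)))
    have h3 : Tendsto (fun _ : ℕ => (1 : ℝ)) l (𝓝 ((Pi.single 2 1 : Vec) 2)) := by
      simp
    refine (tendsto_vec3 h1 h2 h3).congr fun n => ?_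
    rw [vecMul_fin_three]
    ext i
    fin_cases i
    · simp [rotMat]
    · simp [rotMat]
    · have : ‖μ‖ ≠ 0 := by simpa using hμ0
      simp [rotMat, t, Complex.normSq_eq_norm_sq]
      field_simp

theorem flagMinimal_of_rotMat {Γ : Subgroup SL(3, ℝ)}
    (hΓ : IsZariskiDense (Γ : Set SL(3, ℝ))) {g : SL(3, ℝ)} (hg : g ∈ Γ) {μ : ℂ}
    (hgμ : mat g = rotMat μ) (hμ : 1 < ‖μ‖) (him : ∀ n : ℕ, 0 < n → (μ ^ n).im ≠ 0) :
    FlagMinimal Γ := by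
  refine flagMinimal_of_line_of_dual_line (ℓ := Pi.single 2 1) (p := Pi.single 2 1) (by simp)
    (by simp) (fun M hM => hM.mem_line_of_rotMat hΓ hg hgμ hμ him) fun M hM =>
    hM.mem_line_of_rotMat hΓ.dual (transpose_mem_dual hg) (μ := starRingEnd ℂ μ) ?_ ?_ ?_
  · rw [mat_transpose, hgμ, rotMat_transpose]
  · simpa using hμ
  · intro n hn
    rw [← map_pow, Complex.conj_im, neg_ne_zero]
    exact him n hn

/-! ### Regular unipotent elements together with transvections -/

/-- The matrix `1 + s N + t N²`, where `N` is the regular nilpotent upper triangular matrix. -/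
def regMat (s t : ℝ) : Matrix (Fin 3) (Fin 3) ℝ := !![1, s, t; 0, 1, s; 0, 0, 1]

theorem regMat_mul (s t s' t' : ℝ) :
    regMat s t * regMat s' t' = regMat (s + s') (t + t' + s * s') := by
  ext i j
  fin_cases i <;> fin_cases j <;> simp [regMat, Matrix.mul_apply, Fin.sum_univ_three] <;> ring

theorem regMat_zero : regMat 0 0 = 1 := by
  ext i j
  fin_cases i <;> fin_cases j <;> simp [regMat]

theorem mat_inv_of_regMat {g : SL(3, ℝ)} {s t : ℝ} (h : mat g = regMat s t) :
    mat g⁻¹ = regMat (-s) (s ^ 2 - t) := by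
  refine mat_inv_eq ?_
  rw [h, regMat_mul, ← regMat_zero]
  congr 1 <;> ring

theorem regMat_mulVec (s t : ℝ) (y : Vec) :
    regMat s t *ᵥ y = ![y 0 + s * y 1 + t * y 2, y 1 + s * y 2, y 2] := by
  rw [mulVec_fin_three]
  simp [regMat]

theorem vecMul_regMat (s t : ℝ) (y : Vec) :
    y ᵥ* regMat s t = ![y 0, y 0 * s + y 1, y 0 * t + y 1 * s + y 2] := by
  rw [vecMul_fin_three]
  simp [regMat]

theorem tendsto_div_of_abs_sub_le {c : ℝ} {u t : ℕ → ℝ} (h : ∀ n, |u n - t n| ≤ c) {k : ℕ}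
    (hk : k ≠ 0) {L : ℝ} (ht : Tendsto (fun n : ℕ => t n * ((n : ℝ) ^ k)⁻¹) atTop (𝓝 L)) :
    Tendsto (fun n : ℕ => u n * ((n : ℝ) ^ k)⁻¹) atTop (𝓝 L) := by
  have h0 : Tendsto (fun n : ℕ => c * ((n : ℝ) ^ k)⁻¹) atTop (𝓝 0) := by
    have := (tendsto_inv_atTop_zero.comp
      ((tendsto_pow_atTop hk).comp (tendsto_natCast_atTop_atTop (R := ℝ)))).const_mul c
    rwa [mul_zero] at this
  have h1 : Tendsto (fun n : ℕ => (u n - t n) * ((n : ℝ) ^ k)⁻¹) atTop (𝓝 0) := by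
    refine squeeze_zero_norm (fun n => ?_) h0
    rw [norm_mul, Real.norm_eq_abs, norm_inv, norm_pow, Real.norm_natCast]
    exact mul_le_mul_of_nonneg_right (h n) (by positivity)
  have := h1.add ht
  rw [zero_add] at this
  exact this.congr fun n => by ring

theorem tendsto_inv_natCast : Tendsto (fun n : ℕ => (n : ℝ)⁻¹) atTop (𝓝 0) :=
  tendsto_inv_atTop_zero.comp tendsto_natCast_atTop_atTop

theorem tendsto_inv_sq_natCast : Tendsto (fun n : ℕ => ((n : ℝ) ^ 2)⁻¹) atTop (𝓝 0) :=
  tendsto_inv_atTop_zero.comp ((tendsto_pow_atTop two_ne_zero).comp tendsto_natCast_atTop_atTop)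

theorem tendsto_mul_inv_natCast (τ : ℝ) :
    Tendsto (fun n : ℕ => τ * n * ((n : ℝ) ^ 1)⁻¹) atTop (𝓝 τ) := by
  refine tendsto_const_nhds.congr' ?_
  filter_upwards [eventually_ne_atTop 0] with n hn
  have : (n : ℝ) ≠ 0 := Nat.cast_ne_zero.2 hn
  field_simp

theorem tendsto_mul_inv_sq_natCast (τ : ℝ) :
    Tendsto (fun n : ℕ => τ * n * ((n : ℝ) ^ 2)⁻¹) atTop (𝓝 0) := by
  have := tendsto_inv_natCast.const_mul τ
  rw [mul_zero] at this
  refine this.congr' ?_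
  filter_upwards [eventually_ne_atTop 0] with n hn
  have : (n : ℝ) ≠ 0 := Nat.cast_ne_zero.2 hn
  field_simp

section

variable {Γ : Subgroup SL(3, ℝ)} {M : Set (Vec × Vec)}

theorem InvClosed.mem_line_of_regMat
    (hΓ : IsZariskiDense (Γ : Set SL(3, ℝ))) {c : ℝ}
    (hg : ∀ (n : ℕ) (t : ℝ), ∃ u, |u - t| ≤ c ∧ ∃ g ∈ Γ, mat g = regMat n u)
    (hM : InvClosed Γ M) (x : Vec) (hx : x ≠ 0) (hx2 : x ⬝ᵥ Pi.single 2 1 = 0) :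
    (x, Pi.single 2 1) ∈ M := by
  obtain ⟨y, ψ, hyψ, hy, hψ⟩ := hM.exists_generic hΓ {Pi.single 2 1} {Pi.single 0 1}
    (zero_notMem_singleton_single 2) (zero_notMem_singleton_single 0)
  have hy2 : y 2 ≠ 0 := by simpa using hy
  have hψ0 : ψ 0 ≠ 0 := by simpa using hψ
  have hx2 : x 2 = 0 := by simpa using hx2
  have key : ∀ a b : ℝ, b ≠ 0 → ((![a, b, 0], Pi.single 2 1) : Vec × Vec) ∈ M := by
    intro a b hb
    set τ := a / b - y 1 / y 2 with hτ
    choose u hu g hgΓ hgu using fun n : ℕ => hg n (τ * n)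
    have hu1 := tendsto_div_of_abs_sub_le hu one_ne_zero (tendsto_mul_inv_natCast τ)
    have hu2 := tendsto_div_of_abs_sub_le hu two_ne_zero (tendsto_mul_inv_sq_natCast τ)
    simp only [pow_one] at hu1
    have h1 : Tendsto (fun n : ℕ => b / y 2 * (y 0 * (n : ℝ)⁻¹ + y 1 + u n * (n : ℝ)⁻¹ * y 2)) atTop
        (𝓝 ((![a, b, 0] : Vec) 0)) := by
      have := (((tendsto_inv_natCast.const_mul (y 0)).add_const (y 1)).add
        (hu1.mul_const (y 2))).const_mul (b / y 2)
      convert this using 2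
      simp only [hτ, cons_val_zero]
      field_simp
      ring
    have h2 : Tendsto (fun n : ℕ => b / y 2 * (y 1 * (n : ℝ)⁻¹ + y 2)) atTop
        (𝓝 ((![a, b, 0] : Vec) 1)) := by
      have := ((tendsto_inv_natCast.const_mul (y 1)).add_const (y 2)).const_mul (b / y 2)
      convert this using 2
      simp [hy2]
    have h3 : Tendsto (fun n : ℕ => b / y 2 * (y 2 * (n : ℝ)⁻¹)) atTop
        (𝓝 ((![a, b, 0] : Vec) 2)) := by
      have := (tendsto_inv_natCast.const_mul (y 2)).const_mul (b / y 2)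
      convert this using 2
      simp
    have k1 : Tendsto (fun n : ℕ => (ψ 0)⁻¹ * (ψ 0 * ((n : ℝ) ^ 2)⁻¹)) atTop
        (𝓝 ((Pi.single 2 1 : Vec) 0)) := by
      have := (tendsto_inv_sq_natCast.const_mul (ψ 0)).const_mul (ψ 0)⁻¹
      convert this using 2
      simp
    have k2 : Tendsto (fun n : ℕ => (ψ 0)⁻¹ * (-ψ 0 * (n : ℝ)⁻¹ + ψ 1 * ((n : ℝ) ^ 2)⁻¹)) atTop
        (𝓝 ((Pi.single 2 1 : Vec) 1)) := by
      have := ((tendsto_inv_natCast.const_mul (-ψ 0)).add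
        (tendsto_inv_sq_natCast.const_mul (ψ 1))).const_mul (ψ 0)⁻¹
      convert this using 2
      simp
    have k3 : Tendsto (fun n : ℕ => (ψ 0)⁻¹ * (ψ 0 * (1 - u n * ((n : ℝ) ^ 2)⁻¹) -
        ψ 1 * (n : ℝ)⁻¹ + ψ 2 * ((n : ℝ) ^ 2)⁻¹)) atTop (𝓝 ((Pi.single 2 1 : Vec) 2)) := by
      have := ((((hu2.const_sub 1).const_mul (ψ 0)).sub (tendsto_inv_natCast.const_mul (ψ 1))).add
        (tendsto_inv_sq_natCast.const_mul (ψ 2))).const_mul (ψ 0)⁻¹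
      convert this using 2
      simp [hψ0]
    refine hM.mem_of_tendsto (tendsto_vec3 h1 h2 h3) (tendsto_vec3 k1 k2 k3)
      (fun h => hb (congrFun h 1)) (by simp) ?_
    filter_upwards [eventually_ne_atTop 0] with n hn
    have hn' : (n : ℝ) ≠ 0 := Nat.cast_ne_zero.2 hn
    have := hM.smul_mem (s := b / y 2 * (n : ℝ)⁻¹) (t := (ψ 0)⁻¹ * ((n : ℝ) ^ 2)⁻¹)
      (by positivity) (by positivity) (hM.act_mem (hgΓ n) hyψ)
    rw [mat_inv_of_regMat (hgu n), hgu n, regMat_mulVec, vecMul_regMat] at this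
    convert this using 2
    · ext i
      fin_cases i <;> simp <;> field_simp
    · ext i
      fin_cases i <;> simp <;> field_simp
      ring
  have hxe : x = ![x 0, x 1, 0] := by
    ext i
    fin_cases i
    exacts [rfl, rfl, hx2]
  by_cases h1 : x 1 = 0
  · refine hM.mem_of_tendsto (l := atTop) (x := fun n : ℕ => ![x 0, ((n + 1 : ℕ) : ℝ)⁻¹, 0])
      (tendsto_vec3 tendsto_const_nhds ?_ ?_) tendsto_const_nhds hx (by simp)
      (Eventually.of_forall fun n => key _ _ (by positivity))
    · rw [h1]
      exact (tendsto_add_atTop_iff_nat 1).2 tendsto_inv_natCast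
    · rw [hx2]
      exact tendsto_const_nhds
  · rw [hxe]
    exact key _ _ h1

theorem InvClosed.mem_point_of_regMat
    (hΓ : IsZariskiDense (Γ : Set SL(3, ℝ))) {c : ℝ}
    (hg : ∀ (n : ℕ) (t : ℝ), ∃ u, |u - t| ≤ c ∧ ∃ g ∈ Γ, mat g = regMat n u)
    (hM : InvClosed Γ M) (x : Vec) (hx : x ≠ 0) (hx0 : Pi.single 0 1 ⬝ᵥ x = 0) :
    (Pi.single 0 1, x) ∈ M := by
  obtain ⟨y, ψ, hyψ, hy, hψ⟩ := hM.exists_generic hΓ {Pi.single 2 1} {Pi.single 0 1}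
    (zero_notMem_singleton_single 2) (zero_notMem_singleton_single 0)
  have hy2 : y 2 ≠ 0 := by simpa using hy
  have hψ0 : ψ 0 ≠ 0 := by simpa using hψ
  have hx0 : x 0 = 0 := by simpa using hx0
  have key : ∀ a b : ℝ, a ≠ 0 → ((Pi.single 0 1, ![0, a, b]) : Vec × Vec) ∈ M := by
    intro a b ha
    set τ := ψ 1 / ψ 0 - b / a with hτ
    choose u hu g hgΓ hgu using fun n : ℕ => hg n ((n : ℝ) ^ 2 - τ * n)
    have hu' : ∀ n : ℕ, |((n : ℝ) ^ 2 - u n) - τ * n| ≤ c := fun n => by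
      rw [abs_sub_comm]
      convert hu n using 2
      ring
    have hu1 := tendsto_div_of_abs_sub_le hu' one_ne_zero (tendsto_mul_inv_natCast τ)
    have hu2 := tendsto_div_of_abs_sub_le hu' two_ne_zero (tendsto_mul_inv_sq_natCast τ)
    simp only [pow_one] at hu1
    have h1 : Tendsto (fun n : ℕ => (y 2)⁻¹ * (y 0 * ((n : ℝ) ^ 2)⁻¹ + y 1 * (n : ℝ)⁻¹ +
        (1 - ((n : ℝ) ^ 2 - u n) * ((n : ℝ) ^ 2)⁻¹) * y 2)) atTop
        (𝓝 ((Pi.single 0 1 : Vec) 0)) := by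
      have := (((tendsto_inv_sq_natCast.const_mul (y 0)).add
        (tendsto_inv_natCast.const_mul (y 1))).add
        ((hu2.const_sub 1).mul_const (y 2))).const_mul (y 2)⁻¹
      convert this using 2
      simp [hy2]
    have h2 : Tendsto (fun n : ℕ => (y 2)⁻¹ * (y 1 * ((n : ℝ) ^ 2)⁻¹ + y 2 * (n : ℝ)⁻¹)) atTop
        (𝓝 ((Pi.single 0 1 : Vec) 1)) := by
      have := ((tendsto_inv_sq_natCast.const_mul (y 1)).add
        (tendsto_inv_natCast.const_mul (y 2))).const_mul (y 2)⁻¹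
      convert this using 2
      simp
    have h3 : Tendsto (fun n : ℕ => (y 2)⁻¹ * (y 2 * ((n : ℝ) ^ 2)⁻¹)) atTop
        (𝓝 ((Pi.single 0 1 : Vec) 2)) := by
      have := (tendsto_inv_sq_natCast.const_mul (y 2)).const_mul (y 2)⁻¹
      convert this using 2
      simp
    have k1 : Tendsto (fun n : ℕ => -a / ψ 0 * (ψ 0 * (n : ℝ)⁻¹)) atTop
        (𝓝 ((![0, a, b] : Vec) 0)) := by
      have := (tendsto_inv_natCast.const_mul (ψ 0)).const_mul (-a / ψ 0)
      convert this using 2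
      simp
    have k2 : Tendsto (fun n : ℕ => -a / ψ 0 * (-ψ 0 + ψ 1 * (n : ℝ)⁻¹)) atTop
        (𝓝 ((![0, a, b] : Vec) 1)) := by
      have := ((tendsto_inv_natCast.const_mul (ψ 1)).const_add (-ψ 0)).const_mul (-a / ψ 0)
      convert this using 2
      simp [hψ0]
    have k3 : Tendsto (fun n : ℕ => -a / ψ 0 * (ψ 0 * (((n : ℝ) ^ 2 - u n) * (n : ℝ)⁻¹) -
        ψ 1 + ψ 2 * (n : ℝ)⁻¹)) atTop (𝓝 ((![0, a, b] : Vec) 2)) := by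
      have := (((hu1.const_mul (ψ 0)).sub_const (ψ 1)).add
        (tendsto_inv_natCast.const_mul (ψ 2))).const_mul (-a / ψ 0)
      convert this using 2
      simp only [hτ, cons_val]
      field_simp
      ring
    refine hM.mem_of_tendsto (tendsto_vec3 h1 h2 h3) (tendsto_vec3 k1 k2 k3)
      (by simp) (fun h => ha (congrFun h 1)) ?_
    filter_upwards [eventually_ne_atTop 0] with n hn
    have hn' : (n : ℝ) ≠ 0 := Nat.cast_ne_zero.2 hn
    have := hM.smul_mem (s := (y 2)⁻¹ * ((n : ℝ) ^ 2)⁻¹) (t := -a / ψ 0 * (n : ℝ)⁻¹)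
      (by positivity) (mul_ne_zero (div_ne_zero (neg_ne_zero.2 ha) hψ0) (inv_ne_zero hn'))
      (hM.act_mem (hgΓ n) hyψ)
    rw [mat_inv_of_regMat (hgu n), hgu n, regMat_mulVec, vecMul_regMat] at this
    convert this using 2
    · ext i
      fin_cases i <;> simp <;> field_simp
      ring
    · ext i
      fin_cases i <;> simp <;> field_simp
      ring
  have hxe : x = ![0, x 1, x 2] := by
    ext i
    fin_cases i
    exacts [hx0, rfl, rfl]
  by_cases h1 : x 1 = 0
  · refine hM.mem_of_tendsto (l := atTop) (φ := fun n : ℕ => ![0, ((n + 1 : ℕ) : ℝ)⁻¹, x 2])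
      tendsto_const_nhds (tendsto_vec3 ?_ ?_ tendsto_const_nhds) (by simp) hx
      (Eventually.of_forall fun n => key _ _ (by positivity))
    · rw [hx0]
      exact tendsto_const_nhds
    · rw [h1]
      exact (tendsto_add_atTop_iff_nat 1).2 tendsto_inv_natCast
  · rw [hxe]
    exact key _ _ h1

theorem flagMinimal_of_regMat (hΓ : IsZariskiDense (Γ : Set SL(3, ℝ))) {c : ℝ}
    (hg : ∀ (n : ℕ) (t : ℝ), ∃ u, |u - t| ≤ c ∧ ∃ g ∈ Γ, mat g = regMat n u) : FlagMinimal Γ :=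
  flagMinimal_of_line_of_point (ℓ := Pi.single 2 1) (p := Pi.single 0 1) (by simp) (by simp)
    (fun _ hM => hM.mem_line_of_regMat hΓ hg) fun _ hM => hM.mem_point_of_regMat hΓ hg

end

/-! ### Transvections -/

theorem tendsto_floor_mul (a : ℝ) :
    Tendsto (fun n : ℕ => (⌊a * n⌋ : ℝ) * (n : ℝ)⁻¹) atTop (𝓝 a) := by
  have h : ∀ n : ℕ, |(⌊a * n⌋ : ℝ) - a * n| ≤ 1 := fun n => by
    rw [abs_sub_comm, abs_of_nonneg (sub_nonneg.2 (Int.floor_le _))]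
    linarith [Int.lt_floor_add_one (a * n)]
  simpa only [pow_one] using tendsto_div_of_abs_sub_le h one_ne_zero (tendsto_mul_inv_natCast a)

/-- The matrix `1 + t x ⊗ f`. -/
def transMat (t : ℝ) (x f : Vec) : Matrix (Fin 3) (Fin 3) ℝ := 1 + t • vecMulVec x f

theorem transMat_mulVec (t : ℝ) (x f y : Vec) : transMat t x f *ᵥ y = y + (t * f ⬝ᵥ y) • x := by
  rw [transMat, add_mulVec, one_mulVec, smul_mulVec, vecMulVec_mulVec]
  ext i
  simp
  ring

theorem vecMul_transMat (t : ℝ) (x f y : Vec) : y ᵥ* transMat t x f = y + (t * y ⬝ᵥ x) • f := by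
  rw [transMat, vecMul_add, vecMul_one, vecMul_smul, vecMul_vecMulVec, smul_smul]

theorem transMat_mul (s t : ℝ) {x f : Vec} (h : f ⬝ᵥ x = 0) (f' : Vec) :
    transMat s x f * transMat t x f' = 1 + s • vecMulVec x f + t • vecMulVec x f' := by
  rw [transMat, transMat, add_mul, mul_add, one_mul, mul_add, smul_mul_smul_comm,
    vecMulVec_mul_vecMulVec, h]
  simp
  abel

theorem mat_inv_of_transMat {g : SL(3, ℝ)} {t : ℝ} {x f : Vec} (hf : f ⬝ᵥ x = 0)
    (h : mat g = transMat t x f) : mat g⁻¹ = transMat (-t) x f := by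
  refine mat_inv_eq ?_
  rw [h, transMat_mul _ _ hf]
  simp

theorem tendsto_smul_add {y x : Vec} {c : ℝ} (hc : c ≠ 0) :
    Tendsto (fun n : ℕ => ((n : ℝ) * c)⁻¹ • (y + (n * c) • x)) atTop (𝓝 x) := by
  have h : Tendsto (fun n : ℕ => ((n : ℝ)⁻¹ * c⁻¹) • y + x) atTop (𝓝 x) := by
    have := ((tendsto_inv_natCast.mul_const c⁻¹).smul_const y).add_const x
    rwa [zero_mul, zero_smul, zero_add] at this
  refine h.congr' ?_
  filter_upwards [eventually_ne_atTop 0] with n hn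
  have : (n : ℝ) ≠ 0 := Nat.cast_ne_zero.2 hn
  rw [smul_add, smul_smul, inv_mul_cancel₀ (mul_ne_zero this hc), one_smul, mul_inv]

section

variable {Γ : Subgroup SL(3, ℝ)} {M : Set (Vec × Vec)}

theorem InvClosed.mem_of_transvection (hM : InvClosed Γ M) {x f : Vec} (hfx : f ⬝ᵥ x = 0)
    {c : ℝ} (hc : c ≠ 0) (hg : ∀ n : ℕ, ∃ g ∈ Γ, mat g = transMat (n * c) x f)
    {y ψ : Vec} (h : (y, ψ) ∈ M) (hy : f ⬝ᵥ y ≠ 0) (hψ : ψ ⬝ᵥ x ≠ 0) : (x, f) ∈ M := by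
  choose g hgΓ hgm using hg
  have hx0 : x ≠ 0 := by rintro rfl; simp at hψ
  have hf0 : f ≠ 0 := by rintro rfl; simp at hy
  have h1 := tendsto_smul_add (y := y) (x := x) (mul_ne_zero hc hy)
  have h2 := tendsto_smul_add (y := ψ) (x := f) (mul_ne_zero (neg_ne_zero.2 hc) hψ)
  refine hM.mem_of_tendsto h1 h2 hx0 hf0 ?_
  filter_upwards [eventually_ne_atTop 0] with n hn
  have hn' : (n : ℝ) ≠ 0 := Nat.cast_ne_zero.2 hn
  have := hM.smul_mem (s := ((n : ℝ) * (c * f ⬝ᵥ y))⁻¹) (t := ((n : ℝ) * (-c * ψ ⬝ᵥ x))⁻¹)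
    (inv_ne_zero (mul_ne_zero hn' (mul_ne_zero hc hy)))
    (inv_ne_zero (mul_ne_zero hn' (mul_ne_zero (neg_ne_zero.2 hc) hψ))) (hM.act_mem (hgΓ n) h)
  rw [mat_inv_of_transMat hfx (hgm n), hgm n, transMat_mulVec, vecMul_transMat] at this
  convert this using 5 <;> ring

theorem InvClosed.mem_of_transvection_of_fixed (hM : InvClosed Γ M) {x f : Vec} (hfx : f ⬝ᵥ x = 0)
    {c : ℝ} (hc : c ≠ 0) (hg : ∀ n : ℕ, ∃ g ∈ Γ, mat g = transMat (n * c) x f) (hf0 : f ≠ 0)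
    {y ψ : Vec} (h : (y, ψ) ∈ M) (hy : f ⬝ᵥ y = 0) (hψ : ψ ⬝ᵥ x ≠ 0) : (y, f) ∈ M := by
  choose g hgΓ hgm using hg
  have h2 := tendsto_smul_add (y := ψ) (x := f) (mul_ne_zero (neg_ne_zero.2 hc) hψ)
  refine hM.mem_of_tendsto tendsto_const_nhds h2 (hM.subset h).1 hf0 ?_
  filter_upwards [eventually_ne_atTop 0] with n hn
  have hn' : (n : ℝ) ≠ 0 := Nat.cast_ne_zero.2 hn
  have := hM.smul_mem (t := ((n : ℝ) * (-c * ψ ⬝ᵥ x))⁻¹) one_ne_zero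
    (inv_ne_zero (mul_ne_zero hn' (mul_ne_zero (neg_ne_zero.2 hc) hψ))) (hM.act_mem (hgΓ n) h)
  rw [mat_inv_of_transMat hfx (hgm n), hgm n, transMat_mulVec, vecMul_transMat, hy, mul_zero,
    zero_smul, add_zero, one_smul] at this
  convert this using 5
  ring

/-! ### Groups containing enough elementary matrices -/

theorem InvClosed.mem_point_of_elementary (hM : InvClosed Γ M)
    (hΓ : IsZariskiDense (Γ : Set SL(3, ℝ))) {k : ℝ} (hk : k ≠ 0)
    (hg : ∀ m n : ℤ, ∃ g ∈ Γ, mat g = transMat k (Pi.single 0 1) ![0, m, n])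
    (φ : Vec) (hφ : φ ≠ 0) (h0 : Pi.single 0 1 ⬝ᵥ φ = 0) : (Pi.single 0 1, φ) ∈ M := by
  have key : ∀ m n : ℤ, (![0, (m : ℝ), (n : ℝ)] : Vec) ≠ 0 →
      ((Pi.single 0 1, ![0, (m : ℝ), (n : ℝ)]) : Vec × Vec) ∈ M := by
    intro m n hmn
    obtain ⟨y, ψ, hyψ, hy, hψ⟩ := hM.exists_generic hΓ {![0, (m : ℝ), (n : ℝ)]} {Pi.single 0 1}
      (by simpa using hmn.symm) (zero_notMem_singleton_single 0)
    refine hM.mem_of_transvection (by simp) hk (fun j => ?_) hyψ (hy _ (by simp)) ?_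
    · obtain ⟨g, hgΓ, hgm⟩ := hg (j * m) (j * n)
      refine ⟨g, hgΓ, hgm.trans ?_⟩
      ext i l
      fin_cases i <;> fin_cases l <;> simp [transMat, vecMulVec] <;> ring
    · rw [dotProduct_comm]
      exact hψ _ (by simp)
  have hφ0 : φ 0 = 0 := by simpa using h0
  have hlim : Tendsto (fun j : ℕ => (![0, (⌊φ 1 * j⌋ : ℝ) * (j : ℝ)⁻¹,
      (⌊φ 2 * j⌋ : ℝ) * (j : ℝ)⁻¹] : Vec)) atTop (𝓝 φ) :=
    tendsto_vec3 (by rw [hφ0]; exact tendsto_const_nhds) (tendsto_floor_mul _) (tendsto_floor_mul _)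
  refine hM.mem_of_tendsto tendsto_const_nhds hlim (by simp) hφ ?_
  filter_upwards [hlim.eventually_ne hφ, eventually_ne_atTop 0] with j hj hj0
  have hj' : (j : ℝ) ≠ 0 := Nat.cast_ne_zero.2 hj0
  have e : (![0, (⌊φ 1 * j⌋ : ℝ) * (j : ℝ)⁻¹, (⌊φ 2 * j⌋ : ℝ) * (j : ℝ)⁻¹] : Vec) =
      (j : ℝ)⁻¹ • ![0, (⌊φ 1 * j⌋ : ℝ), (⌊φ 2 * j⌋ : ℝ)] := by
    ext i
    fin_cases i <;> simp [mul_comm]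
  rw [e] at hj ⊢
  have := hM.smul_mem (s := 1) one_ne_zero (inv_ne_zero hj')
    (key ⌊φ 1 * j⌋ ⌊φ 2 * j⌋ fun h => hj (by rw [h, smul_zero]))
  rwa [one_smul] at this

theorem mem_coneOrbit_of_elementary {k : ℝ} (hk : k ≠ 0)
    (hg : ∀ m n : ℤ, ∃ g ∈ Γ, mat g = transMat k (Pi.single 0 1) ![0, m, n])
    (hg' : ∀ m n : ℤ, ∃ g ∈ Γ, mat g = transMat k ![0, m, n] (Pi.single 0 1))
    {m n : ℤ} (hmn : IsCoprime m n) (hn : n ≠ 0) (N : ℤ) :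
    ![(1 + k ^ 2 * N) * (k * n)⁻¹, m * (n : ℝ)⁻¹, 1] ∈ coneOrbit Γ (Pi.single 0 1) := by
  obtain ⟨a, b, hab⟩ := hmn
  obtain ⟨g, hgΓ, hgm⟩ := hg' m n
  obtain ⟨g', hgΓ', hgm'⟩ := hg (N * a) (N * b)
  have hn' : (n : ℝ) ≠ 0 := Int.cast_ne_zero.2 hn
  refine ⟨(k * n)⁻¹, by positivity, g' * g, mul_mem hgΓ' hgΓ, ?_⟩
  rw [mat_mul, ← mulVec_mulVec, hgm, hgm', transMat_mulVec, transMat_mulVec]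
  have hab' : (a * m + b * n : ℝ) = 1 := by exact_mod_cast hab
  have e : (Pi.single 0 1 : Vec) = ![1, 0, 0] := by
    ext i
    fin_cases i <;> rfl
  rw [e]
  ext i
  fin_cases i
  · simp [dotProduct, Fin.sum_univ_three]
    linear_combination (-k ^ 2 * N * (n : ℝ)⁻¹ * k⁻¹) * hab'
  · simp
    field_simp
  · simp
    field_simp

theorem closure_coneOrbit_of_elementary {k : ℝ} (hk : k ≠ 0)
    (hg : ∀ m n : ℤ, ∃ g ∈ Γ, mat g = transMat k (Pi.single 0 1) ![0, m, n])
    (hg' : ∀ m n : ℤ, ∃ g ∈ Γ, mat g = transMat k ![0, m, n] (Pi.single 0 1)) (x : Vec) :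
    x ∈ closure (coneOrbit Γ (Pi.single 0 1)) := by
  have h2 : Tendsto (fun r : ℕ => 2 ^ r) atTop (atTop : Filter ℕ) :=
    tendsto_pow_atTop_atTop_of_one_lt one_lt_two
  have key : ∀ a b : ℝ, ![a, b, 1] ∈ closure (coneOrbit Γ (Pi.single 0 1)) := by
    intro a b
    let m : ℕ → ℤ := fun j => 2 * ⌊b / 2 * j⌋ + 1
    let N : ℕ → ℤ := fun j => ⌊a / k * j⌋
    have h0 : Tendsto (fun j : ℕ => (1 + k ^ 2 * N j) * (k * (j : ℝ))⁻¹) atTop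
        (𝓝 ((![a, b, 1] : Vec) 0)) := by
      have := (tendsto_inv_natCast.const_mul k⁻¹).add ((tendsto_floor_mul (a / k)).const_mul k)
      refine (this.congr fun j => ?_).trans (le_of_eq ?_)
      · simp only [N]
        field_simp
      · congr 1
        simp only [cons_val_zero]
        field_simp
        ring
    have h1 : Tendsto (fun j : ℕ => m j * (j : ℝ)⁻¹) atTop (𝓝 ((![a, b, 1] : Vec) 1)) := by
      have := ((tendsto_floor_mul (b / 2)).const_mul 2).add tendsto_inv_natCast
      refine (this.congr fun j => ?_).trans (le_of_eq ?_)
      · simp only [m]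
        push_cast
        ring
      · congr 1
        simp
        ring
    refine mem_closure_of_tendsto ((tendsto_vec3 h0 h1
      (x := ![a, b, 1]) (c := fun _ => 1) tendsto_const_nhds).comp h2) (Eventually.of_forall
      fun r => ?_)
    have hcop : IsCoprime (m (2 ^ r)) (((2 ^ r : ℕ) : ℤ)) := by
      push_cast
      refine IsCoprime.pow_right ⟨1, -⌊b / 2 * ((2 ^ r : ℕ) : ℝ)⌋, ?_⟩
      simp only [m]
      ring
    have := mem_coneOrbit_of_elementary hk hg hg' hcop (by positivity) (N (2 ^ r))
    rwa [Int.cast_natCast] at this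
  have hsmul : ∀ {c : ℝ} {x : Vec}, c ≠ 0 → x ∈ closure (coneOrbit Γ (Pi.single 0 1)) →
      c • x ∈ closure (coneOrbit Γ (Pi.single 0 1)) := by
    intro c x hc hx
    refine map_mem_closure (f := fun y : Vec => c • y) (continuous_const_smul c) hx ?_
    rintro _ ⟨d, hd, g, hgΓ, rfl⟩
    exact ⟨c * d, mul_ne_zero hc hd, g, hgΓ, (mul_smul _ _ _).symm⟩
  have key2 : ∀ x : Vec, x 2 ≠ 0 → x ∈ closure (coneOrbit Γ (Pi.single 0 1)) := by
    intro x hx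
    convert hsmul hx (key (x 0 / x 2) (x 1 / x 2))
    ext i
    fin_cases i <;> simp <;> field_simp
  by_cases hx : x 2 = 0
  · rw [← closure_closure]
    have hlim : Tendsto (fun n : ℕ => (![x 0, x 1, ((n + 1 : ℕ) : ℝ)⁻¹] : Vec)) atTop (𝓝 x) := by
      refine tendsto_vec3 tendsto_const_nhds tendsto_const_nhds ?_
      rw [hx]
      exact (tendsto_add_atTop_iff_nat 1).2 tendsto_inv_natCast
    refine mem_closure_of_tendsto hlim (Eventually.of_forall fun n => key2 _ ?_)
    simp only [cons_val]
    positivity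
  · exact key2 x hx

theorem flagMinimal_of_elementary (hΓ : IsZariskiDense (Γ : Set SL(3, ℝ))) {k : ℝ} (hk : k ≠ 0)
    (hg : ∀ m n : ℤ, ∃ g ∈ Γ, mat g = transMat k (Pi.single 0 1) ![0, m, n])
    (hg' : ∀ m n : ℤ, ∃ g ∈ Γ, mat g = transMat k ![0, m, n] (Pi.single 0 1)) :
    FlagMinimal Γ := fun _ hM _ hq =>
  hM.mem_of_mem_closure_coneOrbit (by simp) (hM.mem_point_of_elementary hΓ hk hg) hq
    (closure_coneOrbit_of_elementary hk hg hg' _)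

/-! ### Groups containing the block-diagonal `SL(2, ℤ)` -/

theorem exists_transMat_of_blockSL2 (hg : ∀ A, blockSL2 A ∈ Γ) (a b n : ℤ) :
    ∃ g ∈ Γ, mat g = transMat n ![a, b, 0] ![-b, a, 0] := by
  refine ⟨blockSL2 ⟨!![1 - n * a * b, n * a ^ 2; -n * b ^ 2, 1 + n * a * b], ?_⟩, hg _, ?_⟩
  · rw [det_fin_two_of]
    ring
  · change blockMatrix !![1 - n * a * b, n * a ^ 2; -n * b ^ 2, 1 + n * a * b] = _
    ext i l
    fin_cases i <;> fin_cases l <;> 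
      simp [-mul_eq_mul_left_iff, -mul_eq_mul_right_iff, transMat, vecMulVec, blockMatrix] <;> ring

theorem InvClosed.mem_of_blockSL2 (hM : InvClosed Γ M) (hΓ : IsZariskiDense (Γ : Set SL(3, ℝ)))
    (hg : ∀ A, blockSL2 A ∈ Γ) {a b : ℝ} (hab : (![a, b, 0] : Vec) ≠ 0) :
    ((![a, b, 0], ![-b, a, 0]) : Vec × Vec) ∈ M := by
  have hne : ∀ {a b : ℝ}, (![a, b, 0] : Vec) ≠ 0 → (![-b, a, 0] : Vec) ≠ 0 := by
    intro a b h h0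
    refine h ?_
    have h1 := congrFun h0 0
    have h2 := congrFun h0 1
    simp at h1 h2
    simp [h1, h2]
  have key : ∀ a b : ℤ, (![(a : ℝ), (b : ℝ), 0] : Vec) ≠ 0 →
      ((![(a : ℝ), (b : ℝ), 0], ![-(b : ℝ), (a : ℝ), 0]) : Vec × Vec) ∈ M := by
    intro a b hab
    obtain ⟨y, ψ, hyψ, hy, hψ⟩ := hM.exists_generic hΓ {![-(b : ℝ), (a : ℝ), 0]}
      {![(a : ℝ), (b : ℝ), 0]} (by simpa using (hne hab).symm) (by simpa using hab.symm)
    refine hM.mem_of_transvection (c := 1) ?_ one_ne_zero (fun n => ?_) hyψ (hy _ (by simp)) ?_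
    · simp [dotProduct, Fin.sum_univ_three]
      ring
    · simpa using exists_transMat_of_blockSL2 hg a b n
    · rw [dotProduct_comm]
      exact hψ _ (by simp)
  have ha := tendsto_floor_mul a
  have hb := tendsto_floor_mul b
  have h1 : Tendsto (fun j : ℕ => (![(⌊a * j⌋ : ℝ) * (j : ℝ)⁻¹,
      (⌊b * j⌋ : ℝ) * (j : ℝ)⁻¹, 0] : Vec)) atTop (𝓝 ![a, b, 0]) :=
    tendsto_vec3 ha hb tendsto_const_nhds
  have h2 : Tendsto (fun j : ℕ => (![-((⌊b * j⌋ : ℝ) * (j : ℝ)⁻¹),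
      (⌊a * j⌋ : ℝ) * (j : ℝ)⁻¹, 0] : Vec)) atTop (𝓝 ![-b, a, 0]) :=
    tendsto_vec3 hb.neg ha tendsto_const_nhds
  refine hM.mem_of_tendsto h1 h2 hab (hne hab) ?_
  filter_upwards [h1.eventually_ne hab, eventually_ne_atTop 0] with j hj hj0
  have hj' : (j : ℝ) ≠ 0 := Nat.cast_ne_zero.2 hj0
  have e1 : (![(⌊a * j⌋ : ℝ) * (j : ℝ)⁻¹, (⌊b * j⌋ : ℝ) * (j : ℝ)⁻¹, 0] : Vec) =
      (j : ℝ)⁻¹ • ![(⌊a * j⌋ : ℝ), (⌊b * j⌋ : ℝ), 0] := by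
    ext i
    fin_cases i <;> simp [mul_comm]
  have e2 : (![-((⌊b * j⌋ : ℝ) * (j : ℝ)⁻¹), (⌊a * j⌋ : ℝ) * (j : ℝ)⁻¹, 0] : Vec) =
      (j : ℝ)⁻¹ • ![-(⌊b * j⌋ : ℝ), (⌊a * j⌋ : ℝ), 0] := by
    ext i
    fin_cases i <;> simp [mul_comm]
  rw [e1] at hj
  rw [e1, e2]
  exact hM.smul_mem (inv_ne_zero hj') (inv_ne_zero hj')
    (key ⌊a * j⌋ ⌊b * j⌋ fun h => hj (by rw [h, smul_zero]))

theorem mem_closure_dualConeOrbit_of_blockSL2 (hΓ : IsZariskiDense (Γ : Set SL(3, ℝ)))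
    (hg : ∀ A, blockSL2 A ∈ Γ) {g : SL(3, ℝ)} (hgΓ : g ∈ Γ) {φ : Vec} (hφ : φ ≠ 0)
    (h : φ ⬝ᵥ mat g *ᵥ Pi.single 2 1 = 0) : φ ∈ closure (dualConeOrbit Γ (Pi.single 2 1)) := by
  have hS := invClosed_closure_dualConeOrbit Γ (p := Pi.single 2 1) (by simp)
  set ψ := φ ᵥ* mat g with hψ
  have hψ0 : ψ ≠ 0 := vecMul_ne_zero g hφ
  have hψ2 : ψ 2 = 0 := by
    rw [dotProduct_mulVec] at h
    simpa using h
  have e : ψ = ![-(-ψ 0), ψ 1, 0] := by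
    ext i
    fin_cases i
    exacts [(neg_neg _).symm, rfl, hψ2]
  have hmem := hS.mem_of_blockSL2 hΓ hg (a := ψ 1) (b := -ψ 0) (fun h0 => hψ0 (by
    have h1 := congrFun h0 0
    have h2 := congrFun h0 1
    simp at h1 h2
    rw [e, h1, h2]
    simp))
  rw [← e] at hmem
  have := (hS.act_mem hgΓ hmem).2
  rwa [hψ, vecMul_vecMul_inv] at this

theorem InvClosed.mem_of_blockSL2_of_int (hM : InvClosed Γ M)
    (hΓ : IsZariskiDense (Γ : Set SL(3, ℝ))) (hg : ∀ A, blockSL2 A ∈ Γ) {a b : ℤ} {x : Vec}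
    (hφ : (![-(b : ℝ), (a : ℝ), 0] : Vec) ≠ 0) (hx : ![-(b : ℝ), (a : ℝ), 0] ⬝ᵥ x = 0)
    (hx2 : x 2 ≠ 0) : (x, ![-(b : ℝ), (a : ℝ), 0]) ∈ M := by
  set φ : Vec := ![-(b : ℝ), (a : ℝ), 0] with hφdef
  set e : Vec := ![(a : ℝ), (b : ℝ), 0] with he
  have hφe : φ ⬝ᵥ e = 0 := by
    simp [hφdef, he, dotProduct, Fin.sum_univ_three]
    ring
  have hx0 : x ≠ 0 := by rintro rfl; exact hx2 rfl
  obtain ⟨g, hgΓ, hgφ⟩ := hΓ.exists_dotProduct_mulVec_ne_zero (x := Pi.single 2 1) (α := φ)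
    (by simp) hφ
  set q := mat g *ᵥ Pi.single 2 1 with hq
  have hcc : crossProduct φ (crossProduct x q) = (φ ⬝ᵥ q) • x := by
    rw [cross_cross_eq_smul_sub_smul', dotProduct_comm x, hx, zero_smul, sub_zero]
  have hcr : crossProduct x q ≠ 0 := by
    intro h
    rw [h, map_zero] at hcc
    exact smul_ne_zero hgφ hx0 hcc.symm
  have hcl := mem_closure_dualConeOrbit_of_blockSL2 hΓ hg hgΓ hcr
    ((dotProduct_comm _ _).trans (dot_cross_self x q))
  obtain ⟨ψ, hψ, hψlim⟩ := mem_closure_iff_seq_limit.1 hcl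
  have hlim : Tendsto (fun n => crossProduct φ (ψ n)) atTop (𝓝 ((φ ⬝ᵥ q) • x)) := by
    rw [← hcc]
    have hc : Continuous fun y : Vec => crossProduct φ y :=
      LinearMap.continuous_of_finiteDimensional _
    exact (hc.tendsto _).comp hψlim
  have hmem : ((φ ⬝ᵥ q) • x, φ) ∈ M := by
    refine hM.mem_of_tendsto hlim tendsto_const_nhds (smul_ne_zero hgφ hx0) hφ ?_
    have hlim2 := ((continuous_apply (2 : Fin 3)).tendsto _).comp hlim
    filter_upwards [hlim2.eventually_ne (mul_ne_zero hgφ hx2)] with n hn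
    set u := crossProduct φ (ψ n) with hu
    replace hn : u 2 ≠ 0 := hn
    have hu0 : u ≠ 0 := by rintro h; rw [h] at hn; exact hn rfl
    have hφu : φ ⬝ᵥ u = 0 := dot_self_cross _ _
    obtain ⟨c, hc, k, hk, hψn⟩ := hψ n
    have huψ : Pi.single 2 1 ᵥ* mat k⁻¹ ⬝ᵥ u = 0 := by
      have := dot_cross_self φ (ψ n)
      rw [hψn, smul_dotProduct, smul_eq_mul, mul_eq_zero, ← hψn] at this
      exact this.resolve_left hc
    set v := mat k⁻¹ *ᵥ u with hv
    have hv2 : v 2 = 0 := by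
      rw [← dotProduct_mulVec] at huψ
      simpa using huψ
    have hve : v = ![v 0, v 1, 0] := by
      ext i
      fin_cases i
      exacts [rfl, rfl, hv2]
    have hv0 := mulVec_ne_zero k⁻¹ hu0
    rw [← hv, hve] at hv0
    have hflag := hM.act_mem hk (hM.mem_of_blockSL2 hΓ hg hv0)
    rw [← hve, hv, mulVec_inv_mulVec] at hflag
    set χ := ![-v 1, v 0, 0] ᵥ* mat k⁻¹ with hχ
    by_cases hχe : χ ⬝ᵥ e = 0
    · have hχ0 := (hM.subset hflag).2.1
      have hχu := (hM.subset hflag).2.2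
      simp only [dotProduct, Fin.sum_univ_three, hφdef, he, cons_val] at hχe hχu hφu
      have hab : (a : ℝ) ^ 2 + (b : ℝ) ^ 2 ≠ 0 := by
        intro h
        have h1 : (a : ℝ) = 0 := by nlinarith [sq_nonneg (a : ℝ), sq_nonneg (b : ℝ)]
        have h2 : (b : ℝ) = 0 := by nlinarith [sq_nonneg (a : ℝ), sq_nonneg (b : ℝ)]
        apply hφ
        simp [hφdef, h1, h2]
      set d := (χ 1 * a - χ 0 * b) / ((a : ℝ) ^ 2 + (b : ℝ) ^ 2) with hd
      have hχφ : χ = d • φ := by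
        ext i
        fin_cases i
        · simp [hφdef, hd]
          field_simp
          linear_combination a * hχe
        · simp [hφdef, hd]
          field_simp
          linear_combination b * hχe
        · simp only [Fin.reduceFinMk, hφdef, smul_eq_mul, Pi.smul_apply, cons_val, mul_zero]
          refine (mul_eq_zero.1 (?_ : χ 2 * u 2 = 0)).resolve_right hn
          have e0 : χ 0 = d * -b := by
            rw [hd]; field_simp
            linear_combination a * hχe
          have e1 : χ 1 = d * a := by
            rw [hd]; field_simp
            linear_combination b * hχe
          rw [e0, e1] at hχu
          linear_combination hχu - d * hφu
      have hd0 : d ≠ 0 := by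
        intro h
        rw [h, zero_smul] at hχφ
        exact hχ0 hχφ
      have := hM.smul_mem (s := 1) one_ne_zero (inv_ne_zero hd0) hflag
      rwa [hχφ, one_smul, smul_smul, inv_mul_cancel₀ hd0, one_smul] at this
    · refine hM.mem_of_transvection_of_fixed hφe (c := 1) one_ne_zero (fun n => ?_) hφ hflag hφu hχe
      simpa using exists_transMat_of_blockSL2 hg a b n
  have := hM.smul_mem (inv_ne_zero hgφ) (one_ne_zero (α := ℝ)) hmem
  rwa [one_smul, smul_smul, inv_mul_cancel₀ hgφ, one_smul] at this

theorem InvClosed.mem_lines_through_of_blockSL2 (hM : InvClosed Γ M)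
    (hΓ : IsZariskiDense (Γ : Set SL(3, ℝ))) (hg : ∀ A, blockSL2 A ∈ Γ) {x φ : Vec}
    (h : (x, φ) ∈ flags) (hφ2 : φ ⬝ᵥ Pi.single 2 1 = 0) : (x, φ) ∈ M := by
  obtain ⟨hx, hφ, hxφ⟩ := h
  replace hφ2 : φ 2 = 0 := by simpa using hφ2
  set a := φ 1 with ha
  set b := -φ 0 with hb
  have hφe : φ = ![-b, a, 0] := by
    ext i
    fin_cases i
    exacts [(neg_neg _).symm, rfl, hφ2]
  simp only at hx hφ hxφ
  have hab : a ^ 2 + b ^ 2 ≠ 0 := by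
    intro h
    have h1 : a = 0 := by nlinarith [sq_nonneg a, sq_nonneg b]
    have h2 : b = 0 := by nlinarith [sq_nonneg a, sq_nonneg b]
    apply hφ
    rw [hφe, h1, h2]
    simp
  set σ := (x 0 * a + x 1 * b) / (a ^ 2 + b ^ 2) with hσ
  rw [hφe] at hxφ
  simp only [dotProduct, Fin.sum_univ_three, cons_val] at hxφ
  have hx0 : x 0 = σ * a := by
    rw [hσ]; field_simp
    linear_combination -b * hxφ
  have hx1 : x 1 = σ * b := by
    rw [hσ]; field_simp
    linear_combination a * hxφ
  by_cases hx2 : x 2 = 0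
  · have hσ0 : σ ≠ 0 := by
      intro h
      apply hx
      ext i
      fin_cases i <;> simp [hx0, hx1, hx2, h]
    have := hM.smul_mem hσ0 (one_ne_zero (α := ℝ)) (hM.mem_of_blockSL2 hΓ hg (a := a) (b := b)
      (fun h => hab (by
        have h1 : a = 0 := congrFun h 0
        have h2 : b = 0 := congrFun h 1
        rw [h1, h2]; ring)))
    rw [one_smul, ← hφe] at this
    convert this using 2
    ext i
    fin_cases i <;> simp [hx0, hx1, hx2]
  · have la := tendsto_floor_mul a
    have lb := tendsto_floor_mul b
    have h1 : Tendsto (fun j : ℕ => (![σ * ((⌊a * j⌋ : ℝ) * (j : ℝ)⁻¹),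
        σ * ((⌊b * j⌋ : ℝ) * (j : ℝ)⁻¹), x 2] : Vec)) atTop (𝓝 x) := by
      refine tendsto_vec3 ?_ ?_ tendsto_const_nhds
      · rw [hx0]; exact la.const_mul σ
      · rw [hx1]; exact lb.const_mul σ
    have h2 : Tendsto (fun j : ℕ => (j : ℝ)⁻¹ • (![-(⌊b * j⌋ : ℝ), (⌊a * j⌋ : ℝ), 0] : Vec))
        atTop (𝓝 φ) := by
      refine (tendsto_vec3 (a := fun j : ℕ => -((⌊b * j⌋ : ℝ) * (j : ℝ)⁻¹))
        (b := fun j : ℕ => (⌊a * j⌋ : ℝ) * (j : ℝ)⁻¹) (c := fun _ => 0) ?_ la ?_).congr fun j => ?_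
      · rw [hφe]; exact lb.neg
      · rw [hφ2]; exact tendsto_const_nhds
      · ext i
        fin_cases i <;> simp [mul_comm]
    refine hM.mem_of_tendsto h1 h2 hx hφ ?_
    filter_upwards [h2.eventually_ne hφ, eventually_ne_atTop 0] with j hj hj0
    have hj' : (j : ℝ) ≠ 0 := Nat.cast_ne_zero.2 hj0
    have := hM.smul_mem (s := 1) one_ne_zero (inv_ne_zero hj') (hM.mem_of_blockSL2_of_int hΓ hg
      (a := ⌊a * j⌋) (b := ⌊b * j⌋) (x := ![σ * ((⌊a * j⌋ : ℝ) * (j : ℝ)⁻¹),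
        σ * ((⌊b * j⌋ : ℝ) * (j : ℝ)⁻¹), x 2]) (fun h => hj (by rw [h, smul_zero])) (by
          simp [dotProduct, Fin.sum_univ_three]; ring) hx2)
    rwa [one_smul] at this

theorem flagMinimal_of_blockSL2 (hΓ : IsZariskiDense (Γ : Set SL(3, ℝ)))
    (hg : ∀ A, blockSL2 A ∈ Γ) : FlagMinimal Γ := by
  intro M hM
  have hS := invClosed_closure_coneOrbit Γ (p := Pi.single 2 1) (by simp)
  refine hM.flags_subset_of_lines_through (p := Pi.single 2 1) (by simp)
    (fun x φ h h2 => hM.mem_lines_through_of_blockSL2 hΓ hg h h2) fun φ hφ => ?_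
  have key : ∀ a b : ℝ, (![a, b, 0] : Vec) ≠ 0 → φ 0 * a + φ 1 * b = 0 →
      ∃ y, y ≠ 0 ∧ φ ⬝ᵥ y = 0 ∧ y ∈ closure (coneOrbit Γ (Pi.single 2 1)) := fun a b h0 h1 =>
    ⟨_, h0, by simpa [dotProduct, Fin.sum_univ_three] using h1, (hS.mem_of_blockSL2 hΓ hg h0).2⟩
  by_cases h : φ 0 = 0
  · exact key 1 0 (by simp) (by simp [h])
  · exact key (-φ 1) (φ 0) (fun h' => h (congrFun h' 1)) (by ring)

end

/-! ### Groups containing a rank two group of positive diagonal matrices -/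

/-- `Γ` contains positive diagonal matrices whose `k`-th entry is negligible and for which the ratio
of the other two entries is arbitrarily close to any given positive number. -/
def HasDiagonals (Γ : Subgroup SL(3, ℝ)) : Prop :=
  ∀ i j k : Fin 3, i ≠ j → j ≠ k → i ≠ k → ∀ c : ℝ, 0 < c → ∀ ε : ℝ, 0 < ε →
    ∃ d : Fin 3 → ℝ, (∀ l, 0 < d l) ∧ |d i / d j - c| < ε ∧ d k / d j < ε ∧
      ∃ g ∈ Γ, mat g = diagonal d

theorem HasDiagonals.dual {Γ : Subgroup SL(3, ℝ)} (h : HasDiagonals Γ) :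
    HasDiagonals (dual Γ) := by
  intro i j k hij hjk hik c hc ε hε
  obtain ⟨d, h1, h2, h3, g, hg, hgd⟩ := h i j k hij hjk hik c hc ε hε
  exact ⟨d, h1, h2, h3, g.transpose, transpose_mem_dual hg, by
    rw [mat_transpose, hgd, diagonal_transpose]⟩

theorem eq_or_eq_or_eq_of_ne : ∀ {i j k : Fin 3} (_ : i ≠ j) (_ : j ≠ k) (_ : i ≠ k) (l : Fin 3),
    l = i ∨ l = j ∨ l = k := by
  decide

theorem mat_inv_of_diagonal {g : SL(3, ℝ)} {d : Vec} (hd : ∀ l, d l ≠ 0)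
    (h : mat g = diagonal d) : mat g⁻¹ = diagonal fun l => (d l)⁻¹ := by
  refine mat_inv_eq ?_
  rw [h, diagonal_mul_diagonal, ← diagonal_one]
  congr 1
  ext l
  exact mul_inv_cancel₀ (hd l)

section

variable {Γ : Subgroup SL(3, ℝ)} {M : Set (Vec × Vec)}

theorem InvClosed.edge_mem (hM : InvClosed Γ M) (hT : HasDiagonals Γ) {i j k : Fin 3} (hij : i ≠ j)
    (hjk : j ≠ k) (hik : i ≠ k) {y ψ : Vec} (h : (y, ψ) ∈ M) (hyj : y j ≠ 0)
    (hψ : ψ k ≠ 0) {s t : ℝ} (hs : 0 < s) (ht : 0 < t) :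
    (Pi.single i (s * y i) + Pi.single j (t * y j), Pi.single k 1) ∈ M := by
  choose d hd hdi hdk g hgΓ hgd using fun n : ℕ => hT i j k hij hjk hik (s / t) (by positivity)
    (1 / ((n : ℝ) + 1)) (by positivity)
  have h0 : Tendsto (fun n : ℕ => 1 / ((n : ℝ) + 1)) atTop (𝓝 0) :=
    tendsto_one_div_add_atTop_nhds_zero_nat
  have l1 : Tendsto (fun n => d n i / d n j) atTop (𝓝 (s / t)) := by
    rw [tendsto_iff_norm_sub_tendsto_zero]
    exact squeeze_zero (fun n => norm_nonneg _) (fun n => (hdi n).le) h0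
  have l2 : Tendsto (fun n => d n k / d n j) atTop (𝓝 0) :=
    squeeze_zero (fun n => (div_pos (hd n k) (hd n j)).le) (fun n => (hdk n).le) h0
  have l3 : Tendsto (fun n => d n k / d n i) atTop (𝓝 0) := by
    have := l2.div l1 (by positivity)
    rw [zero_div] at this
    refine this.congr fun n => ?_
    have := (hd n i).ne'
    have := (hd n j).ne'
    simp only [Pi.div_apply]
    field_simp
  have hmem : ∀ n, ((t / d n j) • (diagonal (d n) *ᵥ y),
      (d n k / ψ k) • (ψ ᵥ* diagonal fun l => (d n l)⁻¹)) ∈ M := by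
    intro n
    have := hM.smul_mem (s := t / d n j) (t := d n k / ψ k) (div_pos ht (hd n j)).ne'
      (div_ne_zero (hd n k).ne' hψ) (hM.act_mem (hgΓ n) h)
    rwa [mat_inv_of_diagonal (fun l => (hd n l).ne') (hgd n), hgd n] at this
  refine hM.mem_of_tendsto (l := atTop) ?_ ?_ ?_ (by simp) (Eventually.of_forall hmem)
  · refine tendsto_pi_nhds.2 fun l => ?_
    simp only [Pi.smul_apply, mulVec_diagonal, smul_eq_mul, Pi.add_apply]
    rcases eq_or_eq_or_eq_of_ne hij hjk hik l with rfl | rfl | rfl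
    · have := (l1.const_mul t).mul_const (y l)
      rw [Pi.single_eq_same, Pi.single_eq_of_ne hij, add_zero]
      convert this using 2
      · ring
      · field_simp
    · rw [Pi.single_eq_same, Pi.single_eq_of_ne hij.symm, zero_add]
      refine tendsto_const_nhds.congr fun n => ?_
      have := (hd n l).ne'
      field_simp
    · have := (l2.const_mul t).mul_const (y l)
      rw [Pi.single_eq_of_ne hik.symm, Pi.single_eq_of_ne hjk.symm, add_zero]
      rw [mul_zero, zero_mul] at this
      refine this.congr fun n => by ring
  · refine tendsto_pi_nhds.2 fun l => ?_
    simp only [Pi.smul_apply, vecMul_diagonal, smul_eq_mul]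
    rcases eq_or_eq_or_eq_of_ne hij hjk hik l with rfl | rfl | rfl
    · rw [Pi.single_eq_of_ne hik]
      have := l3.mul_const (ψ l / ψ k)
      rw [zero_mul] at this
      exact this.congr fun n => by ring
    · rw [Pi.single_eq_of_ne hjk]
      have := l2.mul_const (ψ l / ψ k)
      rw [zero_mul] at this
      exact this.congr fun n => by ring
    · rw [Pi.single_eq_same]
      refine tendsto_const_nhds.congr fun n => ?_
      have := (hd n l).ne'
      field_simp
  · intro h0
    have := congrFun h0 j
    rw [Pi.add_apply, Pi.single_eq_same, Pi.single_eq_of_ne hij.symm, zero_add] at this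
    exact mul_ne_zero ht.ne' hyj this

theorem InvClosed.vertex_mem (hM : InvClosed Γ M) (hT : HasDiagonals Γ) {i j k : Fin 3} (hij : i ≠ j)
    (hjk : j ≠ k) (hik : i ≠ k) {y ψ : Vec} (h : (y, ψ) ∈ M) (hyj : y j ≠ 0)
    (hψ : ψ k ≠ 0) : (Pi.single j 1, Pi.single k 1) ∈ M := by
  have hlim : Tendsto (fun n : ℕ => (Pi.single i (((n + 1 : ℕ) : ℝ)⁻¹ * y i) +
      Pi.single j (1 * y j) : Vec)) atTop (𝓝 (Pi.single j (y j))) := by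
    have h1 := ((tendsto_add_atTop_iff_nat 1).2 tendsto_inv_natCast).mul_const (y i)
    have h2 : Continuous fun a : ℝ => (Pi.single i a : Vec) :=
      continuous_single (A := fun _ => ℝ) i
    have h3 := ((h2.tendsto _).comp h1).add_const (Pi.single j (1 * y j))
    rw [zero_mul, Pi.single_zero, zero_add, one_mul] at h3
    simpa only [one_mul] using! h3
  have hmem := hM.mem_of_tendsto (φ := fun _ => Pi.single k 1) hlim tendsto_const_nhds
    (by simpa using hyj) (by simp) (Eventually.of_forall fun n =>
      hM.edge_mem hT hij hjk hik h hyj hψ (by positivity) one_pos)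
  have := hM.smul_mem (inv_ne_zero hyj) (one_ne_zero (α := ℝ)) hmem
  rw [one_smul, ← Pi.single_smul, smul_eq_mul, inv_mul_cancel₀ hyj] at this
  exact this

theorem mul_pos_of_forall_nonneg {κ a b c d : ℝ} (hκ : κ ≠ 0) (ha : a ≠ 0) (hb : b ≠ 0)
    (hD : a * d - b * c ≠ 0)
    (h : ∀ s t : ℝ, 0 < s → 0 < t → 0 ≤ κ * ((s * a + t * b) * (s * c + t * d))) : 0 < a * b := by
  by_contra hab
  have hab : a * b < 0 := lt_of_le_of_ne (not_lt.1 hab) (mul_ne_zero ha hb)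
  have hq : 0 < -b / a := by
    have : -b / a = -(a * b) / a ^ 2 := by field_simp
    rw [this]
    have : 0 < a ^ 2 := by positivity
    exact div_pos (neg_pos.2 hab) this
  set D := a * d - b * c with hDdef
  obtain ⟨η, hη, hη1, hη2⟩ : ∃ η : ℝ, 0 < η ∧ η < -b / a ∧ η * |κ * (a * c)| < |κ * D| := by
    have h1 : 0 < |κ * D| := abs_pos.2 (mul_ne_zero hκ hD)
    refine ⟨min ((-b / a) / 2) (|κ * D| / (|κ * (a * c)| + 1) / 2), by positivity, ?_, ?_⟩
    · exact (min_le_left _ _).trans_lt (by linarith)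
    · calc _ ≤ (|κ * D| / (|κ * (a * c)| + 1) / 2) * |κ * (a * c)| :=
            mul_le_mul_of_nonneg_right (min_le_right _ _) (abs_nonneg _)
        _ = |κ * D| / 2 * (|κ * (a * c)| / (|κ * (a * c)| + 1)) := by ring
        _ ≤ |κ * D| / 2 * 1 := by
            refine mul_le_mul_of_nonneg_left ?_ (by positivity)
            rw [div_le_one (by positivity)]
            linarith
        _ < |κ * D| := by linarith
  have key : ∀ δ : ℝ, 0 < -b / a + δ → 0 ≤ δ * (κ * D + δ * (κ * (a * c))) := by
    intro δ hδ
    have := h _ 1 hδ one_pos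
    convert this using 1
    rw [hDdef]
    field_simp
    ring
  have k1 := key η (by linarith)
  have k2 := key (-η) (by linarith)
  have k1' : 0 ≤ κ * D + η * (κ * (a * c)) := nonneg_of_mul_nonneg_right k1 hη
  have k2' : 0 ≤ -(κ * D) + η * (κ * (a * c)) :=
    nonneg_of_mul_nonneg_right (by linarith : 0 ≤ η * (-(κ * D) + η * (κ * (a * c)))) hη
  have hle : η * (κ * (a * c)) ≤ η * |κ * (a * c)| :=
    mul_le_mul_of_nonneg_left (le_abs_self _) hη.le
  have : |κ * D| ≤ η * |κ * (a * c)| := abs_le.2 ⟨by linarith, by linarith⟩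
  linarith

theorem minor_ne_zero (g : SL(3, ℝ)) {i j k : Fin 3} (hij : i ≠ j) (hjk : j ≠ k) (hik : i ≠ k)
    (h : mat g⁻¹ k 2 ≠ 0) : mat g 0 i * mat g 1 j - mat g 0 j * mat g 1 i ≠ 0 := by
  have e0 : mat g⁻¹ 0 2 = mat g 0 1 * mat g 1 2 - mat g 0 2 * mat g 1 1 := by
    rw [mat_inv, adjugate_fin_three]; rfl
  have e1 : mat g⁻¹ 1 2 = -(mat g 0 0 * mat g 1 2) + mat g 0 2 * mat g 1 0 := by
    rw [mat_inv, adjugate_fin_three]; rfl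
  have e2 : mat g⁻¹ 2 2 = mat g 0 0 * mat g 1 1 - mat g 0 1 * mat g 1 0 := by
    rw [mat_inv, adjugate_fin_three]; rfl
  intro h0
  apply h
  fin_cases i <;> fin_cases j <;> fin_cases k <;> simp at hij hjk hik h0 ⊢ <;>
    first
    | (rw [e0]; linarith)
    | (rw [e1]; linarith)
    | (rw [e2]; linarith)

theorem InvClosed.exists_opposite_sign (hM : InvClosed Γ M)
    (hΓ : IsZariskiDense (Γ : Set SL(3, ℝ))) (hT : HasDiagonals Γ) {x φ : Vec} (h : (x, φ) ∈ M)
    (hx : ∀ i, x i ≠ 0) (hφ : ∀ i, φ i ≠ 0) :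
    ∃ y ψ, (y, ψ) ∈ M ∧ ψ 2 ≠ 0 ∧ x 0 * x 1 * (y 0 * y 1) < 0 := by
  by_contra! H
  obtain ⟨g, hgΓ, hg⟩ := hΓ.exists_entries_ne_zero
  have hκ : x 0 * x 1 ≠ 0 := mul_ne_zero (hx 0) (hx 1)
  have edge : ∀ (k : SL(3, ℝ)), k ∈ Γ → (∀ i j, mat k i j ≠ 0 ∧ mat k⁻¹ i j ≠ 0) →
      ∀ {i j l : Fin 3}, i ≠ j → j ≠ l → i ≠ l → ∀ {y ψ : Vec}, (y, ψ) ∈ M → y i ≠ 0 → y j ≠ 0 →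
      ψ l ≠ 0 → 0 < (y i * mat k 0 i) * (y j * mat k 0 j) := by
    intro k hk hk0 i j l hij hjl hil y ψ hyψ hyi hyj hψ
    refine mul_pos_of_forall_nonneg (c := y i * mat k 1 i) (d := y j * mat k 1 j) hκ
      (mul_ne_zero hyi (hk0 0 i).1) (mul_ne_zero hyj (hk0 0 j).1) ?_ fun s t hs ht => ?_
    · have := mul_ne_zero (mul_ne_zero hyi hyj) (minor_ne_zero k hij hjl hil (hk0 l 2).2)
      convert this using 1
      ring
    · have hm := hM.act_mem hk (hM.edge_mem hT hij hjl hil hyψ hyj hψ hs ht)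
      have h2 : (Pi.single l 1 ᵥ* mat k⁻¹) 2 ≠ 0 := by
        rw [single_one_vecMul]
        exact (hk0 l 2).2
      have := H _ _ hm h2
      rw [mulVec_add] at this
      simp only [Pi.add_apply, mulVec_single, Pi.smul_apply,
        MulOpposite.smul_eq_mul_unop, MulOpposite.unop_op, col_apply] at this
      linarith
  have hg' : ∀ i j, mat g⁻¹ i j ≠ 0 ∧ mat g⁻¹⁻¹ i j ≠ 0 := fun i j =>
    ⟨(hg i j).2, by rw [inv_inv]; exact (hg i j).1⟩
  have vertex : (Pi.single 1 1, Pi.single 2 1) ∈ M :=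
    hM.vertex_mem hT (i := 0) (by decide) (by decide) (by decide) h (hx 1) (hφ 2)
  have hm := hM.act_mem hgΓ vertex
  rw [mulVec_single_one, single_one_vecMul] at hm
  have s1 := H _ _ hm (hg 2 2).2
  simp only [col_apply] at s1
  replace s1 : 0 < x 0 * x 1 * (mat g 0 1 * mat g 1 1) :=
    lt_of_le_of_ne s1 (mul_ne_zero hκ (mul_ne_zero (hg 0 1).1 (hg 1 1).1)).symm
  have p01 := edge g⁻¹ (inv_mem hgΓ) hg' (i := 0) (j := 1) (l := 2) (by decide) (by decide)
    (by decide) h (hx 0) (hx 1) (hφ 2)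
  have p02 := edge g⁻¹ (inv_mem hgΓ) hg' (i := 0) (j := 2) (l := 1) (by decide) (by decide)
    (by decide) h (hx 0) (hx 2) (hφ 1)
  have a1 := edge g hgΓ hg (i := 0) (j := 2) (l := 1) (by decide) (by decide)
    (by decide) h (hx 0) (hx 2) (hφ 1)
  have a2 := edge g hgΓ hg (i := 0) (j := 2) (l := 1) (by decide) (by decide)
    (by decide) hm (hg 0 1).1 (hg 2 1).1 (hg 2 1).2
  simp only [col_apply] at a2
  have hprod : 0 < x 0 * x 2 * (mat g 0 1 * mat g 2 1) := by
    have := mul_pos a1 a2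
    have h3 : (x 0 * mat g 0 0 * (x 2 * mat g 0 2)) *
        (mat g 0 1 * mat g 0 0 * (mat g 2 1 * mat g 0 2)) =
        (x 0 * x 2 * (mat g 0 1 * mat g 2 1)) * (mat g 0 0 * mat g 0 2) ^ 2 := by ring
    rw [h3] at this
    exact pos_of_mul_pos_left this (sq_nonneg _)
  have hz : mat g⁻¹ 0 0 * mat g 0 1 + mat g⁻¹ 0 1 * mat g 1 1 + mat g⁻¹ 0 2 * mat g 2 1 = 0 := by
    have := congrFun (congrFun (inv_mul_coe g) 0) 1
    rw [Matrix.mul_apply, Fin.sum_univ_three] at this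
    simpa using this
  have e1 : 0 < (mat g⁻¹ 0 0 * mat g 0 1) * (mat g⁻¹ 0 1 * mat g 1 1) := by
    have := mul_pos s1 p01
    have h3 : x 0 * x 1 * (mat g 0 1 * mat g 1 1) * (x 0 * mat g⁻¹ 0 0 * (x 1 * mat g⁻¹ 0 1)) =
      (mat g⁻¹ 0 0 * mat g 0 1) * (mat g⁻¹ 0 1 * mat g 1 1) * (x 0 * x 1) ^ 2 := by ring
    rw [h3] at this
    exact pos_of_mul_pos_left this (sq_nonneg _)
  have e2 : 0 < (mat g⁻¹ 0 0 * mat g 0 1) * (mat g⁻¹ 0 2 * mat g 2 1) := by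
    have := mul_pos hprod p02
    have h3 : x 0 * x 2 * (mat g 0 1 * mat g 2 1) * (x 0 * mat g⁻¹ 0 0 * (x 2 * mat g⁻¹ 0 2)) =
      (mat g⁻¹ 0 0 * mat g 0 1) * (mat g⁻¹ 0 2 * mat g 2 1) * (x 0 * x 2) ^ 2 := by ring
    rw [h3] at this
    exact pos_of_mul_pos_left this (sq_nonneg _)
  have := mul_eq_zero_of_right (mat g⁻¹ 0 0 * mat g 0 1) hz
  nlinarith [sq_nonneg (mat g⁻¹ 0 0 * mat g 0 1)]

theorem InvClosed.mem_line_of_diagonals (hM : InvClosed Γ M)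
    (hΓ : IsZariskiDense (Γ : Set SL(3, ℝ))) (hT : HasDiagonals Γ) (x : Vec) (hx : x ≠ 0)
    (hx2 : x ⬝ᵥ Pi.single 2 1 = 0) : (x, Pi.single 2 1) ∈ M := by
  classical
  have hS : (0 : Vec) ∉ Finset.univ.image fun i : Fin 3 => (Pi.single i 1 : Vec) := by
    simp only [Finset.mem_image, Finset.mem_univ, true_and, not_exists]
    intro i
    rw [Pi.single_eq_zero_iff]
    exact one_ne_zero
  obtain ⟨y, ψ, hyψ, hy, hψ⟩ := hM.exists_generic hΓ _ _ hS hS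
  have hy : ∀ i, y i ≠ 0 := fun i => by simpa using hy (Pi.single i 1) (by simp)
  have hψ : ∀ i, ψ i ≠ 0 := fun i => by simpa using hψ (Pi.single i 1) (by simp)
  obtain ⟨z, χ, hzχ, hχ, hsign⟩ := hM.exists_opposite_sign hΓ hT hyψ hy hψ
  have hz0 : z 0 ≠ 0 := by rintro h; simp [h] at hsign
  have hz1 : z 1 ≠ 0 := by rintro h; simp [h] at hsign
  have e01 : (0 : Fin 3) ≠ 1 := by decide
  have edge : ∀ {y ψ : Vec}, (y, ψ) ∈ M → y 0 ≠ 0 → y 1 ≠ 0 → ψ 2 ≠ 0 → ∀ {a b : ℝ}, a ≠ 0 → b ≠ 0 →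
      0 < a * b * (y 0 * y 1) → ((![a, b, 0], Pi.single 2 1) : Vec × Vec) ∈ M := by
    intro y ψ h h0 h1 h2 a b ha hb hab
    have hq : 0 < (a / y 0) * (b / y 1) := by
      have : (a / y 0) * (b / y 1) = a * b * (y 0 * y 1) / (y 0 * y 1) ^ 2 := by field_simp
      rw [this]
      exact div_pos hab (by positivity)
    have hm := hM.edge_mem hT e01 (k := 2) (by decide) (by decide) h h1 h2
      (abs_pos.2 (div_ne_zero ha h0)) (abs_pos.2 (div_ne_zero hb h1))
    obtain ⟨σ, hσ, hs1, hs2⟩ : ∃ σ : ℝ, σ ≠ 0 ∧ σ * |a / y 0| = a / y 0 ∧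
        σ * |b / y 1| = b / y 1 := by
      rcases pos_and_pos_or_neg_and_neg_of_mul_pos hq with ⟨p, q⟩ | ⟨p, q⟩
      · exact ⟨1, one_ne_zero, by rw [abs_of_pos p, one_mul], by rw [abs_of_pos q, one_mul]⟩
      · exact ⟨-1, by norm_num, by rw [abs_of_neg p]; ring, by rw [abs_of_neg q]; ring⟩
    have := hM.smul_mem hσ (one_ne_zero (α := ℝ)) hm
    rw [one_smul] at this
    convert this using 2
    ext i
    fin_cases i
    · simp [← mul_assoc, hs1, h0]
    · simp [← mul_assoc, hs2, h1]
    · simp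
  have key : ∀ {a b : ℝ}, a ≠ 0 → b ≠ 0 → ((![a, b, 0], Pi.single 2 1) : Vec × Vec) ∈ M := by
    intro a b ha hb
    have hyy : y 0 * y 1 ≠ 0 := mul_ne_zero (hy 0) (hy 1)
    rcases lt_or_gt_of_ne (mul_ne_zero (mul_ne_zero ha hb) hyy) with h | h
    · refine edge hzχ hz0 hz1 hχ ha hb ?_
      have := mul_pos_of_neg_of_neg h hsign
      have h3 : a * b * (y 0 * y 1) * (y 0 * y 1 * (z 0 * z 1)) =
        a * b * (z 0 * z 1) * (y 0 * y 1) ^ 2 := by ring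
      rw [h3] at this
      exact pos_of_mul_pos_left this (sq_nonneg _)
    · exact edge hyψ (hy 0) (hy 1) (hψ 2) ha hb h
  have hx2 : x 2 = 0 := by simpa using hx2
  have hu := (tendsto_add_atTop_iff_nat 1).2 tendsto_inv_natCast
  have hpert : ∀ a : ℝ, ∃ u : ℕ → ℝ, Tendsto u atTop (𝓝 a) ∧ ∀ n, u n ≠ 0 := by
    intro a
    by_cases ha : a = 0
    · exact ⟨_, ha ▸ hu, fun n => by positivity⟩
    · exact ⟨fun _ => a, tendsto_const_nhds, fun _ => ha⟩
  obtain ⟨u, hu, hu0⟩ := hpert (x 0)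
  obtain ⟨v, hv, hv0⟩ := hpert (x 1)
  exact hM.mem_of_tendsto (φ := fun _ => Pi.single 2 1)
    (tendsto_vec3 hu hv (by rw [hx2]; exact tendsto_const_nhds)) tendsto_const_nhds hx (by simp)
    (Eventually.of_forall fun n => key (hu0 n) (hv0 n))

theorem flagMinimal_of_diagonals (hΓ : IsZariskiDense (Γ : Set SL(3, ℝ))) (hT : HasDiagonals Γ) :
    FlagMinimal Γ :=
  flagMinimal_of_line_of_dual_line (ℓ := Pi.single 2 1) (p := Pi.single 2 1) (by simp) (by simp)
    (fun _ hM => hM.mem_line_of_diagonals hΓ hT)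
    fun _ hM => hM.mem_line_of_diagonals hΓ.dual hT.dual

end

/-! ### Integral matrices -/

theorem exists_intMatrix {g : SL(3, ℝ)} (hg : g ∈ integerSL3) :
    ∃ A : Matrix (Fin 3) (Fin 3) ℤ, mat g = A.map (Int.cast : ℤ → ℝ) := by
  obtain ⟨A, rfl⟩ := hg
  exact ⟨A.1, rfl⟩

theorem exists_trace_eq_intCast {g : SL(3, ℝ)} (hg : g ∈ integerSL3) :
    ∃ t : ℤ, (mat g).trace = t := by
  obtain ⟨A, hA⟩ := exists_intMatrix hg
  exact ⟨A.trace, by simp [hA, Matrix.trace]⟩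

theorem eq_one_or_neg_one_of_rat_root {r : ℚ} {t s : ℤ} (h : r ^ 3 - t * r ^ 2 + s * r - 1 = 0) :
    r = 1 ∨ r = -1 := by
  have hd : (r.den : ℚ) ≠ 0 := by exact_mod_cast r.den_ne_zero
  have hr : r = r.num / r.den := (Rat.num_div_den r).symm
  have hZ : r.num ^ 3 - t * r.num ^ 2 * r.den + s * r.num * r.den ^ 2 - (r.den : ℤ) ^ 3 = 0 := by
    have : (r.num : ℚ) ^ 3 - t * r.num ^ 2 * r.den + s * r.num * r.den ^ 2 - (r.den : ℚ) ^ 3 =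
        (r ^ 3 - t * r ^ 2 + s * r - 1) * r.den ^ 3 := by
      have e : (r.num : ℚ) = r * r.den := by
        rw [eq_comm]; exact Rat.mul_den_eq_num r
      rw [e]
      ring
    rw [h, zero_mul] at this
    exact_mod_cast this
  have hcop : IsCoprime r.num (r.den : ℤ) := by
    rw [Int.isCoprime_iff_gcd_eq_one]
    exact r.reduced
  have h1 : (r.den : ℤ) ∣ r.num ^ 3 :=
    ⟨t * r.num ^ 2 - s * r.num * r.den + r.den ^ 2, by linear_combination hZ⟩
  have h2 : r.num ∣ (r.den : ℤ) ^ 3 :=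
    ⟨r.num ^ 2 - t * r.num * r.den + s * r.den ^ 2, by linear_combination -hZ⟩
  have u1 : IsUnit (r.den : ℤ) := (hcop.symm.pow_right (n := 3)).isUnit_of_dvd' dvd_rfl h1
  have u2 : IsUnit r.num := (hcop.pow_right (n := 3)).isUnit_of_dvd' dvd_rfl h2
  have h3 : r.den = 1 := by
    rcases Int.isUnit_iff.1 u1 with h | h
    · exact_mod_cast h
    · have : (0 : ℤ) ≤ r.den := Int.natCast_nonneg _
      omega
  rw [hr, h3]
  rcases Int.isUnit_iff.1 u2 with h | h
  · left; rw [h]; norm_num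
  · right; rw [h]; norm_num

/-- A repeated real eigenvalue of an integral matrix of determinant one is `±1`. -/
theorem eq_one_or_neg_one_of_double_root {r q : ℝ} {t s : ℤ} (ht : (t : ℝ) = 2 * r + q)
    (hs : (s : ℝ) = r ^ 2 + 2 * r * q) (hq : r ^ 2 * q = 1) : r = 1 ∨ r = -1 := by
  by_cases h : 3 * s = t ^ 2
  · left
    have h' : 3 * (s : ℝ) = t ^ 2 := by exact_mod_cast h
    have h0 : (r - q) ^ 2 = 0 := by
      rw [ht, hs] at h'
      linear_combination -h'
    have hrq : r = q := sub_eq_zero.1 (pow_eq_zero_iff two_ne_zero |>.1 h0)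
    have h1 : (r - 1) * (r ^ 2 + r + 1) = 0 := by
      rw [← hrq] at hq
      linear_combination hq
    exact sub_eq_zero.1 ((mul_eq_zero.1 h1).resolve_right (by nlinarith [sq_nonneg (r + 1 / 2)]))
  · have h6 : (6 * s - 2 * t ^ 2 : ℝ) ≠ 0 := by
      intro h0
      apply h
      have : (3 * s : ℝ) = t ^ 2 := by linarith
      exact_mod_cast this
    have hr : r = ((9 - t * s) / (6 * s - 2 * t ^ 2) : ℚ) := by
      push_cast
      rw [eq_div_iff h6, ht, hs]
      linear_combination 9 * hq
    set ρ : ℚ := (9 - t * s) / (6 * s - 2 * t ^ 2)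
    have hroot : ρ ^ 3 - t * ρ ^ 2 + s * ρ - 1 = 0 := by
      have : (ρ : ℝ) ^ 3 - t * ρ ^ 2 + s * ρ - 1 = 0 := by
        rw [← hr, ht, hs]
        linear_combination hq
      exact_mod_cast this
    rw [hr]
    rcases eq_one_or_neg_one_of_rat_root hroot with h | h
    · left; rw [h]; norm_num
    · right; rw [h]; norm_num

/-! ### Change of basis -/

theorem exists_cube_eq (x : ℝ) : ∃ y : ℝ, y ^ 3 = x := by
  have h : Odd 3 := by decide
  rcases le_total 0 x with hx | hx
  · exact ⟨x ^ ((3 : ℕ) : ℝ)⁻¹, Real.rpow_inv_natCast_pow hx three_ne_zero⟩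
  · refine ⟨-(-x) ^ ((3 : ℕ) : ℝ)⁻¹, ?_⟩
    rw [h.neg_pow, Real.rpow_inv_natCast_pow (neg_nonneg.2 hx) three_ne_zero, neg_neg]

theorem exists_conj_eq (C : Matrix (Fin 3) (Fin 3) ℝ) (hC : C.det ≠ 0) :
    ∃ h : SL(3, ℝ), ∀ (g : SL(3, ℝ)) (B : Matrix (Fin 3) (Fin 3) ℝ),
      mat g * C = C * B ↔ mat (h⁻¹ * g * h) = B := by
  obtain ⟨κ, hκ⟩ := exists_cube_eq C.det⁻¹
  have hκ0 : κ ≠ 0 := by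
    rintro rfl
    exact inv_ne_zero hC (by rw [← hκ]; norm_num)
  refine ⟨mkSL (κ • C) ?_, fun g B => ?_⟩
  · rw [det_smul, Fintype.card_fin, hκ, inv_mul_cancel₀ hC]
  · set h := mkSL (κ • C) _
    have hm : mat h = κ • C := rfl
    rw [mat_mul, mat_mul, mul_assoc]
    constructor
    · intro e
      rw [hm, mul_smul_comm, e, ← smul_mul_assoc, ← hm, ← mul_assoc, inv_mul_coe, one_mul]
    · intro e
      have : mat h * (mat h⁻¹ * (mat g * mat h)) = mat h * B := by rw [e]
      rw [← mul_assoc, mul_inv_coe, one_mul, hm, mul_smul_comm, smul_mul_assoc] at this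
      exact smul_right_injective _ hκ0 this

/-- The matrix with the given columns. -/
def colMat (x y z : Vec) : Matrix (Fin 3) (Fin 3) ℝ :=
  !![x 0, y 0, z 0; x 1, y 1, z 1; x 2, y 2, z 2]

theorem det_colMat (x y z : Vec) : (colMat x y z).det = crossProduct x y ⬝ᵥ z := by
  simp [colMat, det_fin_three, cross_apply, dotProduct, Fin.sum_univ_three]
  ring

theorem mul_colMat (A : Matrix (Fin 3) (Fin 3) ℝ) (x y z : Vec) :
    A * colMat x y z = colMat (A *ᵥ x) (A *ᵥ y) (A *ᵥ z) := by
  ext i j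
  fin_cases i <;> fin_cases j <;>
    simp [colMat, Matrix.mul_apply, mulVec, dotProduct, Fin.sum_univ_three]

theorem colMat_mul (x y z : Vec) (B : Matrix (Fin 3) (Fin 3) ℝ) :
    colMat x y z * B = colMat (B 0 0 • x + B 1 0 • y + B 2 0 • z)
      (B 0 1 • x + B 1 1 • y + B 2 1 • z) (B 0 2 • x + B 1 2 • y + B 2 2 • z) := by
  ext i j
  fin_cases i <;> fin_cases j <;>
    simp [colMat, Matrix.mul_apply, Fin.sum_univ_three] <;> ring

theorem cross_mulVec (g : SL(3, ℝ)) (x y : Vec) :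
    crossProduct (mat g *ᵥ x) (mat g *ᵥ y) = crossProduct x y ᵥ* mat g⁻¹ := by
  rw [mat_inv, adjugate_fin_three, cross_apply, cross_apply]
  ext i
  fin_cases i <;> simp [vecMul, mulVec, dotProduct, Fin.sum_univ_three] <;> ring

theorem exists_eq_smul_add_smul {x y p : Vec} (hxy : crossProduct x y ≠ 0)
    (hp : crossProduct x y ⬝ᵥ p = 0) : ∃ a b : ℝ, p = a • x + b • y := by
  set ℓ := crossProduct x y with hℓ
  have h0 := (dotProduct_self_pos hxy).ne'
  have key : (ℓ ⬝ᵥ ℓ) • p = (crossProduct y ℓ ⬝ᵥ p) • x + (crossProduct ℓ x ⬝ᵥ p) • y +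
      (ℓ ⬝ᵥ p) • ℓ := by
    rw [hℓ]
    ext i
    fin_cases i <;> simp [cross_apply, dotProduct, Fin.sum_univ_three] <;> ring
  rw [hp, zero_smul, add_zero] at key
  refine ⟨(ℓ ⬝ᵥ ℓ)⁻¹ * (crossProduct y ℓ ⬝ᵥ p), (ℓ ⬝ᵥ ℓ)⁻¹ * (crossProduct ℓ x ⬝ᵥ p), ?_⟩
  rw [mul_smul, mul_smul, ← smul_add, ← key, smul_smul, inv_mul_cancel₀ h0, one_smul]

theorem eq_zero_of_smul_add_smul_eq_zero {x y : Vec} (hxy : crossProduct x y ≠ 0) {a b : ℝ}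
    (h : a • x + b • y = 0) : a = 0 ∧ b = 0 := by
  have h1 : crossProduct (a • x + b • y) y = a • crossProduct x y := by
    rw [map_add, map_smul, map_smul, LinearMap.add_apply, LinearMap.smul_apply,
      LinearMap.smul_apply, cross_self, smul_zero, add_zero]
  have h2 : crossProduct x (a • x + b • y) = b • crossProduct x y := by
    rw [map_add, map_smul, map_smul, cross_self, smul_zero, zero_add]
  rw [h, map_zero, LinearMap.zero_apply] at h1
  rw [h, map_zero] at h2
  exact ⟨(smul_eq_zero.1 h1.symm).resolve_right hxy, (smul_eq_zero.1 h2.symm).resolve_right hxy⟩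

/-! ### Elements with a non-real eigenvalue -/

/-- `w` is a complex eigenvector of `g` for the eigenvalue `μ`. -/
def IsComplexEigenvector (g : SL(3, ℝ)) (μ : ℂ) (w : Fin 3 → ℂ) : Prop :=
  w ≠ 0 ∧ (mat g).map (fun x : ℝ => (x : ℂ)) *ᵥ w = μ • w

theorem HasComplexEigenvalue.exists_eigenvector {g : SL(3, ℝ)} {μ : ℂ}
    (h : HasComplexEigenvalue g μ) : ∃ w, IsComplexEigenvector g μ w := by
  obtain ⟨w, hw⟩ := Module.End.HasEigenvalue.exists_hasEigenvector h
  refine ⟨w, hw.2, ?_⟩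
  have := hw.apply_eq_smul
  rwa [toLin'_apply] at this

theorem exists_conj_rotMat {g : SL(3, ℝ)} {μ : ℂ} (hμ : μ.im ≠ 0) {w : Fin 3 → ℂ}
    (hw : IsComplexEigenvector g μ w) : ∃ h : SL(3, ℝ), mat (h⁻¹ * g * h) = rotMat μ := by
  obtain ⟨hw0, hw⟩ := hw
  set u : Vec := fun i => (w i).re with hu
  set v : Vec := fun i => (w i).im with hv
  set α := μ.re with hα
  set β := μ.im with hβ
  have hgu : mat g *ᵥ u = α • u - β • v := by
    ext i
    have := congrArg Complex.re (congrFun hw i)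
    simpa [mulVec, dotProduct, Fin.sum_univ_three, hu, hv] using this
  have hgv : mat g *ᵥ v = α • v + β • u := by
    ext i
    have := congrArg Complex.im (congrFun hw i)
    simpa [mulVec, dotProduct, Fin.sum_univ_three, hu, hv] using this
  have hcross : crossProduct v u ≠ 0 := by
    intro hc
    have huv : u ≠ 0 ∨ v ≠ 0 := by
      by_contra! h
      apply hw0
      ext i
      exact Complex.ext (congrFun h.1 i) (congrFun h.2 i)
    have key : ∀ a : ℝ, v = a • u → False := by
      intro a ha
      rw [ha, mulVec_smul, hgu, ha] at hgv
      have h1 : (β * (1 + a ^ 2)) • u = 0 := by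
        ext i
        have := congrFun hgv i
        simp at this ⊢
        have h2 : β * ((1 + a ^ 2) * u i) = 0 := by linear_combination -this
        simpa [or_assoc] using h2
      have hu0 : u = 0 := (smul_eq_zero.1 h1).resolve_left
        (mul_ne_zero hμ (by positivity))
      rcases huv with h | h
      · exact h hu0
      · exact h (by rw [ha, hu0, smul_zero])
    by_cases hu0 : u = 0
    · refine hμ ?_
      have hv0 : v ≠ 0 := huv.resolve_left (not_not.2 hu0)
      rw [hu0, mulVec_zero, smul_zero, zero_sub, eq_comm, neg_eq_zero] at hgu
      exact (smul_eq_zero.1 hgu).resolve_right hv0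
    · have h1 := cross_cross_eq_smul_sub_smul' u v u
      rw [hc, map_zero] at h1
      refine key ((u ⬝ᵥ u)⁻¹ * (u ⬝ᵥ v)) ?_
      rw [mul_smul, eq_inv_smul_iff₀ (dotProduct_self_pos hu0).ne']
      rw [dotProduct_comm u v]
      exact sub_eq_zero.1 h1.symm
  set ℓ := crossProduct v u with hℓ
  set ρ := (Complex.normSq μ)⁻¹ with hρ
  have hnorm : Complex.normSq μ = α ^ 2 + β ^ 2 := by
    rw [Complex.normSq_apply]; ring
  have hn0 : Complex.normSq μ ≠ 0 := by
    rw [Ne, Complex.normSq_eq_zero]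
    rintro h
    exact hμ (by rw [hβ, h]; rfl)
  have hℓg : ℓ ᵥ* mat g⁻¹ = Complex.normSq μ • ℓ := by
    rw [hℓ, ← cross_mulVec, hgu, hgv, hnorm]
    ext i
    fin_cases i <;> simp [cross_apply] <;> ring
  have hℓg' : ℓ ᵥ* (mat g - ρ • 1) = 0 := by
    have : ℓ = (Complex.normSq μ • ℓ) ᵥ* mat g := by rw [← hℓg, vecMul_inv_vecMul]
    rw [smul_vecMul] at this
    rw [vecMul_sub, vecMul_smul, vecMul_one, sub_eq_zero]
    conv_rhs => rw [this]
    rw [smul_smul, hρ, inv_mul_cancel₀ hn0, one_smul]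
  obtain ⟨z, hz0, hz⟩ := exists_mulVec_eq_zero_iff.2 (exists_vecMul_eq_zero_iff.1 ⟨ℓ, hcross, hℓg'⟩)
  have hgz : mat g *ᵥ z = ρ • z := by
    rw [sub_mulVec, smul_mulVec, one_mulVec] at hz
    exact sub_eq_zero.1 hz
  have hdet : ℓ ⬝ᵥ z ≠ 0 := by
    intro h0
    obtain ⟨a, b, hab⟩ := exists_eq_smul_add_smul hcross h0
    have h1 : (a * (α - ρ) - b * β) • v + (a * β + b * (α - ρ)) • u = 0 := by
      have h2 := hgz
      rw [hab, mulVec_add, mulVec_smul, mulVec_smul, hgu, hgv] at h2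
      ext i
      have := congrFun h2 i
      simp at this ⊢
      linear_combination this
    obtain ⟨e1, e2⟩ := eq_zero_of_smul_add_smul_eq_zero hcross h1
    have e3 : β * (a ^ 2 + b ^ 2) = 0 := by linear_combination a * e2 - b * e1
    have e4 := (mul_eq_zero.1 e3).resolve_left hμ
    have ha : a = 0 := by nlinarith [sq_nonneg a, sq_nonneg b]
    have hb : b = 0 := by nlinarith [sq_nonneg a, sq_nonneg b]
    exact hz0 (by rw [hab, ha, hb]; simp)
  obtain ⟨h, hh⟩ := exists_conj_eq (colMat v u z) (by rwa [det_colMat])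
  refine ⟨h, (hh g _).1 ?_⟩
  rw [mul_colMat, colMat_mul, hgu, hgv, hgz]
  congr 1
  · simp [rotMat, hα, hβ]
  · simp [rotMat, hα, hβ]
    abel
  · simp [rotMat, hρ]

theorem trace_conj (h g : SL(3, ℝ)) : (mat (h⁻¹ * g * h)).trace = (mat g).trace := by
  rw [mat_mul, trace_mul_comm, ← mat_mul, ← mul_assoc, mul_inv_cancel, one_mul]

theorem mat_inv_of_rotMat {g : SL(3, ℝ)} {μ : ℂ} (hμ : μ ≠ 0) (h : mat g = rotMat μ) :
    mat g⁻¹ = rotMat μ⁻¹ := by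
  refine mat_inv_eq ?_
  rw [h, ← rotMat_mul, mul_inv_cancel₀ hμ, rotMat_one]

theorem trace_rotMat (μ : ℂ) : (rotMat μ).trace = 2 * μ.re + (Complex.normSq μ)⁻¹ := by
  simp [rotMat, trace_fin_three]
  ring

theorem im_pow_ne_zero_of_infinite_order {g h : SL(3, ℝ)} (hg : g ∈ integerSL3)
    (hord : ¬ IsOfFinOrder g) {μ : ℂ} (hμ : μ ≠ 0) (hgμ : mat (h⁻¹ * g * h) = rotMat μ) {n : ℕ}
    (hn : 0 < n) : (μ ^ n).im ≠ 0 := by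
  intro him
  obtain ⟨σ, hσ⟩ : ∃ σ : ℝ, μ ^ n = σ := ⟨(μ ^ n).re, Complex.ext rfl him⟩
  have hpow : h⁻¹ * g ^ n * h = (h⁻¹ * g * h) ^ n := by
    have := (conj_pow (a := h⁻¹) (b := g) (i := n)).symm
    rwa [inv_inv] at this
  have h1 : mat (h⁻¹ * g ^ n * h) = rotMat σ := by
    rw [hpow, ← hσ, rotMat_pow, ← hgμ]
    rfl
  have hσ0 : σ ≠ 0 := by
    rintro rfl
    exact pow_ne_zero n hμ (by simpa using hσ)
  have h2 : mat (h⁻¹ * (g ^ n)⁻¹ * h) = rotMat (σ : ℂ)⁻¹ := by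
    have := mat_inv_of_rotMat (Complex.ofReal_ne_zero.2 hσ0) h1
    rwa [_root_.mul_inv_rev, _root_.mul_inv_rev, inv_inv, ← mul_assoc] at this
  obtain ⟨t, ht⟩ := exists_trace_eq_intCast (pow_mem hg n)
  obtain ⟨s, hs⟩ := exists_trace_eq_intCast (inv_mem (pow_mem hg n))
  rw [← trace_conj h, h1, trace_rotMat, Complex.ofReal_re, Complex.normSq_ofReal] at ht
  rw [← trace_conj h, h2, trace_rotMat, ← Complex.ofReal_inv, Complex.ofReal_re,
    Complex.normSq_ofReal] at hs
  have hσ1 : σ = 1 ∨ σ = -1 := by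
    refine eq_one_or_neg_one_of_double_root (q := (σ * σ)⁻¹) ht.symm (hs.symm.trans ?_) ?_
    · field_simp
      ring
    · field_simp
  refine hord (isOfFinOrder_iff_pow_eq_one.2 ⟨n * 2, by positivity, ?_⟩)
  have h3 : h⁻¹ * (g ^ n) ^ 2 * h = 1 := by
    apply mat_injective
    have e : h⁻¹ * (g ^ n) ^ 2 * h = (h⁻¹ * g ^ n * h) * (h⁻¹ * g ^ n * h) := by group
    rw [e, mat_mul, h1, ← rotMat_mul, mat_one, ← rotMat_one]
    rcases hσ1 with rfl | rfl <;> norm_num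
  rw [pow_mul]
  have h4 : (g ^ n) ^ 2 = h * (h⁻¹ * (g ^ n) ^ 2 * h) * h⁻¹ := by group
  rw [h4, h3, mul_one, mul_inv_cancel]

theorem flagMinimal_of_complex_eigenvector {Γ : Subgroup SL(3, ℝ)} (hint : Γ ≤ integerSL3)
    (hΓ : IsZariskiDense (Γ : Set SL(3, ℝ))) {g : SL(3, ℝ)} (hg : g ∈ Γ) (hord : ¬ IsOfFinOrder g)
    {μ : ℂ} (hμ : μ.im ≠ 0) {w : Fin 3 → ℂ} (hw : IsComplexEigenvector g μ w) : FlagMinimal Γ := by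
  obtain ⟨h, hh⟩ := exists_conj_rotMat hμ hw
  have hμ0 : μ ≠ 0 := by rintro rfl; simp at hμ
  have him : ∀ n : ℕ, 0 < n → (μ ^ n).im ≠ 0 := fun n hn =>
    im_pow_ne_zero_of_infinite_order (hint hg) hord hμ0 hh hn
  have hnorm : ‖μ‖ ≠ 1 := by
    intro h1
    have hsq : μ.re ^ 2 + μ.im ^ 2 = 1 := by
      have := Complex.normSq_eq_norm_sq μ
      rw [h1, Complex.normSq_apply] at this
      linarith
    obtain ⟨t, ht⟩ := exists_trace_eq_intCast (hint hg)
    rw [← trace_conj h, hh, trace_rotMat, Complex.normSq_eq_norm_sq, h1] at ht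
    have hre : 2 * μ.re = ((t - 1 : ℤ) : ℝ) := by
      push_cast
      linarith
    have hpos : 0 < μ.im ^ 2 := by positivity
    have hlt : ((t - 1 : ℤ) : ℝ) ^ 2 < 2 ^ 2 := by
      rw [← hre]
      nlinarith
    have hlt' : (t - 1) ^ 2 < 2 ^ 2 := by exact_mod_cast hlt
    have hb := abs_lt.1 (sq_lt_sq.1 hlt')
    have hc : t - 1 = -1 ∨ t - 1 = 0 ∨ t - 1 = 1 := by
      norm_num at hb
      omega
    have h3 : (μ ^ 3).im = μ.im * (4 * μ.re ^ 2 - 1) := by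
      rw [pow_succ, pow_two]
      simp only [Complex.mul_im, Complex.mul_re]
      linear_combination -μ.im * hsq
    have h2 : (μ ^ 2).im = 2 * μ.re * μ.im := by
      rw [pow_two, Complex.mul_im]
      ring
    rcases hc with h | h | h
    · apply him 3 (by norm_num)
      rw [h3]
      have : 2 * μ.re = -1 := by rw [hre, h]; norm_num
      have : μ.re = -1 / 2 := by linarith
      rw [this]
      ring
    · apply him 2 (by norm_num)
      rw [h2, hre, h]
      simp
    · apply him 3 (by norm_num)
      rw [h3]
      have : 2 * μ.re = 1 := by rw [hre, h]; norm_num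
      have : μ.re = 1 / 2 := by linarith
      rw [this]
      ring
  refine FlagMinimal.of_conj (h := h) ?_
  have hmem : h⁻¹ * g * h ∈ conj h Γ := by
    rw [mem_conj]
    have : h * (h⁻¹ * g * h) * h⁻¹ = g := by group
    rwa [this]
  rcases lt_or_gt_of_ne hnorm with hlt | hgt
  · refine flagMinimal_of_rotMat (hΓ.conj h) (inv_mem hmem) (μ := μ⁻¹)
      (mat_inv_of_rotMat hμ0 hh) ?_ ?_
    · rw [norm_inv]
      exact (one_lt_inv₀ (norm_pos_iff.2 hμ0)).2 hlt
    · intro n hn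
      rw [inv_pow, Complex.inv_im]
      exact div_ne_zero (neg_ne_zero.2 (him n hn)) (by simpa using fun h => absurd h hμ0)
  · exact flagMinimal_of_rotMat (hΓ.conj h) hmem hh hgt him

/-! ### The three types of elements -/

theorem det_sub_smul_one {R : Type*} [CommRing R] (A : Matrix (Fin 3) (Fin 3) R) (c : R) :
    (A - c • 1).det = -(c ^ 3 - A.trace * c ^ 2 + A.adjugate.trace * c - A.det) := by
  simp [det_fin_three, adjugate_fin_three, trace_fin_three]
  ring

theorem exists_mulVec_eq_smul_of_root {K : Type*} [Field K] {A : Matrix (Fin 3) (Fin 3) K} {c : K}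
    (h : c ^ 3 - A.trace * c ^ 2 + A.adjugate.trace * c - A.det = 0) :
    ∃ v, v ≠ 0 ∧ A *ᵥ v = c • v := by
  obtain ⟨v, hv, h0⟩ := exists_mulVec_eq_zero_iff (M := A - c • 1).2 (by
    rw [det_sub_smul_one, h, neg_zero])
  refine ⟨v, hv, ?_⟩
  rw [sub_mulVec, smul_mulVec, one_mulVec] at h0
  exact sub_eq_zero.1 h0

theorem exists_cubic_root (t s : ℝ) : ∃ r : ℝ, r ^ 3 - t * r ^ 2 + s * r - 1 = 0 := by
  set M := 1 + |t| + |s| with hM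
  have ht := neg_abs_le t
  have ht' := le_abs_self t
  have hs := neg_abs_le s
  have h1 : 1 ≤ M := by linarith [abs_nonneg t, abs_nonneg s]
  have hc : Continuous fun r : ℝ => r ^ 3 - t * r ^ 2 + s * r - 1 := by fun_prop
  have hpos : 0 ≤ M ^ 3 - t * M ^ 2 + s * M - 1 := by
    have e1 : t * M ^ 2 ≤ |t| * M ^ 2 := by gcongr
    have e2 : -|s| * M ≤ s * M := by gcongr
    have e3 : |s| * M ≤ |s| * M ^ 2 := by
      gcongr
      nlinarith
    have e4 : M ^ 3 = M ^ 2 + |t| * M ^ 2 + |s| * M ^ 2 := by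
      rw [hM]
      ring
    nlinarith
  obtain ⟨r, -, hr⟩ := intermediate_value_Icc (by linarith : (0 : ℝ) ≤ M) hc.continuousOn
    ⟨by norm_num, hpos⟩
  exact ⟨r, hr⟩

theorem exists_conj_diagonal {g : SL(3, ℝ)} {d : Fin 3 → ℝ} (hd : Function.Injective d)
    (h : ∀ l, ∃ v : Vec, v ≠ 0 ∧ mat g *ᵥ v = d l • v) :
    ∃ k : SL(3, ℝ), mat (k⁻¹ * g * k) = diagonal d := by
  choose v hv0 hv using h
  have hli : LinearIndependent ℝ v :=
    Module.End.eigenvectors_linearIndependent' (toLin' (mat g)) d hd v fun l =>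
      Module.End.hasEigenvector_iff.2 ⟨Module.End.mem_eigenspace_iff.2 (hv l), hv0 l⟩
  set C : Matrix (Fin 3) (Fin 3) ℝ := (Matrix.of v)ᵀ with hC
  have hu : IsUnit C := Matrix.linearIndependent_cols_iff_isUnit.1 hli
  obtain ⟨k, hk⟩ := exists_conj_eq C ((Matrix.isUnit_iff_isUnit_det C).1 hu).ne_zero
  refine ⟨k, (hk g _).1 ?_⟩
  ext i j
  rw [mul_diagonal]
  have := congrFun (hv j) i
  rw [Pi.smul_apply, smul_eq_mul, mul_comm] at this
  exact this

/-- An element of `SL(3, ℝ)` has a non-real eigenvalue, or three distinct real eigenvalues, or a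
repeated real eigenvalue. -/
theorem eigenvalue_trichotomy (g : SL(3, ℝ)) :
    (∃ (μ : ℂ) (w : Fin 3 → ℂ), μ.im ≠ 0 ∧ IsComplexEigenvector g μ w) ∨
    (∃ (k : SL(3, ℝ)) (d : Fin 3 → ℝ), Function.Injective d ∧
      mat (k⁻¹ * g * k) = diagonal d) ∨
    ∃ r q : ℝ, (mat g).trace = 2 * r + q ∧ (mat g⁻¹).trace = r ^ 2 + 2 * r * q ∧
      r ^ 2 * q = 1 := by
  set t := (mat g).trace with ht
  set s := (mat g⁻¹).trace with hs
  have hadj : (mat g).adjugate.trace = s := by rw [hs, mat_inv]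
  obtain ⟨r, hr⟩ := exists_cubic_root t s
  set b := r - t with hb
  set c := s + r * b with hc
  have hrc : r * c = 1 := by
    rw [hc, hb]
    linear_combination hr
  have htr : t = r - b := by rw [hb]; ring
  have hsr : s = c - r * b := by rw [hc]; ring
  rcases lt_trichotomy (b ^ 2 - 4 * c) 0 with hΔ | hΔ | hΔ
  · left
    set σ := √(-(b ^ 2 - 4 * c)) with hσ
    have hσ2 : σ ^ 2 = -(b ^ 2 - 4 * c) := Real.sq_sqrt (by linarith)
    have hσ0 : 0 < σ := Real.sqrt_pos.2 (by linarith)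
    have hσC : (σ : ℂ) ^ 2 = -(b ^ 2 - 4 * c) := by exact_mod_cast hσ2
    set μ : ℂ := (-b + σ * Complex.I) / 2 with hμ
    have hμ2 : μ ^ 2 + b * μ + c = 0 := by
      rw [hμ]
      linear_combination (σ ^ 2 / 4 : ℂ) * Complex.I_sq - hσC / 4
    have hrcC : (r : ℂ) * c = 1 := by exact_mod_cast hrc
    obtain ⟨w, hw0, hw⟩ := exists_mulVec_eq_smul_of_root
      (A := (mat g).map (fun x : ℝ => (x : ℂ))) (c := μ) (by
        have e1 : ((mat g).map (fun x : ℝ => (x : ℂ))).trace = (t : ℂ) := by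
          simp [ht, Matrix.trace]
        have e2 : ((mat g).map (fun x : ℝ => (x : ℂ))).adjugate.trace = (s : ℂ) := by
          have := RingHom.map_adjugate Complex.ofRealHom (mat g)
          rw [RingHom.mapMatrix_apply, RingHom.mapMatrix_apply] at this
          rw [← hadj]
          change ((mat g).map Complex.ofRealHom).adjugate.trace = _
          rw [← this]
          simp [Matrix.trace]
        have e3 : ((mat g).map (fun x : ℝ => (x : ℂ))).det = 1 := by
          have := RingHom.map_det Complex.ofRealHom (mat g)
          rw [RingHom.mapMatrix_apply, det_mat, map_one] at this
          exact this.symm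
        rw [e1, e2, e3, htr, hsr]
        push_cast
        linear_combination (μ - r) * hμ2 + hrcC)
    refine ⟨μ, w, ?_, hw0, hw⟩
    simp [hμ, hσ0.ne']
  · right; right
    refine ⟨-b / 2, r, ?_, ?_, ?_⟩
    · rw [htr]; ring
    · rw [hsr]
      linear_combination -hΔ / 4
    · linear_combination hrc + r * hΔ / 4
  · right
    set σ := √(b ^ 2 - 4 * c) with hσ
    have hσ2 : σ ^ 2 = b ^ 2 - 4 * c := Real.sq_sqrt hΔ.le
    have hσ0 : 0 < σ := Real.sqrt_pos.2 hΔ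
    set p := (-b + σ) / 2 with hp
    set q := (-b - σ) / 2 with hq
    have hbp : b = -(p + q) := by rw [hp, hq]; ring
    have hcp : c = p * q := by
      rw [hp, hq]
      linear_combination hσ2 / 4
    have hpq : p ≠ q := by
      intro h
      rw [hp, hq] at h
      linarith
    rw [hcp] at hrc
    rw [hbp] at htr
    rw [hbp, hcp] at hsr
    by_cases h1 : r = p
    · right
      refine ⟨p, q, ?_, ?_, ?_⟩
      · rw [htr, h1]; ring
      · rw [hsr, h1]; ring
      · rw [← hrc, h1]; ring
    by_cases h2 : r = q
    · right
      refine ⟨q, p, ?_, ?_, ?_⟩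
      · rw [htr, h2]; ring
      · rw [hsr, h2]; ring
      · rw [← hrc, h2]; ring
    left
    have hinj : Function.Injective ![r, p, q] := by
      intro i j
      fin_cases i <;> fin_cases j <;> simp [h1, h2, hpq, Ne.symm h1, Ne.symm h2, hpq.symm]
    have hroot : ∀ l, ∃ v : Vec, v ≠ 0 ∧ mat g *ᵥ v = ![r, p, q] l • v := by
      intro l
      apply exists_mulVec_eq_smul_of_root
      rw [← ht, hadj, det_mat, htr, hsr]
      fin_cases l <;> simp <;> linear_combination hrc
    obtain ⟨k, hk⟩ := exists_conj_diagonal hinj hroot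
    exact ⟨k, _, hinj, hk⟩

theorem univ_eq_of_ne : ∀ {i j k : Fin 3} (_ : i ≠ j) (_ : j ≠ k) (_ : i ≠ k),
    (Finset.univ : Finset (Fin 3)) = {i, j, k} := by
  decide

@[to_additive]
theorem prod_eq_of_ne {M : Type*} [CommMonoid M] {i j k : Fin 3} (hij : i ≠ j) (hjk : j ≠ k)
    (hik : i ≠ k) (f : Fin 3 → M) : f i * f j * f k = f 0 * f 1 * f 2 := by
  rw [← Fin.prod_univ_three, univ_eq_of_ne hij hjk hik, Finset.prod_insert (by simp [hij, hik]),
    Finset.prod_insert (by simp [hjk]), Finset.prod_singleton, mul_assoc]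

theorem ne_zero_of_prod_eq_one {f : Fin 3 → ℝ} (h : f 0 * f 1 * f 2 = 1) (l : Fin 3) :
    f l ≠ 0 := by
  rw [← Fin.prod_univ_three] at h
  exact Finset.prod_ne_zero_iff.1 (h.trans_ne one_ne_zero) l (Finset.mem_univ l)

theorem exists_ne_ne : ∀ {i j : Fin 3} (_ : i ≠ j), ∃ k, j ≠ k ∧ i ≠ k := by
  decide

/-! ### Free abelian groups of rank two containing an element with distinct real eigenvalues -/

theorem eq_diagonal_of_commute {d : Fin 3 → ℝ} (hd : Function.Injective d)
    {B : Matrix (Fin 3) (Fin 3) ℝ} (h : Commute (diagonal d) B) : B = diagonal fun l => B l l := by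
  ext i j
  rw [diagonal_apply]
  split_ifs with hij
  · rw [hij]
  · have := congrFun (congrFun h.eq i) j
    rw [diagonal_mul, mul_diagonal, mul_comm, ← sub_eq_zero, ← mul_sub] at this
    exact (mul_eq_zero.1 this).resolve_right (sub_ne_zero.2 fun e => hij (hd e))

theorem finite_intMatrix_of_bounded (φ : ℤ × ℤ → SL(3, ℝ)) (hinj : Function.Injective φ)
    (hint : ∀ p, φ p ∈ integerSL3) (R : ℝ) (S : Set (ℤ × ℤ))
    (hS : ∀ p ∈ S, ∀ i j, |mat (φ p) i j| ≤ R) : S.Finite := by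
  choose A hA using fun p => exists_intMatrix (hint p)
  refine Set.Finite.of_injOn (f := fun p i j => A p i j)
    (t := Set.Icc (fun _ _ => -⌈R⌉ : Fin 3 → Fin 3 → ℤ) (fun _ _ => ⌈R⌉)) ?_ ?_ (Set.finite_Icc _ _)
  · intro p hp
    have key : ∀ i j, |A p i j| ≤ ⌈R⌉ := by
      intro i j
      have h1 := hS p hp i j
      rw [hA, map_apply] at h1
      have h2 := h1.trans (Int.le_ceil R)
      exact_mod_cast h2
    exact ⟨fun i j => (abs_le.1 (key i j)).1, fun i j => (abs_le.1 (key i j)).2⟩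
  · intro p _ q _ h
    have hAA : A p = A q := h
    exact hinj (mat_injective (by rw [hA, hA, hAA]))

theorem dense_range_of_injective {L : ℤ × ℤ →+ ℝ} (hL : ∀ p, L p = 0 → p = 0) :
    Dense (Set.range L) := by
  rcases L.range.dense_or_cyclic with h | ⟨a, ha⟩
  · exact h
  · exfalso
    have hmem : ∀ p, ∃ n : ℤ, n • a = L p := fun p => by
      rw [← AddSubgroup.mem_closure_singleton, ← ha]
      exact ⟨p, rfl⟩
    obtain ⟨m, hm⟩ := hmem (1, 0)
    obtain ⟨n, hn⟩ := hmem (0, 1)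
    have h0 : L (n • (1, 0) - m • (0, 1)) = 0 := by
      rw [map_sub, map_zsmul, map_zsmul, ← hm, ← hn, smul_comm, sub_self]
    have h1 := hL _ h0
    have hm0 : m = 0 := by simpa using congrArg Prod.snd h1
    rw [hm0, zero_smul] at hm
    simpa using congrArg Prod.fst (hL _ hm.symm)

theorem infinite_small_of_dense {L : ℤ × ℤ →+ ℝ} (hL : Dense (Set.range L)) {δ : ℝ} (hδ : 0 < δ) :
    {p | |L p| < δ}.Infinite := by
  intro hfin
  have hd := hL.sdiff_finite (hfin.image L)
  obtain ⟨_, hp, ⟨p, rfl⟩, hx⟩ := Metric.dense_iff.1 hd 0 δ hδ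
  rw [Metric.mem_ball, Real.dist_0_eq_abs] at hp
  exact hx ⟨p, hp, rfl⟩

/-- A group of positive diagonal matrices, parametrized by its logarithms, is rich in diagonal
elements as soon as the differences of logarithms have dense range and bounded sets are finite. -/
theorem exists_approx {ℓ : Fin 3 → ℤ × ℤ →+ ℝ} (hsum : ∀ p, ℓ 0 p + ℓ 1 p + ℓ 2 p = 0)
    (hne : ∀ i j, i ≠ j → ∀ p, ℓ i p = ℓ j p → p = 0)
    (hfin : ∀ K : ℝ, {p | ∀ l, |ℓ l p| ≤ K}.Finite) {i j k : Fin 3} (hij : i ≠ j) (hjk : j ≠ k)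
    (hik : i ≠ k) (x M : ℝ) {δ : ℝ} (hδ : 0 < δ) :
    ∃ p, |ℓ i p - ℓ j p - x| < δ ∧ ℓ k p - ℓ j p < M := by
  have hsum' : ∀ p, ℓ i p + ℓ j p + ℓ k p = 0 := by
    intro p
    rw [← hsum p]
    exact sum_eq_of_ne hij hjk hik fun l => ℓ l p
  have hdense : Dense (Set.range (ℓ i - ℓ j)) := dense_range_of_injective fun p hp =>
    hne i j hij p (sub_eq_zero.1 hp)
  obtain ⟨_, hp₀, p₀, rfl⟩ := Metric.dense_iff.1 hdense x (δ / 2) (half_pos hδ)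
  rw [Metric.mem_ball, Real.dist_eq, AddMonoidHom.sub_apply] at hp₀
  set K := |ℓ k p₀| + |x| + δ + 2 * |M|
  obtain ⟨p₁, hp₁, hK⟩ : ∃ p₁, |ℓ i p₁ - ℓ j p₁| < δ / 2 ∧ ℓ k p₁ < -K := by
    obtain ⟨p, hp, hK⟩ : ∃ p, |ℓ i p - ℓ j p| < δ / 2 ∧ K < |ℓ k p| := by
      by_contra! hcon
      refine infinite_small_of_dense hdense (half_pos hδ) ((hfin (K + δ)).subset fun p hp => ?_)
      have h1 : |ℓ i p - ℓ j p| < δ / 2 := hp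
      have h2 := abs_le.1 (hcon p h1)
      have h3 := hsum' p
      rw [abs_lt] at h1
      intro l
      rw [abs_le]
      rcases eq_or_eq_or_eq_of_ne hij hjk hik l with rfl | rfl | rfl <;> constructor <;> linarith
    rcases lt_abs.1 hK with h | h
    · refine ⟨-p, ?_, ?_⟩
      · rw [map_neg, map_neg, neg_sub_neg, abs_sub_comm]
        exact hp
      · rw [map_neg]
        linarith
    · exact ⟨p, hp, by linarith⟩
  refine ⟨p₀ + p₁, ?_, ?_⟩
  · rw [map_add, map_add, abs_lt]
    rw [abs_lt] at hp₀ hp₁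
    constructor <;> linarith
  · have h1 := hsum' p₀
    have h2 := hsum' p₁
    have h3 := le_abs_self (ℓ k p₀)
    have h4 := le_abs_self x
    have h5 := neg_abs_le M
    have h6 := abs_nonneg x
    have h7 := abs_nonneg M
    rw [abs_lt] at hp₀ hp₁
    rw [map_add, map_add]
    simp only [K] at hK
    linarith

theorem abs_mul_diagonal_mul_le (A B : Matrix (Fin 3) (Fin 3) ℝ) {d : Fin 3 → ℝ} {K : ℝ}
    (hd : ∀ l, |d l| ≤ K) (i j : Fin 3) :
    |(A * diagonal d * B) i j| ≤ K * ∑ i, ∑ j, ∑ l, |A i l| * |B l j| := by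
  have hK : 0 ≤ K := (abs_nonneg _).trans (hd 0)
  have h1 : |(A * diagonal d * B) i j| ≤ K * ∑ l, |A i l| * |B l j| := by
    rw [Matrix.mul_apply, Finset.mul_sum]
    refine (Finset.abs_sum_le_sum_abs _ _).trans (Finset.sum_le_sum fun l _ => ?_)
    rw [mul_diagonal, abs_mul, abs_mul]
    calc |A i l| * |d l| * |B l j| = |d l| * (|A i l| * |B l j|) := by ring
      _ ≤ K * (|A i l| * |B l j|) := by gcongr; exact hd l
  refine h1.trans (mul_le_mul_of_nonneg_left ?_ hK)
  have hn : ∀ i j, 0 ≤ ∑ l, |A i l| * |B l j| := fun i j =>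
    Finset.sum_nonneg fun l _ => by positivity
  exact (Finset.single_le_sum (f := fun j => ∑ l, |A i l| * |B l j|) (fun j _ => hn i j)
    (Finset.mem_univ j)).trans (Finset.single_le_sum
      (f := fun i => ∑ j, ∑ l, |A i l| * |B l j|) (fun i _ => Finset.sum_nonneg fun j _ => hn i j)
      (Finset.mem_univ i))

theorem flagMinimal_of_commuting_diagonal {Γ : Subgroup SL(3, ℝ)} (hint : Γ ≤ integerSL3)
    (hΓ : IsZariskiDense (Γ : Set SL(3, ℝ))) {φ : Multiplicative (ℤ × ℤ) →* SL(3, ℝ)}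
    (hφ : Function.Injective φ) (hφΓ : ∀ p, φ p ∈ Γ) {p₀ : Multiplicative (ℤ × ℤ)} {h : SL(3, ℝ)}
    {d₀ : Fin 3 → ℝ} (hd₀ : Function.Injective d₀) (hp₀ : mat (h⁻¹ * φ p₀ * h) = diagonal d₀) :
    FlagMinimal Γ := by
  set D : ℤ × ℤ → Fin 3 → ℝ := fun p l => mat (h⁻¹ * φ (.ofAdd p) * h) l l with hD
  have hmat : ∀ p, mat (h⁻¹ * φ (.ofAdd p) * h) = diagonal (D p) := by
    intro p
    refine eq_diagonal_of_commute hd₀ ?_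
    rw [← hp₀]
    change _ * _ = _ * _
    rw [← mat_mul, ← mat_mul]
    congr 1
    have : φ p₀ * φ (.ofAdd p) = φ (.ofAdd p) * φ p₀ := by rw [← map_mul, mul_comm, map_mul]
    calc h⁻¹ * φ p₀ * h * (h⁻¹ * φ (.ofAdd p) * h) = h⁻¹ * (φ p₀ * φ (.ofAdd p)) * h := by group
      _ = _ := by rw [this]; group
  have hmul : ∀ p q l, D (p + q) l = D p l * D q l := by
    intro p q l
    have e : h⁻¹ * φ (.ofAdd (p + q)) * h =
        (h⁻¹ * φ (.ofAdd p) * h) * (h⁻¹ * φ (.ofAdd q) * h) := by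
      rw [ofAdd_add, map_mul]
      group
    have := hmat (p + q)
    rw [e, mat_mul, hmat, hmat, diagonal_mul_diagonal] at this
    exact (congrFun (diagonal_injective this) l).symm
  have hprod : ∀ p, D p 0 * D p 1 * D p 2 = 1 := by
    intro p
    rw [← det_mat (h⁻¹ * φ (.ofAdd p) * h), hmat, det_diagonal, Fin.prod_univ_three]
  have hD0 : ∀ p l, D p l ≠ 0 := fun p => ne_zero_of_prod_eq_one (hprod p)
  have hone : ∀ p, D p = 1 → p = 0 := by
    intro p hp
    have h1 : h⁻¹ * φ (.ofAdd p) * h = 1 := by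
      apply mat_injective
      rw [hmat, hp, mat_one]
      exact diagonal_one
    have h2 : φ (.ofAdd p) = 1 := by
      have e : φ (.ofAdd p) = h * (h⁻¹ * φ (.ofAdd p) * h) * h⁻¹ := by group
      rw [e, h1]
      group
    exact ofAdd_eq_one.1 (hφ (h2.trans φ.map_one.symm))
  set ℓ : Fin 3 → ℤ × ℤ →+ ℝ := fun l => AddMonoidHom.mk' (fun p => Real.log (D p l))
    (fun p q => by rw [hmul, Real.log_mul (hD0 p l) (hD0 q l)]) with hℓ
  have hℓD : ∀ l p, ℓ l p = Real.log (D p l) := fun l p => rfl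
  have hexp : ∀ p l, D (p + p) l = Real.exp (2 * ℓ l p) := by
    intro p l
    rw [hmul, two_mul, Real.exp_add, hℓD, Real.exp_log_eq_abs (hD0 p l), abs_mul_abs_self]
  have hsum : ∀ p, ℓ 0 p + ℓ 1 p + ℓ 2 p = 0 := by
    intro p
    rw [hℓD, hℓD, hℓD, ← Real.log_mul (hD0 _ _) (hD0 _ _),
      ← Real.log_mul (mul_ne_zero (hD0 _ _) (hD0 _ _)) (hD0 _ _), hprod, Real.log_one]
  have hne : ∀ i j, i ≠ j → ∀ p, ℓ i p = ℓ j p → p = 0 := by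
    intro i j hij p hp
    obtain ⟨k, hjk, hik⟩ := exists_ne_ne hij
    have e1 : D (p + p) i = D (p + p) j := by rw [hexp, hexp, hp]
    have e2 : D (p + p) i * D (p + p) j * D (p + p) k = 1 := by
      rw [← hprod (p + p)]
      exact prod_eq_of_ne hij hjk hik _
    have hpos : 0 < D (p + p) i := by rw [hexp]; positivity
    obtain ⟨t, ht⟩ := exists_trace_eq_intCast (hint (hφΓ (.ofAdd (p + p))))
    obtain ⟨s, hs⟩ := exists_trace_eq_intCast (hint (hφΓ (.ofAdd (-(p + p)))))
    have hinv : ∀ l, D (-(p + p)) l = (D (p + p) l)⁻¹ := by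
      intro l
      refine eq_inv_of_mul_eq_one_left ?_
      rw [← hmul, neg_add_cancel, hD]
      simp [mat_one]
    have htr : ∀ q, (mat (φ (.ofAdd q))).trace = D q i + D q j + D q k := by
      intro q
      rw [← trace_conj h, hmat, trace_diagonal, Fin.sum_univ_three]
      exact (sum_eq_of_ne hij hjk hik _).symm
    rw [htr] at ht hs
    have hr := eq_one_or_neg_one_of_double_root (r := D (p + p) i) (q := D (p + p) k) (t := t)
      (s := s) (by rw [← ht, ← e1]; ring) (by
        have e3 : D (p + p) i ^ 2 * D (p + p) k = 1 := by rw [← e2, ← e1]; ring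
        have hi := hD0 (p + p) i
        have hk := hD0 (p + p) k
        rw [← hs, hinv, hinv, hinv, ← e1]
        field_simp
        linear_combination (-(2 * D (p + p) k + D (p + p) i)) * e3) (by rw [← e2, ← e1]; ring)
    have h1 : D (p + p) i = 1 := hr.resolve_right (by linarith)
    rw [← e1, h1, one_mul, one_mul] at e2
    have h0 : p + p = 0 := by
      apply hone
      ext l
      rcases eq_or_eq_or_eq_of_ne hij hjk hik l with rfl | rfl | rfl
      · exact h1
      · rw [← e1]; exact h1
      · exact e2
    have e4 := congrArg Prod.fst h0
    have e5 := congrArg Prod.snd h0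
    simp only [Prod.fst_add, Prod.snd_add, Prod.fst_zero, Prod.snd_zero] at e4 e5
    exact Prod.ext (by simp only [Prod.fst_zero]; omega) (by simp only [Prod.snd_zero]; omega)
  have hfin : ∀ K : ℝ, {p | ∀ l, |ℓ l p| ≤ K}.Finite := by
    intro K
    refine finite_intMatrix_of_bounded (fun p => φ (.ofAdd p)) (hφ.comp Multiplicative.ofAdd.injective)
      (fun p => hint (hφΓ _)) (Real.exp K * ∑ i, ∑ j, ∑ l, |mat h i l| * |mat h⁻¹ l j|) _ ?_
    intro p hp i j
    have e : φ (.ofAdd p) = h * (h⁻¹ * φ (.ofAdd p) * h) * h⁻¹ := by group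
    change |mat (φ (.ofAdd p)) i j| ≤ _
    rw [e, mat_mul, mat_mul, hmat]
    refine abs_mul_diagonal_mul_le _ _ (fun l => ?_) i j
    rw [← Real.exp_log_eq_abs (hD0 p l)]
    exact Real.exp_le_exp.2 ((le_abs_self _).trans (hp l))
  refine FlagMinimal.of_conj (h := h) (flagMinimal_of_diagonals (hΓ.conj h) ?_)
  intro i j k hij hjk hik c hc ε hε
  have hcont : ContinuousAt (fun x => Real.exp (2 * x)) (Real.log c / 2) := by fun_prop
  obtain ⟨δ, hδ, hδc⟩ := Metric.continuousAt_iff.1 hcont ε hε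
  obtain ⟨p, hp, hpM⟩ := exists_approx hsum hne hfin hij hjk hik (Real.log c / 2)
    (Real.log ε / 2) hδ
  have hdiv : ∀ l m, D (p + p) l / D (p + p) m = Real.exp (2 * (ℓ l p - ℓ m p)) := by
    intro l m
    rw [hexp, hexp, ← Real.exp_sub]
    ring_nf
  refine ⟨D (p + p), fun l => ?_, ?_, ?_, h⁻¹ * φ (.ofAdd (p + p)) * h, ?_, hmat _⟩
  · rw [hexp]; positivity
  · have := hδc (x := ℓ i p - ℓ j p) hp
    rw [hdiv]
    rwa [mul_div_cancel₀ _ two_ne_zero, Real.exp_log hc, Real.dist_eq] at this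
  · rw [hdiv, ← Real.lt_log_iff_exp_lt hε]
    linarith
  · rw [mem_conj]
    have e : h * (h⁻¹ * φ (.ofAdd (p + p)) * h) * h⁻¹ = φ (.ofAdd (p + p)) := by group
    rw [e]
    exact hφΓ _

/-! ### Unipotent free abelian groups of rank two containing a regular element -/

theorem cayley_hamilton_fin_three {R : Type*} [CommRing R] (A : Matrix (Fin 3) (Fin 3) R) :
    A ^ 3 = A.trace • A ^ 2 - A.adjugate.trace • A + A.det • 1 := by
  ext i j
  fin_cases i <;> fin_cases j <;>
    simp [pow_succ, Matrix.mul_apply, Fin.sum_univ_three, trace_fin_three, det_fin_three,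
      adjugate_fin_three] <;> ring

theorem sq_sub_one_pow_three_eq_zero {g : SL(3, ℝ)} (hg : g ∈ integerSL3) {r q : ℝ}
    (ht : (mat g).trace = 2 * r + q) (hs : (mat g⁻¹).trace = r ^ 2 + 2 * r * q)
    (hq : r ^ 2 * q = 1) : (mat (g * g) - 1) ^ 3 = 0 := by
  obtain ⟨t, ht'⟩ := exists_trace_eq_intCast hg
  obtain ⟨s, hs'⟩ := exists_trace_eq_intCast (inv_mem hg)
  have hr := eq_one_or_neg_one_of_double_root (ht'.symm.trans ht) (hs'.symm.trans hs) hq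
  have hq1 : q = 1 := by
    rcases hr with rfl | rfl <;> linarith
  have hch := cayley_hamilton_fin_three (mat g)
  rw [← mat_inv, det_mat, ht, hs, hq1, one_smul] at hch
  rw [mat_mul]
  set G := mat g
  have hcomm : Commute (G - 1) (G + 1) :=
    ((Commute.refl G).sub_left (Commute.one_left G)).add_right (Commute.one_right _)
  have hfac : G * G - 1 = (G - 1) * (G + 1) := by noncomm_ring
  rcases hr with rfl | rfl
  · have h3 : (G - 1) ^ 3 = 0 := by
      have : (G - 1) ^ 3 = G ^ 3 - 3 • G ^ 2 + 3 • G - 1 := by noncomm_ring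
      rw [this, hch]
      module
    rw [hfac, hcomm.mul_pow, h3, zero_mul]
  · have h3 : (G - 1) * (G + 1) ^ 2 = 0 := by
      have : (G - 1) * (G + 1) ^ 2 = G ^ 3 + G ^ 2 - G - 1 := by noncomm_ring
      rw [this, hch]
      module
    rw [hfac, hcomm.mul_pow, pow_succ' (G - 1), pow_succ (G + 1), ← mul_assoc, mul_assoc (G - 1),
      (hcomm.pow_pow 2 2).eq, ← mul_assoc, h3, zero_mul, zero_mul]

theorem colMat_mulVec (x y z v : Vec) : colMat x y z *ᵥ v = v 0 • x + v 1 • y + v 2 • z := by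
  ext i
  fin_cases i <;> simp [colMat, mulVec, dotProduct, Fin.sum_univ_three] <;> ring

theorem exists_conj_regMat {g : SL(3, ℝ)} (h3 : (mat g - 1) ^ 3 = 0) (h2 : (mat g - 1) ^ 2 ≠ 0) :
    ∃ h : SL(3, ℝ), mat (h⁻¹ * g * h) = regMat 1 0 := by
  set N := mat g - 1 with hN
  have hg : mat g = 1 + N := by rw [hN]; abel
  obtain ⟨w, hw⟩ : ∃ w, N *ᵥ (N *ᵥ w) ≠ 0 := by
    by_contra! hcon
    apply h2
    ext i j
    have := congrFun (hcon (Pi.single j 1)) i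
    rwa [mulVec_mulVec, mulVec_single_one, ← pow_two] at this
  have hN3 : ∀ v, N *ᵥ (N *ᵥ (N *ᵥ v)) = 0 := by
    intro v
    rw [mulVec_mulVec, mulVec_mulVec, ← pow_two, ← pow_succ, h3, zero_mulVec]
  have hC : (colMat (N *ᵥ (N *ᵥ w)) (N *ᵥ w) w).det ≠ 0 := by
    intro h0
    obtain ⟨v, hv, hv0⟩ := exists_mulVec_eq_zero_iff.2 h0
    rw [colMat_mulVec] at hv0
    have e2 : v 2 = 0 := by
      have := congrArg (fun u => N *ᵥ (N *ᵥ u)) hv0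
      simp only [mulVec_add, mulVec_smul, hN3, mulVec_zero, smul_zero, zero_add] at this
      exact (smul_eq_zero.1 this).resolve_right hw
    rw [e2, zero_smul, add_zero] at hv0
    have e1 : v 1 = 0 := by
      have := congrArg (fun u => N *ᵥ u) hv0
      simp only [mulVec_add, mulVec_smul, hN3, mulVec_zero, smul_zero, zero_add] at this
      exact (smul_eq_zero.1 this).resolve_right hw
    rw [e1, zero_smul, add_zero] at hv0
    have e0 : v 0 = 0 := (smul_eq_zero.1 hv0).resolve_right hw
    apply hv
    ext i
    fin_cases i
    exacts [e0, e1, e2]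
  obtain ⟨h, hh⟩ := exists_conj_eq _ hC
  refine ⟨h, (hh g _).1 ?_⟩
  rw [mul_colMat, colMat_mul, hg]
  simp only [add_mulVec, one_mulVec, hN3, regMat]
  congr 1 <;> simp [add_comm]

theorem eq_regMat_of_commute {g : SL(3, ℝ)} (h : Commute (regMat 1 0) (mat g)) :
    mat g = regMat (mat g 0 1) (mat g 0 2) := by
  have hdet := det_mat g
  set B := mat g
  have e := fun i j => congrFun (congrFun h.eq i) j
  have e00 := e 0 0
  have e01 := e 0 1
  have e02 := e 0 2
  have e10 := e 1 0
  have e11 := e 1 1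
  have e12 := e 1 2
  have e21 := e 2 1
  have e22 := e 2 2
  simp only [regMat, Matrix.mul_apply, Fin.sum_univ_three] at e00 e01 e02 e10 e11 e12 e21 e22
  simp at e00 e01 e02 e10 e11 e12 e21 e22
  have h10 : B 1 0 = 0 := by linarith
  have h20 : B 2 0 = 0 := by linarith
  have h21 : B 2 1 = 0 := by linarith
  have h11 : B 1 1 = B 0 0 := by linarith
  have h22 : B 2 2 = B 0 0 := by linarith
  have h12 : B 1 2 = B 0 1 := by linarith
  have h00 : B 0 0 = 1 := by
    rw [det_fin_three, h10, h20, h21, h11, h22] at hdet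
    have : (B 0 0 - 1) * (B 0 0 ^ 2 + B 0 0 + 1) = 0 := by linear_combination hdet
    exact sub_eq_zero.1
      ((mul_eq_zero.1 this).resolve_right (by nlinarith [sq_nonneg (B 0 0 + 1 / 2)]))
  ext i j
  fin_cases i <;> fin_cases j <;> simp [regMat, h10, h20, h21, h11, h22, h12, h00]

theorem exists_intCast_apply_eq {g : SL(3, ℝ)} (hg : g ∈ integerSL3) :
    ∃ A : Matrix (Fin 3) (Fin 3) ℤ, mat g - 1 = A.map (Int.cast : ℤ → ℝ) := by
  obtain ⟨A, hA⟩ := exists_intMatrix hg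
  refine ⟨A - 1, ?_⟩
  rw [hA]
  ext i j
  by_cases hij : i = j <;> simp [hij]

theorem flagMinimal_of_commuting_regular {Γ : Subgroup SL(3, ℝ)} (hint : Γ ≤ integerSL3)
    (hΓ : IsZariskiDense (Γ : Set SL(3, ℝ))) {φ : Multiplicative (ℤ × ℤ) →* SL(3, ℝ)}
    (hφ : Function.Injective φ) (hφΓ : ∀ p, φ p ∈ Γ) {p₀ : Multiplicative (ℤ × ℤ)}
    (h3 : (mat (φ p₀) - 1) ^ 3 = 0) (h2 : (mat (φ p₀) - 1) ^ 2 ≠ 0) :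
    FlagMinimal Γ := by
  obtain ⟨h, hh⟩ := exists_conj_regMat h3 h2
  obtain ⟨s, t, hst⟩ : ∃ s t : ℤ × ℤ → ℝ, ∀ p,
      mat (h⁻¹ * φ (.ofAdd p) * h) = regMat (s p) (t p) := by
    refine ⟨_, _, fun p => eq_regMat_of_commute ?_⟩
    rw [← hh]
    change _ * _ = _ * _
    rw [← mat_mul, ← mat_mul]
    congr 1
    have : φ p₀ * φ (.ofAdd p) = φ (.ofAdd p) * φ p₀ := by rw [← map_mul, mul_comm, map_mul]
    calc h⁻¹ * φ p₀ * h * (h⁻¹ * φ (.ofAdd p) * h) = h⁻¹ * (φ p₀ * φ (.ofAdd p)) * h := by group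
      _ = _ := by rw [this]; group
  have hinj : ∀ a b a' b' : ℝ, regMat a b = regMat a' b' → a = a' ∧ b = b' := by
    intro a b a' b' e
    exact ⟨congrFun (congrFun e 0) 1, congrFun (congrFun e 0) 2⟩
  have hadd : ∀ p q, s (p + q) = s p + s q ∧ t (p + q) = t p + t q + s p * s q := by
    intro p q
    apply hinj
    rw [← regMat_mul, ← hst, ← hst, ← hst, ← mat_mul, ofAdd_add, map_mul]
    congr 1
    group
  obtain ⟨S, rfl⟩ : ∃ S : ℤ × ℤ →+ ℝ, s = S := ⟨AddMonoidHom.mk' s fun p q => (hadd p q).1, rfl⟩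
  have h0 : ∀ p, S p = 0 → t p = 0 → p = 0 := by
    intro p hs ht
    have h1 : h⁻¹ * φ (.ofAdd p) * h = 1 := by
      apply mat_injective
      rw [hst, hs, ht, mat_one, regMat_zero]
    have h2 : φ (.ofAdd p) = 1 := by
      have e : φ (.ofAdd p) = h * (h⁻¹ * φ (.ofAdd p) * h) * h⁻¹ := by group
      rw [e, h1]
      group
    exact ofAdd_eq_one.1 (hφ (h2.trans φ.map_one.symm))
  have hp₀ := hst p₀.toAdd
  rw [ofAdd_toAdd, hh] at hp₀
  obtain ⟨hs₀, ht₀⟩ := hinj _ _ _ _ hp₀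
  obtain ⟨D, hD, hDS⟩ : ∃ D : ℤ, D ≠ 0 ∧ ∀ p, ∃ n : ℤ, S p * D = n := by
    have hrel : ∀ p, (mat (φ (.ofAdd p)) - 1) * (mat (φ p₀) - 1) = S p • (mat (φ p₀) - 1) ^ 2 := by
      intro p
      have hc : ∀ g : SL(3, ℝ), mat g - 1 = mat h * (mat (h⁻¹ * g * h) - 1) * mat h⁻¹ := by
        intro g
        rw [mul_sub, sub_mul, mul_one, mul_inv_coe, ← mat_mul, ← mat_mul]
        congr 2
        group
      have hc' : ∀ A B, (mat h * A * mat h⁻¹) * (mat h * B * mat h⁻¹) =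
          mat h * (A * B) * mat h⁻¹ := by
        intro A B
        rw [mul_assoc, mul_assoc (mat h) B, ← mul_assoc (mat h⁻¹) (mat h), inv_mul_coe, one_mul]
        simp only [mul_assoc]
      rw [pow_two, hc (φ p₀), hc (φ (.ofAdd p)), hc', hc', hh, hst, ← smul_mul_assoc,
        ← mul_smul_comm]
      congr 2
      ext i j
      fin_cases i <;> fin_cases j <;>
        simp [regMat, Matrix.mul_apply, Fin.sum_univ_three]
    obtain ⟨A, hA⟩ := exists_intCast_apply_eq (hint (hφΓ p₀))
    have hA2 : (mat (φ p₀) - 1) ^ 2 = (A * A).map (Int.cast : ℤ → ℝ) := by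
      rw [pow_two, hA]
      exact (Matrix.map_mul_intCast A A).symm
    obtain ⟨i, j, hij⟩ : ∃ i j, (A * A) i j ≠ 0 := by
      by_contra! hcon
      apply h2
      rw [hA2]
      ext i j
      simp [hcon]
    refine ⟨(A * A) i j, hij, fun p => ?_⟩
    obtain ⟨B, hB⟩ := exists_intCast_apply_eq (hint (hφΓ (.ofAdd p)))
    refine ⟨(B * A) i j, ?_⟩
    have := congrFun (congrFun (hrel p) i) j
    rw [hA2, hB, hA, ← Matrix.map_mul_intCast] at this
    exact this.symm
  obtain ⟨r₀, hr₀, hSr₀⟩ : ∃ r₀, r₀ ≠ 0 ∧ S r₀ = 0 := by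
    obtain ⟨m, hm⟩ := hDS (1, 0)
    obtain ⟨n, hn⟩ := hDS (0, 1)
    have hD' : (D : ℝ) ≠ 0 := Int.cast_ne_zero.2 hD
    refine ⟨(n, -m), ?_, ?_⟩
    · intro h00
      have en : n = 0 := congrArg Prod.fst h00
      have em : m = 0 := by simpa using congrArg Prod.snd h00
      rw [em, Int.cast_zero] at hm
      rw [en, Int.cast_zero] at hn
      have e1 := (mul_eq_zero.1 hm).resolve_right hD'
      have e2 := (mul_eq_zero.1 hn).resolve_right hD'
      have : S p₀.toAdd = 0 := by
        have e : p₀.toAdd = p₀.toAdd.1 • (1, 0) + p₀.toAdd.2 • (0, 1) := by ext <;> simp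
        rw [e, map_add, map_zsmul, map_zsmul, e1, e2, smul_zero, smul_zero, add_zero]
      rw [this] at hs₀
      exact one_ne_zero hs₀
    · have e : ((n, -m) : ℤ × ℤ) = n • (1, 0) + (-m) • (0, 1) := by ext <;> simp
      rw [e, map_add, map_zsmul, map_zsmul, zsmul_eq_mul, zsmul_eq_mul, Int.cast_neg, ← hm, ← hn]
      ring
  have htr₀ : t r₀ ≠ 0 := fun e => hr₀ (h0 r₀ hSr₀ e)
  have hSm : ∀ m : ℤ, S (m • r₀) = 0 := fun m => by rw [map_zsmul, hSr₀, smul_zero]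
  have htm : ∀ m : ℤ, t (m • r₀) = m * t r₀ := by
    intro m
    set F : ℤ →+ ℝ := AddMonoidHom.mk' (fun m => t (m • r₀)) (fun a b => by
      rw [add_smul, (hadd _ _).2, hSm, zero_mul, add_zero])
    have : F (m • 1) = m • F 1 := map_zsmul F m 1
    simpa [F] using this
  refine FlagMinimal.of_conj (h := h) (flagMinimal_of_regMat (hΓ.conj h) (c := |t r₀|) ?_)
  intro n τ
  set q := n • p₀.toAdd
  set m := ⌊(τ - t q) / t r₀⌋
  have hS : S (q + m • r₀) = n := by
    rw [map_add, hSm, map_nsmul, ← hs₀]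
    simp
  have ht : t (q + m • r₀) = t q + m * t r₀ := by
    rw [(hadd _ _).2, hSm, mul_zero, add_zero, htm]
  refine ⟨t (q + m • r₀), ?_, h⁻¹ * φ (.ofAdd (q + m • r₀)) * h, ?_, ?_⟩
  · have e : t (q + m • r₀) - τ = -(Int.fract ((τ - t q) / t r₀) * t r₀) := by
      rw [ht, ← Int.self_sub_floor, sub_mul, div_mul_cancel₀ _ htr₀]
      ring
    rw [e, abs_neg, abs_mul, abs_of_nonneg (Int.fract_nonneg _)]
    exact mul_le_of_le_one_left (abs_nonneg _) (Int.fract_lt_one _).le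
  · rw [mem_conj]
    have e : ∀ k, h * (h⁻¹ * k * h) * h⁻¹ = k := fun k => by group
    rw [e]
    exact hφΓ _
  · rw [hst, hS]

/-! ### Unipotent free abelian groups of rank two without regular elements -/

/-- An integral vector, viewed as a real vector. -/
def intVec (z : Fin 3 → ℤ) : Vec := fun i => z i

theorem intVec_ne_zero {z : Fin 3 → ℤ} (hz : z ≠ 0) : intVec z ≠ 0 := by
  intro h
  apply hz
  ext i
  have := congrFun h i
  simpa [intVec] using this

theorem intVec_dotProduct (x y : Fin 3 → ℤ) : intVec x ⬝ᵥ intVec y = ((x ⬝ᵥ y : ℤ) : ℝ) := by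
  simp [intVec, dotProduct, Fin.sum_univ_three]

theorem cross_intVec (x y : Fin 3 → ℤ) :
    crossProduct (intVec x) (intVec y) = intVec (crossProduct x y) := by
  ext i
  fin_cases i <;> simp [intVec, cross_apply]

theorem exists_mulVec_intVec {g : SL(3, ℝ)} (hg : g ∈ integerSL3) (z : Fin 3 → ℤ) :
    ∃ w, mat g *ᵥ intVec z = intVec w := by
  obtain ⟨A, hA⟩ := exists_intMatrix hg
  refine ⟨A *ᵥ z, ?_⟩
  ext i
  simp [hA, intVec, mulVec, dotProduct, Fin.sum_univ_three]

/-- `Γ` contains a lattice of transvections with centre `x`. -/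
def HasTranslations (Γ : Subgroup SL(3, ℝ)) (x f g : Fin 3 → ℤ) : Prop :=
  f ⬝ᵥ x = 0 ∧ g ⬝ᵥ x = 0 ∧ crossProduct f g ≠ 0 ∧
    ∀ m n : ℤ, ∃ u ∈ Γ, mat u = transMat 1 (intVec x) (intVec (m • f + n • g))

theorem HasTranslations.exists_mulVec_eq {Γ : Subgroup SL(3, ℝ)} (hint : Γ ≤ integerSL3)
    {x f g : Fin 3 → ℤ} (h : HasTranslations Γ x f g) {k : SL(3, ℝ)} (hk : k ∈ Γ)
    {w p q : Vec} (hw : mat k *ᵥ intVec x = w) (hp : ∃ p', p = intVec p') (hq : ∃ q', q = intVec q')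
    (hdet : crossProduct p q ⬝ᵥ w ≠ 0) :
    ∃ D : ℤ, D ≠ 0 ∧ ∀ m n : ℤ, ∃ T ∈ Γ, mat T *ᵥ w = w ∧
      mat T *ᵥ p = p + (D * m : ℝ) • w ∧ mat T *ᵥ q = q + (D * n : ℝ) • w := by
  obtain ⟨p₀, rfl⟩ := hp
  obtain ⟨q₀, rfl⟩ := hq
  obtain ⟨hf, hg, hfg, hu⟩ := h
  obtain ⟨p', hp'⟩ := exists_mulVec_intVec (inv_mem (hint hk)) p₀
  obtain ⟨q', hq'⟩ := exists_mulVec_intVec (inv_mem (hint hk)) q₀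
  have hkp : intVec p₀ = mat k *ᵥ intVec p' := by rw [← hp', mulVec_inv_mulVec]
  have hkq : intVec q₀ = mat k *ᵥ intVec q' := by rw [← hq', mulVec_inv_mulVec]
  set D := (f ⬝ᵥ p') * (g ⬝ᵥ q') - (g ⬝ᵥ p') * (f ⬝ᵥ q') with hD
  have hT : ∀ (u : SL(3, ℝ)) (φ : Fin 3 → ℤ) (v : Fin 3 → ℤ), mat u = transMat 1 (intVec x) (intVec φ) →
      mat (k * u * k⁻¹) *ᵥ (mat k *ᵥ intVec v) = mat k *ᵥ intVec v + ((φ ⬝ᵥ v : ℤ) : ℝ) • w := by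
    intro u φ v h
    rw [mat_mul, ← mulVec_mulVec, inv_mulVec_mulVec, mat_mul, ← mulVec_mulVec, h, transMat_mulVec,
      mulVec_add, mulVec_smul, hw, one_mul, intVec_dotProduct]
  refine ⟨D, ?_, fun m n => ?_⟩
  · intro hD0
    have hcross : crossProduct p' q' ⬝ᵥ x ≠ 0 := by
      intro h0
      apply hdet
      rw [hkp, hkq, cross_mulVec, ← hw, ← dotProduct_mulVec, inv_mulVec_mulVec, cross_intVec,
        intVec_dotProduct, h0, Int.cast_zero]
    have h1 : crossProduct f g ⬝ᵥ crossProduct p' q' = 0 := by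
      rw [cross_dot_cross, ← hD0, hD]
      ring
    have h2 : crossProduct (crossProduct f g) x = 0 := by
      rw [cross_cross_eq_smul_sub_smul, hf, hg, zero_smul, zero_smul, sub_self]
    have h3 : (crossProduct p' q' ⬝ᵥ x) • crossProduct f g = 0 := by
      have := cross_cross_eq_smul_sub_smul' (crossProduct p' q') (crossProduct f g) x
      rw [h2, map_zero, h1, zero_smul, sub_zero] at this
      exact this.symm
    exact hfg ((smul_eq_zero.1 h3).resolve_left hcross)
  · obtain ⟨u, huΓ, hum⟩ := hu (m * (g ⬝ᵥ q') - n * (g ⬝ᵥ p')) (n * (f ⬝ᵥ p') - m * (f ⬝ᵥ q'))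
    refine ⟨k * u * k⁻¹, mul_mem (mul_mem hk huΓ) (inv_mem hk), ?_, ?_, ?_⟩
    · rw [← hw, hT u _ x hum, add_dotProduct, smul_dotProduct, smul_dotProduct, hf, hg]
      simp
    · rw [hkp, hT u _ p' hum, add_dotProduct, smul_dotProduct, smul_dotProduct, hD]
      congr 2
      push_cast [smul_eq_mul]
      ring
    · rw [hkq, hT u _ q' hum, add_dotProduct, smul_dotProduct, smul_dotProduct, hD]
      congr 2
      push_cast [smul_eq_mul]
      ring

theorem flagMinimal_of_translations {Γ : Subgroup SL(3, ℝ)} (hint : Γ ≤ integerSL3)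
    (hΓ : IsZariskiDense (Γ : Set SL(3, ℝ))) {x f g : Fin 3 → ℤ} (hx : x ≠ 0)
    (h : HasTranslations Γ x f g) : FlagMinimal Γ := by
  have hfg := h.2.2.1
  have hf : f ≠ 0 := by
    rintro rfl
    exact hfg (by simp)
  obtain ⟨g₁, hg₁, hfy⟩ :=
    hΓ.exists_dotProduct_mulVec_ne_zero (intVec_ne_zero hx) (intVec_ne_zero hf)
  obtain ⟨y, hy⟩ : ∃ y, mat g₁ *ᵥ intVec x = y := ⟨_, rfl⟩
  obtain ⟨y', hy'⟩ := exists_mulVec_intVec (hint hg₁) x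
  have hxy : crossProduct (intVec x) y ≠ 0 := by
    intro h0
    have := cross_cross_eq_smul_sub_smul' (intVec f) (intVec x) y
    rw [h0, map_zero, dotProduct_comm _ (intVec f), intVec_dotProduct f x, h.1, Int.cast_zero,
      zero_smul, sub_zero] at this
    rw [hy] at hfy
    exact (smul_eq_zero.1 this.symm).elim hfy (intVec_ne_zero hx)
  obtain ⟨g₂, hg₂, hdet⟩ := hΓ.exists_dotProduct_mulVec_ne_zero (intVec_ne_zero hx) hxy
  obtain ⟨z, hz⟩ : ∃ z, mat g₂ *ᵥ intVec x = z := ⟨_, rfl⟩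
  obtain ⟨z', hz'⟩ := exists_mulVec_intVec (hint hg₂) x
  rw [hz] at hdet
  have hyI : ∃ y', y = intVec y' := ⟨y', hy.symm.trans hy'⟩
  have hzI : ∃ z', z = intVec z' := ⟨z', hz.symm.trans hz'⟩
  have hxI : ∃ x', intVec x = intVec x' := ⟨x, rfl⟩
  have hdet₁ : crossProduct y z ⬝ᵥ intVec x ≠ 0 := by
    rw [dotProduct_comm, triple_product_permutation, triple_product_permutation, dotProduct_comm]
    exact hdet
  have hdet₂ : crossProduct z (intVec x) ⬝ᵥ y ≠ 0 := by
    rw [dotProduct_comm, triple_product_permutation, dotProduct_comm]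
    exact hdet
  obtain ⟨D₁, hD₁, hT₁⟩ := h.exists_mulVec_eq hint (one_mem Γ) (w := intVec x)
    (by rw [mat_one, one_mulVec]) hyI hzI hdet₁
  obtain ⟨D₂, hD₂, hT₂⟩ := h.exists_mulVec_eq hint hg₁ hy hzI hxI hdet₂
  obtain ⟨D₃, hD₃, hT₃⟩ := h.exists_mulVec_eq hint hg₂ hz hxI hyI hdet
  obtain ⟨k, hk⟩ := exists_conj_eq (colMat (intVec x) y z) (by rwa [det_colMat])
  have hmem : ∀ T ∈ Γ, k⁻¹ * T * k ∈ conj k Γ := by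
    intro T hT
    rw [mem_conj]
    have : k * (k⁻¹ * T * k) * k⁻¹ = T := by group
    rwa [this]
  have hsingle : (Pi.single 0 1 : Vec) = ![1, 0, 0] := by
    ext i
    fin_cases i <;> simp
  refine FlagMinimal.of_conj (h := k) (flagMinimal_of_elementary (hΓ.conj k)
    (k := ((D₁ * D₂ * D₃ : ℤ) : ℝ)) (by simp [hD₁, hD₂, hD₃]) (fun m n => ?_) (fun m n => ?_))
  · obtain ⟨T, hT, e1, e2, e3⟩ := hT₁ (D₂ * D₃ * m) (D₂ * D₃ * n)
    refine ⟨_, hmem T hT, (hk T _).1 ?_⟩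
    rw [mul_colMat, colMat_mul, e1, e2, e3, hsingle]
    congr 1 <;> simp [transMat, vecMulVec, mul_assoc, add_comm]
  · obtain ⟨T, hT, e1, e2, e3⟩ := hT₂ 0 (D₁ * D₃ * m)
    obtain ⟨T', hT', e1', e2', e3'⟩ := hT₃ (D₁ * D₂ * n) 0
    refine ⟨_, hmem (T * T') (mul_mem hT hT'), (hk _ _).1 ?_⟩
    have ex : mat (T * T') *ᵥ intVec x = intVec x + (D₂ * (D₁ * D₃ * m : ℤ) : ℝ) • y +
        (D₃ * (D₁ * D₂ * n : ℤ) : ℝ) • z := by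
      rw [mat_mul, ← mulVec_mulVec, e2', mulVec_add, mulVec_smul, e3, e2]
      simp
    have ey : mat (T * T') *ᵥ y = y := by
      rw [mat_mul, ← mulVec_mulVec, e3']
      simp [e1]
    have ez : mat (T * T') *ᵥ z = z := by
      rw [mat_mul, ← mulVec_mulVec, e1', e2]
      simp
    rw [mul_colMat, colMat_mul, ex, ey, ez, hsingle]
    congr 1
    · simp [transMat, vecMulVec]
      module
    · simp [transMat, vecMulVec]
    · simp [transMat, vecMulVec]

theorem adjugate_eq_fin_three {R : Type*} [CommRing R] (A : Matrix (Fin 3) (Fin 3) R) :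
    A.adjugate = A * A - A.trace • A + A.adjugate.trace • 1 := by
  ext i j
  fin_cases i <;> fin_cases j <;>
    simp [Matrix.mul_apply, Fin.sum_univ_three, trace_fin_three, adjugate_fin_three] <;> ring

theorem adjugate_eq_zero_of_sq_eq_zero {A : Matrix (Fin 3) (Fin 3) ℤ} (h : A * A = 0) :
    A.adjugate = 0 := by
  have htr : A.trace = 0 :=
    (Matrix.isNilpotent_trace_of_isNilpotent ⟨2, by rw [pow_two, h]⟩).eq_zero
  have hadj := adjugate_eq_fin_three A
  rw [h, htr, zero_smul, sub_zero, zero_add] at hadj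
  have hdet : A.det = 0 := by
    have := congrArg Matrix.det h
    rw [det_mul, det_zero] at this
    exact mul_self_eq_zero.1 this
  have h1 := mul_adjugate A
  rw [hadj, hdet, zero_smul, mul_smul_comm, mul_one] at h1
  rcases smul_eq_zero.1 h1 with h2 | h2
  · rw [hadj, h2, zero_smul]
  · rw [h2, adjugate_zero]

theorem minor_eq_of_adjugate_eq_zero {A : Matrix (Fin 3) (Fin 3) ℤ} (h : A.adjugate = 0)
    (i j k l : Fin 3) : A i j * A k l = A k j * A i l := by
  rw [adjugate_fin_three] at h
  have e := fun i j => congrFun (congrFun h i) j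
  have e00 := e 0 0
  have e01 := e 0 1
  have e02 := e 0 2
  have e10 := e 1 0
  have e11 := e 1 1
  have e12 := e 1 2
  have e20 := e 2 0
  have e21 := e 2 1
  have e22 := e 2 2
  simp at e00 e01 e02 e10 e11 e12 e20 e21 e22
  clear e h
  fin_cases i <;> fin_cases j <;> fin_cases k <;> fin_cases l <;> dsimp <;> grind

theorem exists_smul_eq_vecMulVec {A : Matrix (Fin 3) (Fin 3) ℤ} (hA : A ≠ 0) (h : A * A = 0) :
    ∃ (a : ℤ) (x f : Fin 3 → ℤ), a ≠ 0 ∧ x ≠ 0 ∧ f ≠ 0 ∧ a • A = vecMulVec x f := by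
  obtain ⟨i, j, hij⟩ : ∃ i j, A i j ≠ 0 := by
    by_contra! hcon
    exact hA (by ext i j; exact hcon i j)
  refine ⟨A i j, fun k => A k j, fun l => A i l, hij, fun h0 => hij (congrFun h0 i),
    fun h0 => hij (congrFun h0 j), ?_⟩
  ext k l
  exact minor_eq_of_adjugate_eq_zero (adjugate_eq_zero_of_sq_eq_zero h) i j k l

theorem dotProduct_eq_zero_of_mul_eq_zero {A B : Matrix (Fin 3) (Fin 3) ℤ} {a b : ℤ}
    {x f y g : Fin 3 → ℤ} (hx : x ≠ 0) (hg : g ≠ 0) (hA : a • A = vecMulVec x f)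
    (hB : b • B = vecMulVec y g) (h : A * B = 0) : f ⬝ᵥ y = 0 := by
  have h1 : vecMulVec x f * vecMulVec y g = 0 := by
    rw [← hA, ← hB, smul_mul_smul_comm, h, smul_zero]
  obtain ⟨i, hi⟩ := Function.ne_iff.1 hx
  obtain ⟨j, hj⟩ := Function.ne_iff.1 hg
  have h2 : x i * (f ⬝ᵥ y) * g j = 0 := by
    have := congrFun (congrFun h1 i) j
    rw [Matrix.zero_apply] at this
    rw [← this]
    simp [vecMulVec, Matrix.mul_apply, dotProduct, Fin.sum_univ_three]
    ring
  exact (mul_eq_zero.1 ((mul_eq_zero.1 h2).resolve_right hj)).resolve_left hi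

theorem smul_eq_smul_of_cross_eq_zero {x y : Fin 3 → ℤ} (h : crossProduct x y = 0) (i : Fin 3) :
    x i • y = y i • x := by
  have e0 := congrFun h 0
  have e1 := congrFun h 1
  have e2 := congrFun h 2
  simp [cross_apply] at e0 e1 e2
  ext j
  fin_cases i <;> fin_cases j <;> simp [-mul_eq_mul_left_iff, -mul_eq_mul_right_iff] <;> grind

theorem flagMinimal_of_common_center {Γ : Subgroup SL(3, ℝ)} (hint : Γ ≤ integerSL3)
    (hΓ : IsZariskiDense (Γ : Set SL(3, ℝ))) {X Y : Matrix (Fin 3) (Fin 3) ℤ}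
    (hmem : ∀ m n : ℤ, ∃ u ∈ Γ, mat u = 1 + (m • X + n • Y).map (Int.cast : ℤ → ℝ))
    (hind : ∀ m n : ℤ, m • X = n • Y → m = 0 ∧ n = 0) {a b : ℤ} (hb : b ≠ 0)
    {x f y g : Fin 3 → ℤ} (hx : x ≠ 0) (hf : f ≠ 0)
    (hX : a • X = vecMulVec x f) (hY : b • Y = vecMulVec y g) (hfx : f ⬝ᵥ x = 0)
    (hgx : g ⬝ᵥ x = 0) (hxy : crossProduct x y = 0) : FlagMinimal Γ := by
  obtain ⟨i, hi⟩ := Function.ne_iff.1 hx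
  have hyx := smul_eq_smul_of_cross_eq_zero hxy i
  have hY' : (b * x i) • Y = vecMulVec x (y i • g) := by
    rw [mul_comm, mul_smul, hY, ← smul_vecMulVec, hyx, smul_vecMulVec, vecMulVec_smul]
  refine flagMinimal_of_translations hint hΓ hx (f := f) (g := y i • g)
    ⟨hfx, by rw [smul_dotProduct, hgx, smul_zero], ?_, fun m n => ?_⟩
  · intro h0
    obtain ⟨j, hj⟩ := Function.ne_iff.1 hf
    have h1 := smul_eq_smul_of_cross_eq_zero h0 j
    have h2 : (((y i • g) j) * a) • X = (f j * (b * x i)) • Y := by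
      rw [mul_smul, mul_smul, hX, hY', ← vecMulVec_smul, ← vecMulVec_smul, h1]
    exact mul_ne_zero hj (mul_ne_zero hb hi) (hind _ _ h2).2
  · obtain ⟨u, hu, hum⟩ := hmem (m * a) (n * (b * x i))
    refine ⟨u, hu, ?_⟩
    rw [hum, mul_smul, hX, mul_smul, hY', transMat, one_smul]
    congr 1
    ext k l
    simp [vecMulVec, intVec]
    ring

theorem flagMinimal_of_sq_eq_zero {Γ : Subgroup SL(3, ℝ)} (hint : Γ ≤ integerSL3)
    (hΓ : IsZariskiDense (Γ : Set SL(3, ℝ))) {X Y : Matrix (Fin 3) (Fin 3) ℤ}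
    (hmem : ∀ m n : ℤ, ∃ u ∈ Γ, mat u = 1 + (m • X + n • Y).map (Int.cast : ℤ → ℝ))
    (hind : ∀ m n : ℤ, m • X = n • Y → m = 0 ∧ n = 0) (hXX : X * X = 0) (hYY : Y * Y = 0)
    (hXY : X * Y = 0) (hYX : Y * X = 0) : FlagMinimal Γ := by
  have hX0 : X ≠ 0 := by
    rintro rfl
    exact one_ne_zero (hind 1 0 (by simp)).1
  have hY0 : Y ≠ 0 := by
    rintro rfl
    exact one_ne_zero (hind 0 1 (by simp)).2
  obtain ⟨a, x, f, ha, hx, hf, hX⟩ := exists_smul_eq_vecMulVec hX0 hXX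
  obtain ⟨b, y, g, hb, hy, hg, hY⟩ := exists_smul_eq_vecMulVec hY0 hYY
  have hfx := dotProduct_eq_zero_of_mul_eq_zero hx hf hX hX hXX
  have hfy := dotProduct_eq_zero_of_mul_eq_zero hx hg hX hY hXY
  have hgx := dotProduct_eq_zero_of_mul_eq_zero hy hf hY hX hYX
  have hgy := dotProduct_eq_zero_of_mul_eq_zero hy hg hY hY hYY
  by_cases hxy : crossProduct x y = 0
  · exact flagMinimal_of_common_center hint hΓ hmem hind hb hx hf hX hY hfx hgx hxy
  · have hfg : crossProduct f g = 0 := by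
      have h1 : crossProduct (crossProduct f g) x = 0 := by
        rw [cross_cross_eq_smul_sub_smul, hfx, hgx, zero_smul, zero_smul, sub_self]
      have h2 : crossProduct (crossProduct f g) y = 0 := by
        rw [cross_cross_eq_smul_sub_smul, hfy, hgy, zero_smul, zero_smul, sub_self]
      by_contra hne
      obtain ⟨i, hi⟩ := Function.ne_iff.1 hne
      have e1 := smul_eq_smul_of_cross_eq_zero h1 i
      have e2 := smul_eq_smul_of_cross_eq_zero h2 i
      apply hxy
      have h3 : ((crossProduct f g) i * (crossProduct f g) i) • crossProduct x y = 0 := by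
        have : crossProduct ((crossProduct f g) i • x) ((crossProduct f g) i • y) = 0 := by
          rw [e1, e2, map_smul, map_smul, LinearMap.smul_apply, cross_self, smul_zero, smul_zero]
        rwa [map_smul, map_smul, LinearMap.smul_apply, smul_smul] at this
      exact (smul_eq_zero.1 h3).resolve_left (mul_ne_zero hi hi)
    refine FlagMinimal.of_dual (flagMinimal_of_common_center (Γ := dual Γ) (X := Xᵀ) (Y := Yᵀ) (a := a)
      ?_ hΓ.dual ?_ ?_ hb hf hx ?_ ?_ ((dotProduct_comm _ _).trans hfx)
      ((dotProduct_comm _ _).trans hfy) hfg)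
    · intro u hu
      obtain ⟨A, hA⟩ := hint (mem_dual.1 hu)
      refine ⟨A.transpose, mat_injective ?_⟩
      have h1 : mat u = (mat u.transpose)ᵀ := by rw [mat_transpose, transpose_transpose]
      rw [h1, ← hA]
      rfl
    · intro m n
      obtain ⟨u, hu, hum⟩ := hmem m n
      refine ⟨u.transpose, transpose_mem_dual hu, ?_⟩
      rw [mat_transpose, hum, transpose_add, transpose_one, ← transpose_smul, ← transpose_smul,
        ← transpose_add, transpose_map]
    · intro m n h
      rw [← transpose_smul, ← transpose_smul] at h
      exact hind m n (transpose_injective h)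
    · rw [← transpose_smul, hX, transpose_vecMulVec]
    · rw [← transpose_smul, hY, transpose_vecMulVec]

theorem flagMinimal_of_commuting_sq_eq_zero {Γ : Subgroup SL(3, ℝ)} (hint : Γ ≤ integerSL3)
    (hΓ : IsZariskiDense (Γ : Set SL(3, ℝ))) {φ : Multiplicative (ℤ × ℤ) →* SL(3, ℝ)}
    (hφ : Function.Injective φ) (hφΓ : ∀ p, φ p ∈ Γ) (h2 : ∀ p, (mat (φ p) - 1) ^ 2 = 0) :
    FlagMinimal Γ := by
  choose A hA using fun p : ℤ × ℤ => exists_intCast_apply_eq (hint (hφΓ (.ofAdd p)))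
  have hinj : Function.Injective fun B : Matrix (Fin 3) (Fin 3) ℤ => B.map (Int.cast : ℤ → ℝ) :=
    Matrix.map_injective Int.cast_injective
  have hA' : ∀ p, mat (φ (.ofAdd p)) = 1 + (A p).map (Int.cast : ℤ → ℝ) := fun p => by
    rw [← hA]; abel
  have hsq : ∀ p, A p * A p = 0 := by
    intro p
    apply hinj
    have := h2 (.ofAdd p)
    rw [hA, pow_two, ← Matrix.map_mul_intCast] at this
    change (A p * A p).map (Int.cast : ℤ → ℝ) = _
    rw [this]
    ext i j
    simp
  have hadd' : ∀ p q, A (p + q) = A p + A q + A p * A q := by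
    intro p q
    apply hinj
    have e := hA' (p + q)
    rw [ofAdd_add, map_mul, mat_mul, hA', hA'] at e
    have e' : (A (p + q)).map (Int.cast : ℤ → ℝ) = (A p).map (Int.cast : ℤ → ℝ) +
        (A q).map (Int.cast : ℤ → ℝ) + (A p).map (Int.cast : ℤ → ℝ) *
          (A q).map (Int.cast : ℤ → ℝ) := by
      rw [← add_right_inj (1 : Matrix (Fin 3) (Fin 3) ℝ), ← e]
      noncomm_ring
    rw [← Matrix.map_mul_intCast] at e'
    change (A (p + q)).map (Int.cast : ℤ → ℝ) = _
    rw [e']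
    ext i j
    simp
  have hcomm : ∀ p q, A q * A p = A p * A q := by
    intro p q
    have e1 := hadd' p q
    rw [add_comm p q, hadd' q p, add_comm (A q)] at e1
    exact add_left_cancel e1
  have hmul : ∀ p q, A p * A q = 0 := by
    intro p q
    have e := hsq (p + q)
    rw [hadd'] at e
    have e1 : A p * (A p * A q) = 0 := by rw [← mul_assoc, hsq, zero_mul]
    have e2 : A p * A q * A q = 0 := by rw [mul_assoc, hsq, mul_zero]
    have e3 : A q * (A p * A q) = 0 := by rw [← mul_assoc, hcomm, e2]
    have e4 : A p * A q * A p = 0 := by rw [mul_assoc, hcomm, e1]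
    have e5 : A p * A q * (A p * A q) = 0 := by rw [← mul_assoc, e4, zero_mul]
    simp only [add_mul, mul_add, hsq, e1, e2, e3, e4, e5, hcomm p q, zero_add, add_zero] at e
    have e6 : (2 : ℤ) • (A p * A q) = 0 := by rw [two_smul, e]
    exact (smul_eq_zero.1 e6).resolve_left two_ne_zero
  obtain ⟨F, rfl⟩ : ∃ F : ℤ × ℤ →+ Matrix (Fin 3) (Fin 3) ℤ, A = F :=
    ⟨AddMonoidHom.mk' A fun p q => by rw [hadd', hmul, add_zero], rfl⟩
  have hF : ∀ m n : ℤ, m • F (1, 0) + n • F (0, 1) = F (m, n) := by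
    intro m n
    rw [← map_zsmul, ← map_zsmul, ← map_add]
    congr 1
    ext <;> simp
  have h0 : ∀ p, F p = 0 → p = 0 := by
    intro p hp
    have h1 : φ (.ofAdd p) = 1 := by
      apply mat_injective
      rw [hA', hp, mat_one]
      ext i j
      simp
    exact ofAdd_eq_one.1 (hφ (h1.trans φ.map_one.symm))
  refine flagMinimal_of_sq_eq_zero hint hΓ (X := F (1, 0)) (Y := F (0, 1)) ?_ ?_ (hsq _) (hsq _)
    (hmul _ _) (hmul _ _)
  · intro m n
    exact ⟨φ (.ofAdd (m, n)), hφΓ _, by rw [hA', hF]⟩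
  · intro m n h
    have h1 := h0 (m, -n) (by rw [← hF, h, neg_smul, add_neg_cancel])
    exact ⟨congrArg Prod.fst h1, by simpa using congrArg Prod.snd h1⟩

/-! ### The three conditions -/

theorem flagMinimal_of_free_abelian {Γ : Subgroup SL(3, ℝ)} (hint : Γ ≤ integerSL3)
    (hΓ : IsZariskiDense (Γ : Set SL(3, ℝ))) {H : Subgroup SL(3, ℝ)} (hH : H ≤ Γ)
    (e : H ≃* Multiplicative (ℤ × ℤ)) : FlagMinimal Γ := by
  set φ : Multiplicative (ℤ × ℤ) →* SL(3, ℝ) := H.subtype.comp e.symm.toMonoidHom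
  have hφ : Function.Injective φ := H.subtype_injective.comp e.symm.injective
  have hφΓ : ∀ p, φ p ∈ Γ := fun p => hH (e.symm p).2
  have hsq : ∀ p : Multiplicative (ℤ × ℤ), ∀ n : ℕ, n ≠ 0 → p ^ n = 1 → p = 1 := by
    intro p n hn h
    have h' : n • p.toAdd = 0 := congrArg Multiplicative.toAdd h
    exact congrArg Multiplicative.ofAdd ((smul_eq_zero.1 h').resolve_left hn)
  by_cases hA : ∃ (p : _) (μ : ℂ) (w : Fin 3 → ℂ), μ.im ≠ 0 ∧ IsComplexEigenvector (φ p) μ w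
  · obtain ⟨p, μ, w, hμ, hw⟩ := hA
    refine flagMinimal_of_complex_eigenvector hint hΓ (hφΓ p) ?_ hμ hw
    intro hfin
    obtain ⟨n, hn, hpn⟩ := isOfFinOrder_iff_pow_eq_one.1 hfin
    rw [← map_pow, ← map_one φ] at hpn
    have hp1 := hsq p n hn.ne' (hφ hpn)
    obtain ⟨hw0, hw⟩ := hw
    rw [hp1, map_one, mat_one] at hw
    have h1 : (1 - μ) • w = 0 := by
      rw [sub_smul, one_smul, ← hw, Matrix.map_one _ Complex.ofReal_zero Complex.ofReal_one,
        one_mulVec, sub_self]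
    rw [← sub_eq_zero.1 ((smul_eq_zero.1 h1).resolve_right hw0)] at hμ
    exact hμ Complex.one_im
  by_cases hB : ∃ (p : _) (k : SL(3, ℝ)) (d : Fin 3 → ℝ), Function.Injective d ∧
      mat (k⁻¹ * φ p * k) = diagonal d
  · obtain ⟨p, k, d, hd, hk⟩ := hB
    exact flagMinimal_of_commuting_diagonal hint hΓ hφ hφΓ hd hk
  set ψ := φ.comp (powMonoidHom 2) with hψ
  have hψφ : ∀ p, ψ p = φ p * φ p := fun p => by rw [← map_mul, ← pow_two]; rfl
  have hψi : Function.Injective ψ := by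
    refine hφ.comp ((injective_iff_map_eq_one _).2 fun p hp => hsq p 2 two_ne_zero hp)
  have h3 : ∀ p, (mat (ψ p) - 1) ^ 3 = 0 := by
    intro p
    rcases eigenvalue_trichotomy (φ p) with h | h | ⟨r, q, ht, hs, hq⟩
    · exact absurd ⟨p, h⟩ hA
    · exact absurd ⟨p, h⟩ hB
    · rw [hψφ]
      exact sq_sub_one_pow_three_eq_zero (hint (hφΓ p)) ht hs hq
  by_cases h2 : ∀ p, (mat (ψ p) - 1) ^ 2 = 0
  · exact flagMinimal_of_commuting_sq_eq_zero hint hΓ hψi (fun p => hφΓ _) h2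
  · push Not at h2
    obtain ⟨p, hp⟩ := h2
    exact flagMinimal_of_commuting_regular hint hΓ hψi (fun p => hφΓ _) (h3 p) hp

theorem flagMinimal_of_isStandardSL2Z {Γ : Subgroup SL(3, ℝ)}
    (hΓ : IsZariskiDense (Γ : Set SL(3, ℝ))) {H : Subgroup SL(3, ℝ)} (hH : H ≤ Γ)
    (h : IsStandardSL2Z H) : FlagMinimal Γ := by
  obtain ⟨k, rfl⟩ := h
  refine FlagMinimal.of_conj (h := k) (flagMinimal_of_blockSL2 (hΓ.conj k) fun A => ?_)
  rw [mem_conj]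
  exact hH ⟨A, rfl⟩

end SLThree

theorem theorem5p1 (Γ : Subgroup (Matrix.SpecialLinearGroup (Fin 3) ℝ))
    (hΓ : Γ ≤ SLThree.integerSL3)
    (hZ : SLThree.IsZariskiDense (Γ : Set (Matrix.SpecialLinearGroup (Fin 3) ℝ)))
    (h : (∃ H : Subgroup (Matrix.SpecialLinearGroup (Fin 3) ℝ),
            H ≤ Γ ∧ Nonempty (H ≃* Multiplicative (ℤ × ℤ))) ∨
         (∃ H : Subgroup (Matrix.SpecialLinearGroup (Fin 3) ℝ),
            H ≤ Γ ∧ SLThree.IsStandardSL2Z H) ∨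
         (∃ γ ∈ Γ, ¬ IsOfFinOrder γ ∧
            ∃ μ : ℂ, μ.im ≠ 0 ∧ SLThree.HasComplexEigenvalue γ μ)) :
    MulAction.IsMinimal Γ
        (Matrix.SpecialLinearGroup (Fin 3) ℝ ⧸ SLThree.minimalParabolic 3) ∧
      MulAction.IsMinimal (SLThree.minimalParabolic 3) (SLThree.RightCosets Γ) := by
  have hmin : SLThree.FlagMinimal Γ := by
    rcases h with ⟨H, hH, ⟨e⟩⟩ | ⟨H, hH, hstd⟩ | ⟨γ, hγ, hord, μ, hμ, hev⟩
    · exact SLThree.flagMinimal_of_free_abelian hΓ hZ hH e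
    · exact SLThree.flagMinimal_of_isStandardSL2Z hZ hH hstd
    · obtain ⟨w, hw⟩ := hev.exists_eigenvector
      exact SLThree.flagMinimal_of_complex_eigenvector hΓ hZ hγ hord hμ hw
  exact ⟨hmin.isMinimal, SLThree.isMinimal_rightCosets Γ _ hmin.isMinimal⟩
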